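/- Let $\mathfrak g$ be a finite-dimensional semisimple complex Lie algebra with a Cartan subalgebra $\mathfrak h$ and a choice of simple roots, let $\mathfrak n_+$ be the sum of the positive root spaces, and let $Q_+\subset\mathfrak h^*$ be the monoid of sums of positive roots. For $\lambda\in\mathfrak h^*$ let $M_\lambda$ be the Verma module, i.e. the quotient of $U(\mathfrak g)$ by the left ideal generated by $\mathfrak n_+$ and the elements $h-\lambda(h)$, $h\in\mathfrak h$, and let $L_\lambda$ be its irreducible quotient, i.e. the quotient of $M_\lambda$ by the sum of all its proper submodules. Let $\mathcal O$ be the category of finitely generated $\mathfrak g$-modules which are direct sums of their $\mathfrak h$-weight spaces and whose weights lie in a finite union of sets $\lambda_i-Q_+$. A standard filtration of an object of $\mathcal O$ is a finite filtration by submodules whose successive quotients are Verma modules; an object which admits one is called standardly filtered. \begin{theorem}[BGG reciprocity] Every Verma module $M_\mu$ has finite length; let $d_{\mu\lambda}=[M_\mu:L_\lambda]$ be the multiplicity of $L_\lambda$ in its Jordan--Hölder series. Every $L_\lambda$ has a projective cover $P_\lambda$ in $\mathcal O$. Every such $P_\lambda$ is standardly filtered, and in every standard filtration of $P_\lambda$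 the number $d^*_{\lambda\mu}$ of successive quotients isomorphic to $M_\mu$ is given by $$d^*_{\lambda\mu}=d_{\mu\lambda}\qquad(\lambda,\mu\in\mathfrak h^*).$$ Consequently, for every $\lambda$ only finitely many of the numbers $d_{\nu\lambda}$ $(\nu\in\mathfrak h^*)$ are nonzero, the spaces $\mathrm{Hom}_{\mathfrak g}(P_\lambda,P_\mu)$ are finite-dimensional, and the entries $c_{\lambda\mu}=\dim\mathrm{Hom}_{\mathfrak g}(P_\lambda,P_\mu)$ of the Cartan matrix $C$ of $\mathcal O$ satisfy $$c_{\lambda\mu}=\sum_{\nu\in\mathfrak h^*}d_{\nu\lambda}d_{\nu\mu},$$ that is, $C=D^TD$ where $D=(d_{\lambda\mu})$. \end{theorem} -/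

import Mathlib

open LieAlgebra LieAlgebra.IsKilling Module

universe u v w

noncomputable section

namespace CatO

section Multiplicities

variable {R : Type u} [Ring R] {M : Type v} [AddCommGroup M] [Module R M]

/-- The subquotient `B / A` attached to submodules `A ≤ B` of a module. -/
abbrev Subquotient (A B : Submodule R M) : Type v := ↥B ⧸ A.submoduleOf B

/-- The number of factors of a composition series of submodules which are isomorphic to `S`. -/
def factorCount (s : CompositionSeries (Submodule R M))
    (S : Type w) [AddCommGroup S] [Module R S] : ℕ :=
  Nat.card {i : Fin s.length // Nonempty (Subquotient (s i.castSucc) (s i.succ) ≃ₗ[R] S)}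

variable (R M) in
/-- The Jordan-Hölder multiplicity `[M : S]`: the number of factors isomorphic to `S` in a
composition series of `M` (the same for each of them, see `jhMult_eq`). It is only meaningful for
modules `M` of finite length. -/
def jhMult (S : Type w) [AddCommGroup S] [Module R S] : ℕ :=
  sInf {n | ∃ s : CompositionSeries (Submodule R M),
    s.head = ⊥ ∧ s.last = ⊤ ∧ factorCount s S = n}

theorem factorCount_eq_of_equivalent {s t : CompositionSeries (Submodule R M)}
    (h : s.Equivalent t) (S : Type w) [AddCommGroup S] [Module R S] :
    factorCount s S = factorCount t S := by
  obtain ⟨e, he⟩ := h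
  refine Nat.card_congr (e.subtypeEquiv fun i => ?_)
  have hi : Nonempty (Subquotient (s i.castSucc) (s i.succ) ≃ₗ[R]
      Subquotient (t (e i).castSucc) (t (e i).succ)) :=
    JordanHolderLattice.Iso.rel
      (e := fun x y => Nonempty (Subquotient x.1 x.2 ≃ₗ[R] Subquotient y.1 y.2))
      ⟨LinearEquiv.refl _ _⟩ (fun ⟨f⟩ => ⟨f.symm⟩) (fun ⟨f⟩ ⟨g⟩ => ⟨f.trans g⟩)
      (fun {x y} _ => by
        rw [sup_comm, inf_comm]
        exact ⟨(LinearMap.quotientInfEquivSupQuotient y x).symm⟩) (he i)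
  obtain ⟨f⟩ := hi
  exact ⟨fun ⟨g⟩ => ⟨f.symm.trans g⟩, fun ⟨g⟩ => ⟨f.trans g⟩⟩

/-- Every composition series of `M` computes the Jordan-Hölder multiplicity. -/
theorem jhMult_eq (s : CompositionSeries (Submodule R M)) (h₀ : s.head = ⊥) (h₁ : s.last = ⊤)
    (S : Type w) [AddCommGroup S] [Module R S] : jhMult R M S = factorCount s S := by
  have h : {n | ∃ t : CompositionSeries (Submodule R M),
      t.head = ⊥ ∧ t.last = ⊤ ∧ factorCount t S = n} = {factorCount s S} := by
    ext n
    constructor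
    · rintro ⟨t, h₂, h₃, rfl⟩
      exact factorCount_eq_of_equivalent
        (t.jordan_holder s (h₂.trans h₀.symm) (h₃.trans h₁.symm)) S
    · rintro rfl
      exact ⟨s, h₀, h₁, rfl⟩
  rw [jhMult, h, csInf_singleton]

end Multiplicities

variable {L : Type u} [LieRing L] [LieAlgebra ℂ L] [FiniteDimensional ℂ L] [IsSemisimple ℂ L]
  {H : LieSubalgebra ℂ L} [H.IsCartanSubalgebra]

variable (L) in
/-- The universal enveloping algebra. Modules over it are the same as `L`-modules. -/
abbrev Ug : Type u := UniversalEnvelopingAlgebra ℂ L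

/-- The space `M[μ]` of vectors `v` such that `h v = μ(h) v` for all `h` in the Cartan subalgebra. -/
def weightSpace (M : Type v) [AddCommGroup M] [Module (Ug L) M] (μ : Dual ℂ H) :
    AddSubgroup M where
  carrier := {v | ∀ h : H, UniversalEnvelopingAlgebra.ι ℂ (h : L) • v =
    algebraMap ℂ (Ug L) (μ h) • v}
  zero_mem' h := by simp
  add_mem' hv hw h := by rw [smul_add, smul_add, hv h, hw h]
  neg_mem' hv h := by rw [smul_neg, smul_neg, hv h]

/-- The monoid `Q₊` of sums of positive roots, that is, of sums of simple roots. -/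
def Qpos (b : (rootSystem H).Base) : AddSubmonoid (Dual ℂ H) :=
  AddSubmonoid.closure ((rootSystem H).root '' b.support)

/-- The left ideal of the enveloping algebra generated by the elements `h - μ(h)`, `h` in the
Cartan subalgebra, and by the positive root vectors. -/
def vermaIdeal (b : (rootSystem H).Base) (μ : Dual ℂ H) : Submodule (Ug L) (Ug L) :=
  Submodule.span (Ug L)
    ({y | ∃ h : H, y = UniversalEnvelopingAlgebra.ι ℂ (h : L) - algebraMap ℂ (Ug L) (μ h)} ∪
     {y | ∃ α : H.root, b.IsPos α ∧
        ∃ x ∈ rootSpace H (α : LieModule.Weight ℂ H L), y = UniversalEnvelopingAlgebra.ι ℂ x})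

/-- The Verma module `M_μ` with highest weight `μ`. -/
abbrev Verma (b : (rootSystem H).Base) (μ : Dual ℂ H) : Type u := Ug L ⧸ vermaIdeal b μ

/-- The irreducible highest weight module `L_μ`: the quotient of the Verma module `M_μ` by the sum
of all its proper submodules. -/
abbrev Irr (b : (rootSystem H).Base) (μ : Dual ℂ H) : Type u :=
  Verma b μ ⧸ sSup {N : Submodule (Ug L) (Verma b μ) | N ≠ ⊤}

/-- Membership in category `O`: finitely generated modules which are spanned by their weight
vectors and whose weights lie in a finite union of sets of the form `ν - Q₊`. -/
def IsCategoryO (b : (rootSystem H).Base) (M : Type v) [AddCommGroup M] [Module (Ug L) M] : Prop :=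
  Module.Finite (Ug L) M ∧
  (⨆ μ : Dual ℂ H, weightSpace M μ) = ⊤ ∧
  ∃ S : Finset (Dual ℂ H), ∀ μ : Dual ℂ H, weightSpace M μ ≠ ⊥ → ∃ ν ∈ S, ν - μ ∈ Qpos b

/-- Projective objects of category `O`. Epimorphisms in `O` are the surjective homomorphisms. -/
def IsProjectiveO (b : (rootSystem H).Base) (P : Type u) [AddCommGroup P] [Module (Ug L) P] :
    Prop :=
  IsCategoryO b P ∧
  ∀ (M N : Type u) [AddCommGroup M] [Module (Ug L) M] [AddCommGroup N] [Module (Ug L) N],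
    IsCategoryO b M → IsCategoryO b N →
    ∀ (g : M →ₗ[Ug L] N) (f : P →ₗ[Ug L] N), Function.Surjective g →
      ∃ f' : P →ₗ[Ug L] M, g ∘ₗ f' = f

/-- `P` is a projective cover of `L_μ` in category `O`: it is projective in `O` and has a surjection
onto `L_μ` with superfluous kernel. -/
def IsProjectiveCover (b : (rootSystem H).Base) (μ : Dual ℂ H) (P : Type u) [AddCommGroup P]
    [Module (Ug L) P] : Prop :=
  IsProjectiveO b P ∧
  ∃ π : P →ₗ[Ug L] Irr b μ, Function.Surjective π ∧
    ∀ N : Submodule (Ug L) P, N ⊔ LinearMap.ker π = ⊤ → N = ⊤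

/-- A standard (Verma) filtration of `M`: a finite filtration by submodules whose successive
quotients are Verma modules. -/
structure StandardFiltration (b : (rootSystem H).Base) (M : Type v) [AddCommGroup M]
    [Module (Ug L) M] where
  length : ℕ
  sub : Fin (length + 1) → Submodule (Ug L) M
  sub_zero : sub 0 = ⊥
  sub_last : sub (Fin.last length) = ⊤
  sub_le : ∀ i : Fin length, sub i.castSucc ≤ sub i.succ
  quot : ∀ i : Fin length, ∃ μ : Dual ℂ H,
    Nonempty (Subquotient (sub i.castSucc) (sub i.succ) ≃ₗ[Ug L] Verma b μ)

/-- The number of successive quotients of a standard filtration which are isomorphic to `M_μ`. -/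
def StandardFiltration.mult {b : (rootSystem H).Base} {M : Type v} [AddCommGroup M]
    [Module (Ug L) M] (F : StandardFiltration b M) (μ : Dual ℂ H) : ℕ :=
  Nat.card {i : Fin F.length //
    Nonempty (Subquotient (F.sub i.castSucc) (F.sub i.succ) ≃ₗ[Ug L] Verma b μ)}

/-- The decomposition matrix `D`, with entries `d_{μ ν} = [M_μ : L_ν]`. -/
def decompMatrix (b : (rootSystem H).Base) : Matrix (Dual ℂ H) (Dual ℂ H) ℕ :=
  fun μ ν => jhMult (Ug L) (Verma b μ) (Irr b ν)

end CatO

end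

/-! The core is a module for which reciprocity can be read off by counting. Take the universal
module on a vector of weight λ and kill all monomials of large height in the positive root vectors
(`BQ`). By PBW it has a Verma filtration in which M_μ occurs once for each surviving exponent d with
μ = λ + wt(d) (`stdF_QMod`). Let `BP` be the generalized eigenspace of the Casimir element in it,
for the scalar by which the Casimir acts on M_λ. If the truncation lies beyond every weight λ + β, β
∈ Q₊, with the same Casimir scalar, then homomorphisms from `BP` to an object of O are its weight-λ
vectors in that generalized eigenspace. Hence `BP` is projective (`isProjectiveO_BP`). For μ with
the same Casimir scalar as λ, M_μ occurs p(μ - λ) times in `BP`, p being Kostant's partition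
function, and dim Hom(BP, M_μ) = dim M_μ[λ] = p(μ - λ) as well; for other μ both numbers vanish
(`count_stdF_BP`). Thus Verma modules themselves stand on the Hom side, and neither dual Verma
modules nor Ext groups enter.

Both numbers are additive over direct sums, and direct summands inherit Verma filtrations with
well-defined multiplicities (`StdF.retract`, `StdF.perm`). The cover P_λ is a summand of `BP`, and
its complement is a sum of covers P_ν with ν > λ and the same Casimir scalar. There are finitely
many such ν, so induction and subtraction give (P_λ : M_μ) = dim Hom(P_λ, M_μ)
(`IsProjectiveCover.recip`). Since Hom(P_λ, -) is exact on O and detects only L_λ among the simples,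
this dimension is [M_μ : L_λ]; summing it along a Verma filtration of P_μ gives C = DᵀD.

All finiteness comes from the Casimir scalar (μ, μ + 2ρ): along λ ± Q₊ it is a positive definite
quadratic form plus affine terms, so it takes each value finitely often (`finite_quadratic`). This
bounds the truncation and gives Verma modules, then all of O, finite length (`isFin_verma`,
`isFin_of_catO`). PBW itself is proved from the comultiplication of the enveloping algebra. -/

noncomputable section

namespace CatO

/-! ### Straightening words in generators that commute up to linear terms. -/

section Words

variable {K : Type*} {A : Type*} {ι : Type*} {Γ : Type*} [Field K] [Ring A] [Algebra K A]
  [AddCommMonoid Γ] (x : ι → A) (d : ι → Γ)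

variable (K) in
/-- The span of the words in the `x i` of length less than `n` and degree `γ`. -/
def wordFil (n : ℕ) (γ : Γ) : Submodule K A :=
  Submodule.span K {y | ∃ w : List ι, w.length < n ∧ (w.map d).sum = γ ∧ (w.map x).prod = y}

variable {x d}

theorem word_mem_wordFil {w : List ι} {n : ℕ} (h : w.length < n) :
    (w.map x).prod ∈ wordFil K x d n (w.map d).sum :=
  Submodule.subset_span ⟨w, h, rfl, rfl⟩

theorem mul_mem_wordFil (i : ι) {n : ℕ} {γ : Γ} {y : A} (hy : y ∈ wordFil K x d n γ) :
    x i * y ∈ wordFil K x d (n + 1) (d i + γ) := by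
  induction hy using Submodule.span_induction with
  | mem y hy =>
    obtain ⟨w, hw, rfl, rfl⟩ := hy
    exact Submodule.subset_span ⟨i :: w, by simpa using hw, by simp, by simp⟩
  | zero => simp
  | add y z _ _ hy hz => rw [mul_add]; exact add_mem hy hz
  | smul c y _ hy => rw [mul_smul_comm]; exact Submodule.smul_mem _ _ hy

theorem wordFil_mono {m n : ℕ} (h : m ≤ n) (γ : Γ) : wordFil K x d m γ ≤ wordFil K x d n γ :=
  Submodule.span_mono fun _ ⟨w, h₁, h₂⟩ => ⟨w, h₁.trans_le h, h₂⟩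

/-- If the `x i` commute up to linear terms, words which are permutations of each other agree up to
shorter words. -/
theorem word_sub_word_mem_of_perm
    (hx : ∀ i j, x i * x j - x j * x i ∈ Submodule.span K (x '' {k | d k = d i + d j}))
    {w w' : List ι} (h : w.Perm w') :
    (w.map x).prod - (w'.map x).prod ∈ wordFil K x d w.length (w.map d).sum := by
  induction h with
  | nil => simp
  | cons i _ ih =>
    have := mul_mem_wordFil (x := x) (d := d) i ih
    simpa [mul_sub] using this
  | swap i j l =>
    have key : ∀ y ∈ Submodule.span K (x '' {k | d k = d j + d i}),
        y * (l.map x).prod ∈ wordFil K x d (l.length + 2) (d j + d i + (l.map d).sum) := by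
      intro y hy
      induction hy using Submodule.span_induction with
      | mem y hy =>
        obtain ⟨k, hk, rfl⟩ := hy
        refine Submodule.subset_span ⟨k :: l, by simp, ?_, by simp⟩
        simp only [Set.mem_ofPred_eq] at hk
        simp [hk]
      | zero => simp
      | add y z _ _ hy hz => rw [add_mul]; exact add_mem hy hz
      | smul c y _ hy => rw [smul_mul_assoc]; exact Submodule.smul_mem _ _ hy
    have := key _ (hx j i)
    simpa [sub_mul, mul_assoc, add_assoc] using this
  | trans h₁ h₂ ih₁ ih₂ =>
    rw [← h₁.length_eq, ← (h₁.map d).sum_eq] at ih₂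
    simpa using add_mem ih₁ ih₂

/-- Straightening: every word is a combination of normally ordered words of the same degree. -/
theorem word_mem_span {T : Type*} {rep : T → List ι}
    (hrep : ∀ s : Multiset ι, ∃ t, (rep t : Multiset ι) = s)
    (hx : ∀ i j, x i * x j - x j * x i ∈ Submodule.span K (x '' {k | d k = d i + d j}))
    (w : List ι) :
    (w.map x).prod ∈ Submodule.span K
      {y | ∃ t, ((rep t).map d).sum = (w.map d).sum ∧ ((rep t).map x).prod = y} := by
  induction hn : w.length using Nat.strong_induction_on generalizing w with
  | _ n ih =>
    obtain ⟨t, ht⟩ := hrep w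
    have hp : (rep t).Perm w := Multiset.coe_eq_coe.mp ht
    have h₁ := word_sub_word_mem_of_perm (K := K) hx hp.symm
    have h₂ : wordFil K x d w.length (w.map d).sum ≤ Submodule.span K
        {y | ∃ t, ((rep t).map d).sum = (w.map d).sum ∧ ((rep t).map x).prod = y} := by
      refine Submodule.span_le.mpr ?_
      rintro _ ⟨w', hw', hd, rfl⟩
      have := ih w'.length (hn ▸ hw') w' rfl
      rwa [hd] at this
    have h₃ : ((rep t).map x).prod ∈ Submodule.span K
        {y | ∃ t, ((rep t).map d).sum = (w.map d).sum ∧ ((rep t).map x).prod = y} :=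
      Submodule.subset_span ⟨t, (hp.map d).sum_eq, rfl⟩
    simpa using add_mem (h₂ h₁) h₃

end Words

/-! ### Independence of ordered monomials by means of approximate partial derivatives. -/

section Independence

variable {K : Type*} {A : Type*} {ι : Type*} [Field K] [Ring A] [Algebra K A]
  {x : ι → A}

/-- Modulo shorter words `D i` behaves as the partial derivative in `x i`. The hypothesis on `D` is
a Leibniz rule for one leading letter; reordering letters costs only shorter words. -/
theorem apply_word_sub_mem [DecidableEq ι] {D : ι → A →ₗ[K] A} (hD₀ : ∀ i, D i 1 = 0)
    (hD : ∀ i j (w : List ι), D i (x j * (w.map x).prod) - x j * D i (w.map x).prod -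
      (if i = j then (w.map x).prod else 0) ∈ wordFil K x (fun _ => ()) w.length ())
    (hx : ∀ i j, x i * x j - x j * x i ∈ Submodule.span K (Set.range x))
    (i : ι) (w : List ι) :
    D i (w.map x).prod - w.count i • ((w.erase i).map x).prod ∈
      wordFil K x (fun _ => ()) (w.length - 1) () := by
  have hx' : ∀ i j, x i * x j - x j * x i ∈
      Submodule.span K (x '' {k | (fun _ : ι => ()) k = (fun _ => ()) i + (fun _ => ()) j}) := by
    simpa using hx
  induction w with
  | nil => simp [hD₀]
  | cons j w ih =>
    have h₁ := hD i j w
    have h₂ : x j * (D i (w.map x).prod - w.count i • ((w.erase i).map x).prod) ∈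
        wordFil K x (fun _ => ()) w.length () := by
      -- For empty `w` the length `w.length - 1` is truncated to zero, so multiplication by `x j`
      -- cannot be accounted for by `mul_mem_wordFil`.
      rcases w with _ | ⟨k, w⟩
      · simp [hD₀]
      · exact mul_mem_wordFil (d := fun _ => ()) j ih
    have h₃ : (w.count i) • (x j * ((w.erase i).map x).prod - (((j :: w).erase i).map x).prod) ∈
        wordFil K x (fun _ => ()) w.length () := by
      by_cases hi : i ∈ w
      · refine nsmul_mem ?_ _
        have hp : (j :: w.erase i).Perm ((j :: w).erase i) := by
          rw [← Multiset.coe_eq_coe]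
          by_cases hij : j = i
          · subst hij
            rw [List.erase_cons_head]
            exact Multiset.coe_eq_coe.mpr (List.perm_cons_erase hi).symm
          · rw [List.erase_cons_tail (by simpa using hij)]
        have h := word_sub_word_mem_of_perm (K := K) hx' hp
        have hl : (j :: w.erase i).length = w.length := by
          rw [List.length_cons, List.length_erase_of_mem hi]
          have := List.length_pos_of_mem hi
          omega
        rw [hl] at h
        simpa using h
      · simp [List.count_eq_zero_of_not_mem hi]
    have h₄ := add_mem (add_mem h₁ h₂) h₃
    refine (congrArg (· ∈ wordFil K x (fun _ => ()) ((j :: w).length - 1) ()) ?_).mp h₄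
    by_cases hij : i = j
    · subst hij
      simp only [if_true, mul_sub, smul_sub, mul_smul_comm, List.erase_cons_head, List.count_cons_self,
        add_smul, one_smul, List.map_cons, List.prod_cons]
      abel
    · have hij' : j ≠ i := fun h => hij h.symm
      simp only [hij, if_false, mul_sub, smul_sub, mul_smul_comm, List.map_cons, List.prod_cons,
        List.count_cons_of_ne hij']
      abel

/-- Independence of the top degree parts of normally ordered words. -/
theorem coeff_eq_zero_of_sum_mem [CharZero K] [DecidableEq ι] {D : ι → A →ₗ[K] A} (hD₀ : ∀ i, D i 1 = 0)
    (hD : ∀ i j (w : List ι), D i (x j * (w.map x).prod) - x j * D i (w.map x).prod -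
      (if i = j then (w.map x).prod else 0) ∈ wordFil K x (fun _ => ()) w.length ())
    (hx : ∀ i j, x i * x j - x j * x i ∈ Submodule.span K (Set.range x))
    (h1 : (1 : A) ≠ 0) (n : ℕ) (S : Finset (Multiset ι)) (hS : ∀ s ∈ S, s.card = n)
    (c : Multiset ι → K)
    (h : ∑ s ∈ S, c s • (s.toList.map x).prod ∈ wordFil K x (fun _ => ()) n ()) :
    ∀ s ∈ S, c s = 0 := by
  have hx' : ∀ i j, x i * x j - x j * x i ∈
      Submodule.span K (x '' {k | (fun _ : ι => ()) k = (fun _ => ()) i + (fun _ => ()) j}) := by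
    simpa using hx
  induction n generalizing S c with
  | zero =>
    intro s hs
    have hs0 : s = 0 := Multiset.card_eq_zero.mp (hS s hs)
    have hS0 : S = {0} := by
      refine Finset.eq_singleton_iff_unique_mem.mpr ⟨hs0 ▸ hs, fun t ht => ?_⟩
      exact Multiset.card_eq_zero.mp (hS t ht)
    have h0 : wordFil K x (fun _ => ()) 0 () = ⊥ := by
      rw [wordFil, Submodule.span_eq_bot]
      rintro _ ⟨w, hw, -⟩
      exact absurd hw (Nat.not_lt_zero _)
    rw [h0, hS0] at h
    subst hs0
    simpa [h1] using h
  | succ n ih =>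
    intro s hs
    obtain ⟨i, hi⟩ : ∃ i, i ∈ s := Multiset.card_pos_iff_exists_mem.mp (by rw [hS s hs]; omega)
    -- Differentiation lowers the filtration by one, so the relation in degree `n + 1` becomes one
    -- in degree `n`.
    have hDF : ∀ y ∈ wordFil K x (fun _ => ()) (n + 1) (), D i y ∈ wordFil K x (fun _ => ()) n () := by
      intro y hy
      induction hy using Submodule.span_induction with
      | mem y hy =>
        obtain ⟨w, hw, -, rfl⟩ := hy
        have h₁ := apply_word_sub_mem (x := x) hD₀ hD hx i w
        have h₂ : w.count i • ((w.erase i).map x).prod ∈ wordFil K x (fun _ => ()) n () := by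
          by_cases hi : i ∈ w
          · refine nsmul_mem (word_mem_wordFil (d := fun _ => ()) ?_) _
            rw [List.length_erase_of_mem hi]
            have := List.length_pos_of_mem hi
            omega
          · simp [List.count_eq_zero_of_not_mem hi]
        simpa using add_mem (wordFil_mono (by omega) _ h₁) h₂
      | zero => simp
      | add y z _ _ hy hz => rw [map_add]; exact add_mem hy hz
      | smul c y _ hy => rw [map_smul]; exact Submodule.smul_mem _ _ hy
    have h₁ := hDF _ h
    rw [map_sum] at h₁
    have h₂ : ∀ s ∈ S, D i (c s • (s.toList.map x).prod) -
        (c s * s.count i) • ((s.erase i).toList.map x).prod ∈ wordFil K x (fun _ => ()) n () := by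
      intro s hs
      have hl : s.toList.length = n + 1 := by rw [Multiset.length_toList, hS s hs]
      have h₃ := apply_word_sub_mem (x := x) hD₀ hD hx i s.toList
      rw [hl, Nat.add_sub_cancel] at h₃
      have hc : s.toList.count i = s.count i := by
        rw [← Multiset.coe_count, Multiset.coe_toList]
      have h₄ : (s.toList.count i : K) • ((((s.toList).erase i).map x).prod -
          ((s.erase i).toList.map x).prod) ∈ wordFil K x (fun _ => ()) n () := by
        by_cases hi : i ∈ s
        · refine Submodule.smul_mem _ _ ?_
          have hp : (s.toList.erase i).Perm (s.erase i).toList := by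
            rw [← Multiset.coe_eq_coe, ← Multiset.coe_erase, Multiset.coe_toList,
              Multiset.coe_toList]
          have h := word_sub_word_mem_of_perm (K := K) hx' hp
          rw [List.length_erase_of_mem (by simpa using hi), hl] at h
          simpa using h
        · rw [hc, Multiset.count_eq_zero_of_notMem hi]
          simp
      have h₅ := Submodule.smul_mem _ (c s) (add_mem h₃ h₄)
      refine (congrArg (· ∈ wordFil K x (fun _ => ()) n ()) ?_).mp h₅
      rw [map_smul, ← Nat.cast_smul_eq_nsmul K, hc]
      simp only [smul_add, smul_sub, smul_smul]
      abel
    have h₃ := sub_mem h₁ (sum_mem h₂)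
    rw [← Finset.sum_sub_distrib] at h₃
    simp only [sub_sub_cancel] at h₃
    -- Differentiating removes one `i`. Erasure is injective on the multisets containing `i`, so no
    -- two coefficients merge.
    let S' := (S.filter (i ∈ ·)).image (·.erase i)
    have h₄ : ∑ s ∈ S, (c s * s.count i) • ((s.erase i).toList.map x).prod =
        ∑ t ∈ S', (c (i ::ₘ t) * (i ::ₘ t).count i) • (t.toList.map x).prod := by
      rw [Finset.sum_image]
      · rw [Finset.sum_filter]
        refine Finset.sum_congr rfl fun s _ => ?_
        split_ifs with hi
        · rw [Multiset.cons_erase hi]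
        · simp [Multiset.count_eq_zero_of_notMem hi]
      · intro s hs t ht hst
        have hs' := (Finset.mem_filter.mp hs).2
        have ht' := (Finset.mem_filter.mp ht).2
        simp only at hst
        rw [← Multiset.cons_erase hs', hst, Multiset.cons_erase ht']
    rw [h₄] at h₃
    have h₅ := ih S' (by
      intro t ht
      obtain ⟨s, hs, rfl⟩ := Finset.mem_image.mp ht
      obtain ⟨hs, hi⟩ := Finset.mem_filter.mp hs
      rw [Multiset.card_erase_of_mem hi, hS s hs]
      rfl) (fun t => c (i ::ₘ t) * (i ::ₘ t).count i) h₃ (s.erase i)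
      (Finset.mem_image_of_mem _ (Finset.mem_filter.mpr ⟨hs, hi⟩))
    simp only [Multiset.cons_erase hi, mul_eq_zero, Nat.cast_eq_zero] at h₅
    -- Characteristic zero enters here: the multiplicity of `i` in `s` is nonzero in `K`.
    exact h₅.resolve_right (by rw [Multiset.count_eq_zero]; exact fun h => h hi)

/-- The Poincaré-Birkhoff-Witt theorem, for an algebra with skew derivations dual to generators. -/
theorem linearIndependent_words [CharZero K] [DecidableEq ι] {D : ι → A →ₗ[K] A} (hD₀ : ∀ i, D i 1 = 0)
    (hD : ∀ i j (w : List ι), D i (x j * (w.map x).prod) - x j * D i (w.map x).prod -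
      (if i = j then (w.map x).prod else 0) ∈ wordFil K x (fun _ => ()) w.length ())
    (hx : ∀ i j, x i * x j - x j * x i ∈ Submodule.span K (Set.range x))
    (h1 : (1 : A) ≠ 0) {T : Type*} (rep : T → List ι)
    (hrep : Function.Injective fun t => (rep t : Multiset ι)) :
    LinearIndependent K fun t => ((rep t).map x).prod := by
  classical
  have hx' : ∀ i j, x i * x j - x j * x i ∈
      Submodule.span K (x '' {k | (fun _ : ι => ()) k = (fun _ => ()) i + (fun _ => ()) j}) := by
    simpa using hx
  rw [linearIndependent_iff']
  intro S c hc
  by_contra! hne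
  obtain ⟨t₀, ht₀, hct₀⟩ := hne
  -- In a nontrivial relation, the part of maximal length is a combination of shorter words, which
  -- `coeff_eq_zero_of_sum_mem` excludes.
  obtain ⟨t₁, ht₁, hmax⟩ := (S.filter (c · ≠ 0)).exists_max_image (fun t => (rep t).length)
    ⟨t₀, Finset.mem_filter.mpr ⟨ht₀, hct₀⟩⟩
  obtain ⟨ht₁S, hct₁⟩ := Finset.mem_filter.mp ht₁
  set n := (rep t₁).length with hn
  let S' := (S.filter (fun t => (rep t).length = n)).image (fun t => (rep t : Multiset ι))
  have : Nonempty T := ⟨t₀⟩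
  have hinv : ∀ t, Function.invFun (fun t => (rep t : Multiset ι)) (rep t : Multiset ι) = t :=
    fun t => Function.leftInverse_invFun hrep t
  have h₁ : ∑ s ∈ S', c (Function.invFun (fun t => (rep t : Multiset ι)) s) •
      (s.toList.map x).prod ∈ wordFil K x (fun _ => ()) n () := by
    rw [Finset.sum_image (fun s _ t _ h => hrep h)]
    have h₂ : ∑ t ∈ S.filter (fun t => (rep t).length = n), c t • ((rep t).map x).prod ∈
        wordFil K x (fun _ => ()) n () := by
      have h₃ := Finset.sum_filter_add_sum_filter_not S (fun t => (rep t).length = n)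
        (fun t => c t • ((rep t).map x).prod)
      rw [hc] at h₃
      rw [eq_neg_of_add_eq_zero_left h₃]
      refine neg_mem (sum_mem fun t ht => ?_)
      obtain ⟨htS, htn⟩ := Finset.mem_filter.mp ht
      by_cases hct : c t = 0
      · simp [hct]
      · refine Submodule.smul_mem _ _ (word_mem_wordFil (d := fun _ => ()) ?_)
        exact lt_of_le_of_ne (hmax t (Finset.mem_filter.mpr ⟨htS, hct⟩)) htn
    have h₃ : ∑ t ∈ S.filter (fun t => (rep t).length = n),
        c t • ((((rep t : Multiset ι)).toList.map x).prod - ((rep t).map x).prod) ∈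
        wordFil K x (fun _ => ()) n () := by
      refine sum_mem fun t ht => Submodule.smul_mem _ _ ?_
      have hp : ((rep t : Multiset ι)).toList.Perm (rep t) := by
        rw [← Multiset.coe_eq_coe, Multiset.coe_toList]
      have := word_sub_word_mem_of_perm (K := K) hx' hp
      rw [hp.length_eq, (Finset.mem_filter.mp ht).2] at this
      exact this
    have h₄ := add_mem h₂ h₃
    rw [← Finset.sum_add_distrib] at h₄
    simpa only [hinv, ← smul_add, add_sub_cancel] using h₄
  have h₂ := coeff_eq_zero_of_sum_mem hD₀ hD hx h1 n S' (by
    intro s hs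
    obtain ⟨t, ht, rfl⟩ := Finset.mem_image.mp hs
    exact (Finset.mem_filter.mp ht).2) _ h₁ (rep t₁)
    (Finset.mem_image_of_mem (fun t => (rep t : Multiset ι))
      (Finset.mem_filter.mpr ⟨ht₁S, rfl⟩))
  rw [hinv] at h₂
  exact hct₁ h₂

open TensorProduct

/-- The skew derivations required in `linearIndependent_words`, obtained from a comultiplication for
which the generators are primitive. -/
theorem comul_derivation (Δ : A →ₐ[K] A ⊗[K] A) (hΔ : ∀ i, Δ (x i) = x i ⊗ₜ 1 + 1 ⊗ₜ x i)
    (ξ : A →ₗ[K] K) (j : ι) (w : List ι) :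
    TensorProduct.lid K A (ξ.rTensor A (Δ (x j * (w.map x).prod))) -
      x j * TensorProduct.lid K A (ξ.rTensor A (Δ (w.map x).prod)) - ξ (x j) • (w.map x).prod ∈
      wordFil K x (fun _ => ()) w.length () := by
  -- Only the length of the second tensor factor is filtered, because `ξ` turns the first factor
  -- into a scalar.
  let R : ℕ → Submodule K (A ⊗[K] A) := fun n =>
    Submodule.span K {z | ∃ a, ∃ f ∈ wordFil K x (fun _ => ()) n (), z = a ⊗ₜ f}
  have hR : ∀ (a : A) n, ∀ z ∈ R n, (a ⊗ₜ 1) * z ∈ R n := by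
    intro a n z hz
    induction hz using Submodule.span_induction with
    | mem z hz =>
      obtain ⟨a', f, hf, rfl⟩ := hz
      exact Submodule.subset_span ⟨a * a', f, hf, by simp⟩
    | zero => simp
    | add y z _ _ hy hz => rw [mul_add]; exact add_mem hy hz
    | smul c y _ hy => rw [mul_smul_comm]; exact Submodule.smul_mem _ _ hy
  have hR₂ : ∀ (i : ι) n, ∀ z ∈ R n, (1 ⊗ₜ x i) * z ∈ R (n + 1) := by
    intro i n z hz
    induction hz using Submodule.span_induction with
    | mem z hz =>
      obtain ⟨a', f, hf, rfl⟩ := hz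
      exact Submodule.subset_span ⟨a', x i * f, mul_mem_wordFil (d := fun _ => ()) i hf, by simp⟩
    | zero => simp
    | add y z _ _ hy hz => rw [mul_add]; exact add_mem hy hz
    | smul c y _ hy => rw [mul_smul_comm]; exact Submodule.smul_mem _ _ hy
  have hR₃ : ∀ n, R n ≤ R (n + 1) := fun n => Submodule.span_mono
    fun _ ⟨a, f, hf, h⟩ => ⟨a, f, wordFil_mono (by omega) _ hf, h⟩
  -- Expanding the product of the `x i ⊗ 1 + 1 ⊗ x i`, every term except `1 ⊗ w` has lost a letter
  -- of its second factor.
  have hw : ∀ w : List ι, Δ (w.map x).prod - 1 ⊗ₜ (w.map x).prod ∈ R w.length := by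
    intro w
    induction w with
    | nil => simp [Algebra.TensorProduct.one_def]
    | cons i w ih =>
      have h₁ := add_mem (hR₃ _ (hR (x i) _ _ ih)) (hR₂ i _ _ ih)
      have h₂ : x i ⊗ₜ[K] (w.map x).prod ∈ R (w.length + 1) :=
        Submodule.subset_span ⟨_, _, word_mem_wordFil (d := fun _ => ()) (Nat.lt_succ_self _), rfl⟩
      refine (congrArg (· ∈ R (w.length + 1)) ?_).mp (add_mem h₁ h₂)
      simp [hΔ, mul_sub, add_mul]
      abel
  have h₁ : ∀ z ∈ R w.length, TensorProduct.lid K A (ξ.rTensor A z) ∈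
      wordFil K x (fun _ => ()) w.length () := by
    intro z hz
    induction hz using Submodule.span_induction with
    | mem z hz =>
      obtain ⟨a', f, hf, rfl⟩ := hz
      simpa using Submodule.smul_mem _ _ hf
    | zero => simp
    | add y z _ _ hy hz => rw [map_add, map_add]; exact add_mem hy hz
    | smul c y _ hy => rw [map_smul, map_smul]; exact Submodule.smul_mem _ _ hy
  have h₂ : ∀ (a : A) (z : A ⊗[K] A), TensorProduct.lid K A (ξ.rTensor A ((1 ⊗ₜ a) * z)) =
      a * TensorProduct.lid K A (ξ.rTensor A z) := by
    intro a z
    induction z using TensorProduct.induction_on with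
    | zero => simp
    | tmul y z => simp
    | add y z hy hz => rw [mul_add, map_add, map_add, map_add, map_add, mul_add, hy, hz]
  have h₃ := h₁ _ (hR (x j) _ _ (hw w))
  refine (congrArg (· ∈ wordFil K x (fun _ => ()) w.length ()) ?_).mp h₃
  rw [map_mul Δ, hΔ, add_mul, map_add, map_add, h₂, mul_sub, map_sub, map_sub,
    Algebra.TensorProduct.tmul_mul_tmul]
  simp

end Independence

/-! ### The Poincaré-Birkhoff-Witt theorem for Lie algebras with trivial center. -/

section UEA

variable {K : Type*} [Field K] {g : Type*} [LieRing g] [LieAlgebra K g]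

open TensorProduct

attribute [local instance 100] LieRing.ofAssociativeRing

/-- The comultiplication of the enveloping algebra. -/
theorem exists_comul : ∃ Δ : UniversalEnvelopingAlgebra K g →ₐ[K]
    UniversalEnvelopingAlgebra K g ⊗[K] UniversalEnvelopingAlgebra K g,
    ∀ y : g, Δ (UniversalEnvelopingAlgebra.ι K y) =
      UniversalEnvelopingAlgebra.ι K y ⊗ₜ 1 + 1 ⊗ₜ UniversalEnvelopingAlgebra.ι K y := by
  let f : g →ₗ⁅K⁆ UniversalEnvelopingAlgebra K g ⊗[K] UniversalEnvelopingAlgebra K g :=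
    { toFun := fun y => UniversalEnvelopingAlgebra.ι K y ⊗ₜ 1 + 1 ⊗ₜ UniversalEnvelopingAlgebra.ι K y
      map_add' := fun y z => by simp [TensorProduct.add_tmul, TensorProduct.tmul_add]; abel
      map_smul' := fun c y => by simp [TensorProduct.smul_tmul']
      map_lie' := fun {y z} => by
        simp only [LieHom.map_lie, LieRing.of_associative_ring_bracket, add_mul, mul_add,
          Algebra.TensorProduct.tmul_mul_tmul, one_mul, mul_one, TensorProduct.sub_tmul,
          TensorProduct.tmul_sub]
        abel }
  exact ⟨UniversalEnvelopingAlgebra.lift K f, fun y => UniversalEnvelopingAlgebra.lift_ι_apply K f y⟩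

theorem exists_counit : ∃ ε : UniversalEnvelopingAlgebra K g →ₐ[K] K,
    ∀ y : g, ε (UniversalEnvelopingAlgebra.ι K y) = 0 :=
  ⟨UniversalEnvelopingAlgebra.lift K (0 : g →ₗ⁅K⁆ K), fun y => by
    rw [UniversalEnvelopingAlgebra.lift_ι_apply]; rfl⟩

/-- The Poincaré-Birkhoff-Witt theorem for Lie algebras without center over a field of
characteristic zero. -/
theorem linearIndependent_pbw [CharZero K] {ι : Type*} (B : Basis ι K g) (hZ : LieAlgebra.center K g = ⊥)
    {T : Type*} (rep : T → List ι) (hrep : Function.Injective fun t => (rep t : Multiset ι)) :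
    LinearIndependent K
      fun t => ((rep t).map fun i => UniversalEnvelopingAlgebra.ι K (B i)).prod := by
  classical
  obtain ⟨Δ, hΔ⟩ := exists_comul (K := K) (g := g)
  obtain ⟨ε, hε⟩ := exists_counit (K := K) (g := g)
  -- The adjoint representation factors through the enveloping algebra and is faithful because the
  -- center vanishes.
  have hinj : Function.Injective (UniversalEnvelopingAlgebra.ι K (L := g)) := by
    have h : ∀ y, LieAlgebra.ad K g y =
        UniversalEnvelopingAlgebra.lift K (LieAlgebra.ad K g) (UniversalEnvelopingAlgebra.ι K y) :=
      fun y => (UniversalEnvelopingAlgebra.lift_ι_apply K (LieAlgebra.ad K g) y).symm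
    intro y z hyz
    have h₁ : LieAlgebra.ad K g (y - z) = 0 := by rw [map_sub, h, h, hyz, sub_self]
    have h₂ : y - z ∈ (LieAlgebra.ad K g).ker := LieHom.mem_ker.mpr h₁
    rw [LieAlgebra.ad_ker_eq_self_module_ker, LieAlgebra.self_module_ker_eq_center, hZ] at h₂
    exact sub_eq_zero.mp ((LieSubmodule.mem_bot _).mp h₂)
  have h1 : (1 : UniversalEnvelopingAlgebra K g) ≠ 0 := by
    intro h
    have := congrArg ε h
    simp at this
  -- functionals dual to the basis and vanishing on `1`
  obtain ⟨r, hr⟩ := LinearMap.exists_leftInverse_of_injective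
    (UniversalEnvelopingAlgebra.ι K (L := g) : g →ₗ[K] UniversalEnvelopingAlgebra K g)
    (LinearMap.ker_eq_bot.mpr hinj)
  let ξ : ι → UniversalEnvelopingAlgebra K g →ₗ[K] K := fun i =>
    (B.coord i ∘ₗ r) ∘ₗ (LinearMap.id - (Algebra.linearMap K _) ∘ₗ ε.toLinearMap)
  have hξ₁ : ∀ i, ξ i 1 = 0 := fun i => by simp [ξ]
  have hξ : ∀ i j, ξ i (UniversalEnvelopingAlgebra.ι K (B j)) = if i = j then 1 else 0 := by
    intro i j
    have := LinearMap.congr_fun hr (B j)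
    simp only [LinearMap.comp_apply, LinearMap.id_apply] at this
    change r (UniversalEnvelopingAlgebra.ι K (B j)) = B j at this
    simp [ξ, hε, this, Finsupp.single_apply, eq_comm, -UniversalEnvelopingAlgebra.ι_apply]
  -- The derivative in direction `i` is `(ξ i ⊗ id) ∘ Δ`.
  refine linearIndependent_words (D := fun i => (TensorProduct.lid K _).toLinearMap ∘ₗ
    (ξ i).rTensor _ ∘ₗ Δ.toLinearMap) ?_ ?_ ?_ h1 rep hrep
  · intro i
    simp [Algebra.TensorProduct.one_def, hξ₁]
  · intro i j w
    have := comul_derivation (x := fun i => UniversalEnvelopingAlgebra.ι K (B i)) Δ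
      (fun i => hΔ _) (ξ i) j w
    simpa [hξ, -UniversalEnvelopingAlgebra.ι_apply] using this
  · intro i j
    rw [← LieRing.of_associative_ring_bracket, ← LieHom.map_lie]
    have h := Submodule.mem_map_of_mem (f := (UniversalEnvelopingAlgebra.ι K (L := g) : g →ₗ[K] UniversalEnvelopingAlgebra K g))
      (B.mem_span ⁅B i, B j⁆)
    rw [Submodule.map_span, ← Set.range_comp] at h
    exact h

end UEA
end CatO
end

set_option linter.unusedSectionVars false

noncomputable section

namespace CatO

variable {L : Type u} [LieRing L] [LieAlgebra ℂ L] [FiniteDimensional ℂ L] [IsSemisimple ℂ L]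
  {H : LieSubalgebra ℂ L} [H.IsCartanSubalgebra] (b : (rootSystem H).Base)

/-! ### Positive roots, heights and the cone Q₊. -/

section Roots

/-- The positive roots. -/
abbrev Pos : Type u := {α : H.root // b.IsPos α}

instance : Fintype (Pos b) := Fintype.ofFinite _

variable {b} in
/-- A positive root as a weight. -/
def wt (i : Pos b) : Dual ℂ H := (rootSystem H).root i.1

/-- The normalization by the Killing form, rather than by coroots, makes opposite root vectors
members of Killing-dual bases; this suits the Casimir element. -/
theorem exists_killing_pair (α : LieModule.Weight ℂ H L) :
    ∃ e ∈ rootSpace H α, ∃ f ∈ rootSpace H (-α), killingForm ℂ L e f = 1 := by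
  obtain ⟨e, he, he₀⟩ := α.exists_ne_zero
  obtain ⟨f, hf, hef⟩ : ∃ f ∈ rootSpace H (-α), killingForm ℂ L e f ≠ 0 := by
    by_contra! h
    refine he₀ ?_
    simpa using mem_ker_killingForm_of_mem_rootSpace_of_forall_rootSpace_neg ℂ L H he h
  exact ⟨e, he, (killingForm ℂ L e f)⁻¹ • f, Submodule.smul_mem _ _ hf, by simp [hef]⟩

variable {b} in
/-- A positive root vector. -/
def posVec (i : Pos b) : L := (exists_killing_pair (i.1 : LieModule.Weight ℂ H L)).choose

variable {b} in
/-- A negative root vector, normalized by `κ(e_α, f_α) = 1`. -/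
def negVec (i : Pos b) : L := (exists_killing_pair (i.1 : LieModule.Weight ℂ H L)).choose_spec.2.choose

variable {b}

theorem posVec_mem (i : Pos b) : posVec i ∈ rootSpace H (wt i) :=
  (exists_killing_pair (i.1 : LieModule.Weight ℂ H L)).choose_spec.1

theorem negVec_mem (i : Pos b) : negVec i ∈ rootSpace H (-wt i : Dual ℂ H) :=
  (exists_killing_pair (i.1 : LieModule.Weight ℂ H L)).choose_spec.2.choose_spec.1

theorem killing_posVec_negVec (i : Pos b) : killingForm ℂ L (posVec i) (negVec i) = 1 :=
  (exists_killing_pair (i.1 : LieModule.Weight ℂ H L)).choose_spec.2.choose_spec.2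

theorem wt_injective : Function.Injective (wt (b := b)) := fun _ _ h =>
  Subtype.ext ((rootSystem H).root.injective h)

variable (b) in
/-- The element of the Cartan subalgebra on which all simple roots take the value one. -/
def gradingElt : H := (Module.evalEquiv ℂ H).symm (b.toWeightBasis.constr ℂ fun _ => (1 : ℂ))

theorem apply_gradingElt (φ : Dual ℂ H) :
    φ (gradingElt b) = b.toWeightBasis.constr ℂ (fun _ => (1 : ℂ)) φ := by
  rw [gradingElt, Module.apply_evalEquiv_symm_apply]

theorem simple_gradingElt {j : H.root} (hj : j ∈ b.support) :
    (rootSystem H).root j (gradingElt b) = 1 := by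
  rw [apply_gradingElt, ← b.toWeightBasis_apply ⟨j, hj⟩, Basis.constr_basis]

theorem root_gradingElt (j : H.root) : (rootSystem H).root j (gradingElt b) = b.height j := by
  obtain ⟨f, -, -, hf⟩ := b.exists_root_eq_sum_int j
  rw [RootPairing.Base.height_eq_sum hf, hf, LinearMap.sum_apply, Int.cast_sum]
  refine Finset.sum_congr rfl fun i hi => ?_
  rw [LinearMap.smul_apply, simple_gradingElt hi]
  simp

variable (b) in
/-- The real part of the height of a weight. -/
def hgt : Dual ℂ H →+ ℝ :=
  Complex.reLm.toAddMonoidHom.comp (Module.Dual.eval ℂ H (gradingElt b)).toAddMonoidHom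

theorem hgt_apply (φ : Dual ℂ H) : hgt b φ = (φ (gradingElt b)).re := rfl

/-- The height of a positive root. -/
def htn (i : Pos b) : ℕ := (b.height i.1).toNat

theorem htn_pos (i : Pos b) : 1 ≤ htn i := by
  have : 0 < b.height i.1 := i.2
  unfold htn
  omega

theorem hgt_wt (i : Pos b) : hgt b (wt i) = htn i := by
  have h : 0 < b.height i.1 := i.2
  rw [hgt_apply, wt, root_gradingElt, htn]
  have h₂ : ((b.height i.1).toNat : ℤ) = b.height i.1 := Int.toNat_of_nonneg h.le
  rw [Complex.intCast_re]
  exact_mod_cast h₂.symm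

/-- The weight of a multiset of positive roots. -/
def wtm (a : Multiset (Pos b)) : Dual ℂ H := (a.map wt).sum

/-- The height of a multiset of positive roots. -/
def htm (a : Multiset (Pos b)) : ℕ := (a.map htn).sum

@[simp] theorem wtm_zero : wtm (0 : Multiset (Pos b)) = 0 := rfl
@[simp] theorem htm_zero : htm (0 : Multiset (Pos b)) = 0 := rfl
@[simp] theorem wtm_cons (i : Pos b) (a : Multiset (Pos b)) : wtm (i ::ₘ a) = wt i + wtm a := by
  simp [wtm]
@[simp] theorem htm_cons (i : Pos b) (a : Multiset (Pos b)) : htm (i ::ₘ a) = htn i + htm a := by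
  simp [htm]
theorem wtm_add (a c : Multiset (Pos b)) : wtm (a + c) = wtm a + wtm c := by simp [wtm]

theorem hgt_wtm (a : Multiset (Pos b)) : hgt b (wtm a) = htm a := by
  induction a using Multiset.induction_on with
  | empty => simp
  | cons i a ih => simp [ih, hgt_wt]

theorem htm_eq_of_wtm_eq {a c : Multiset (Pos b)} (h : wtm a = wtm c) : htm a = htm c := by
  have := hgt_wtm a
  rw [h, hgt_wtm] at this
  exact_mod_cast this.symm

theorem card_le_htm (a : Multiset (Pos b)) : a.card ≤ htm a := by
  induction a using Multiset.induction_on with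
  | empty => simp
  | cons i a ih => rw [htm_cons, Multiset.card_cons]; have := htn_pos i; omega

theorem eq_zero_of_htm_eq_zero {a : Multiset (Pos b)} (h : htm a = 0) : a = 0 :=
  Multiset.card_eq_zero.mp (Nat.le_zero.mp (h ▸ card_le_htm a))

theorem finite_htm_le (n : ℕ) : {a : Multiset (Pos b) | htm a ≤ n}.Finite := by
  classical
  -- Every positive root has height at least one, so a multiset of height at most `n` is contained
  -- in `n` copies of the set of positive roots.
  let t : Multiset (Pos b) := n • Finset.univ.val
  refine Set.Finite.subset (Finset.finite_toSet t.powerset.toFinset) fun a ha => ?_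
  simp only [Finset.mem_coe, Multiset.mem_toFinset, Multiset.mem_powerset, t]
  rw [Multiset.le_iff_count]
  intro i
  rw [Multiset.count_nsmul, Multiset.count_eq_one_of_mem Finset.univ.nodup (Finset.mem_univ i)]
  have h₁ := Multiset.count_le_card i a
  have h₂ := card_le_htm a
  have h₃ : htm a ≤ n := ha
  omega

theorem exists_wtm_eq {β : Dual ℂ H} (hβ : β ∈ Qpos b) : ∃ a : Multiset (Pos b), wtm a = β := by
  induction hβ using AddSubmonoid.closure_induction with
  | mem x hx =>
    obtain ⟨j, hj, rfl⟩ := hx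
    exact ⟨{⟨j, RootPairing.Base.isPos_of_mem_support hj⟩}, by simp [wtm, wt]⟩
  | zero => exact ⟨0, rfl⟩
  | add x y _ _ hx hy =>
    obtain ⟨a, rfl⟩ := hx
    obtain ⟨c, rfl⟩ := hy
    exact ⟨a + c, wtm_add a c⟩

/-- A root or its negative lies in the cone; elements of the cone have nonnegative height, which
excludes the negative of a positive root. -/
theorem wt_mem_Qpos (i : Pos b) : wt i ∈ Qpos b := by
  rcases b.root_mem_or_neg_mem i.1 with h | h
  · exact h
  · obtain ⟨a, ha⟩ := exists_wtm_eq (b := b) h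
    have h₁ := hgt_wtm a
    rw [ha] at h₁
    change hgt b (-wt i) = _ at h₁
    rw [map_neg, hgt_wt] at h₁
    have h₂ : (1 : ℝ) ≤ htn i := by exact_mod_cast htn_pos i
    have h₃ : (0 : ℝ) ≤ htm a := Nat.cast_nonneg _
    linarith

theorem wtm_mem_Qpos (a : Multiset (Pos b)) : wtm a ∈ Qpos b := by
  induction a using Multiset.induction_on with
  | empty => exact zero_mem _
  | cons i a ih => rw [wtm_cons]; exact add_mem (wt_mem_Qpos i) ih

theorem hgt_nonneg {β : Dual ℂ H} (hβ : β ∈ Qpos b) : 0 ≤ hgt b β := by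
  obtain ⟨a, rfl⟩ := exists_wtm_eq hβ
  rw [hgt_wtm]
  positivity

theorem eq_zero_of_hgt_le {β : Dual ℂ H} (hβ : β ∈ Qpos b) (h : hgt b β ≤ 0) : β = 0 := by
  obtain ⟨a, rfl⟩ := exists_wtm_eq hβ
  rw [hgt_wtm] at h
  rw [eq_zero_of_htm_eq_zero (a := a) (by exact_mod_cast le_antisymm h (Nat.cast_nonneg _)), wtm_zero]

theorem eq_of_sub_mem_Qpos {μ ν : Dual ℂ H} (h₁ : μ - ν ∈ Qpos b) (h₂ : ν - μ ∈ Qpos b) :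
    μ = ν := by
  refine sub_eq_zero.mp (eq_zero_of_hgt_le h₁ ?_)
  have := hgt_nonneg h₂
  rw [← neg_sub, map_neg] at this
  linarith

theorem finite_Qpos_hgt_le (C : ℝ) : {β : Dual ℂ H | β ∈ Qpos b ∧ hgt b β ≤ C}.Finite := by
  refine ((finite_htm_le (b := b) ⌊C⌋₊).image wtm).subset ?_
  rintro β ⟨hβ, hC⟩
  obtain ⟨a, rfl⟩ := exists_wtm_eq hβ
  rw [hgt_wtm] at hC
  exact ⟨a, Nat.le_floor hC, rfl⟩

end Roots

/-! ### A basis of root vectors and its Killing-dual basis. -/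

section Basis

variable {b}

theorem root_neg_pos (j : H.root) (hj : ¬ b.IsPos j) : ∃ i : Pos b, wt i = -(rootSystem H).root j := by
  refine ⟨⟨(rootSystem H).reflectionPerm j j, ?_⟩, ?_⟩
  · have := (RootPairing.Base.IsPos.neg_iff_not b j).mpr hj
    exact this
  · rw [wt, RootPairing.root_reflectionPerm, RootPairing.reflection_apply_self]

theorem wt_add_wt_ne_zero (i j : Pos b) : wt i + wt j ≠ 0 := by
  intro h
  have h₁ := congrArg (hgt b) h
  rw [map_add, hgt_wt, hgt_wt, map_zero] at h₁
  have h₂ : (1 : ℝ) ≤ htn i := by exact_mod_cast htn_pos i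
  have h₃ : (1 : ℝ) ≤ htn j := by exact_mod_cast htn_pos j
  linarith

theorem wt_ne_zero (i : Pos b) : wt i ≠ 0 := (rootSystem H).ne_zero i.1

theorem mem_span_of_mem_rootSpace {χ : H → ℂ} {x y : L} (hχ : χ ≠ 0) (hx : x ∈ rootSpace H χ)
    (hx₀ : x ≠ 0) (hy : y ∈ rootSpace H χ) : ∃ c : ℂ, c • x = y := by
  have hbot : rootSpace H χ ≠ ⊥ := fun h => hx₀ (by rwa [h, LieSubmodule.mem_bot] at hx)
  let α : LieModule.Weight ℂ H L := ⟨χ, hbot⟩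
  have hα : α.IsNonZero := fun h => hχ h
  have h₁ := finrank_rootSpace_eq_one α hα
  obtain ⟨c, hc⟩ := (finrank_eq_one_iff_of_nonzero' (⟨x, hx⟩ : rootSpace H α)
    (fun h => hx₀ (congrArg Subtype.val h))).mp h₁ ⟨y, hy⟩
  exact ⟨c, congrArg Subtype.val hc⟩

theorem posVec_ne_zero (i : Pos b) : posVec i ≠ 0 := fun h => by
  have := killing_posVec_negVec i
  simp [h] at this

theorem negVec_ne_zero (i : Pos b) : negVec i ≠ 0 := fun h => by
  have := killing_posVec_negVec i
  simp [h] at this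

theorem wt_coe_ne_zero (i : Pos b) : (wt i : H → ℂ) ≠ 0 := fun h =>
  wt_ne_zero i (LinearMap.ext fun x => congrFun h x)

/-- Root vectors for a positive root are multiples of the chosen one. -/
theorem exists_smul_posVec {i : Pos b} {x : L} (hx : x ∈ rootSpace H (wt i)) :
    ∃ c : ℂ, c • posVec i = x :=
  mem_span_of_mem_rootSpace (wt_coe_ne_zero i) (posVec_mem i) (posVec_ne_zero i) hx

theorem exists_smul_negVec {i : Pos b} {x : L} (hx : x ∈ rootSpace H (-wt i : Dual ℂ H)) :
    ∃ c : ℂ, c • negVec i = x :=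
  mem_span_of_mem_rootSpace (fun h => wt_coe_ne_zero i (by
    funext y; exact neg_eq_zero.mp (congrFun h y))) (negVec_mem i) (negVec_ne_zero i) hx

theorem lie_posVec (x : H) (i : Pos b) : ⁅(x : L), posVec i⁆ = wt i x • posVec i :=
  lie_eq_smul_of_mem_rootSpace (posVec_mem i) x

theorem lie_negVec (x : H) (i : Pos b) : ⁅(x : L), negVec i⁆ = -wt i x • negVec i :=
  lie_eq_smul_of_mem_rootSpace (negVec_mem i) x

theorem exists_wt_of_lie_ne_zero (i j : Pos b) {x y : L} (hx : x ∈ rootSpace H (wt i))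
    (hy : y ∈ rootSpace H (wt j)) (h : ⁅x, y⁆ ≠ 0) : ∃ k : Pos b, wt k = wt i + wt j := by
  have hm : ⁅x, y⁆ ∈ rootSpace H ((wt i : H → ℂ) + wt j) :=
    lie_mem_genWeightSpace_of_mem_genWeightSpace hx hy
  have hbot : rootSpace H ((wt i : H → ℂ) + wt j) ≠ ⊥ :=
    fun h' => h (by rwa [h', LieSubmodule.mem_bot] at hm)
  let α : LieModule.Weight ℂ H L := ⟨_, hbot⟩
  have hα : α.IsNonZero := fun h' => wt_add_wt_ne_zero i j (LinearMap.ext fun x => congrFun h' x)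
  let γ : H.root := ⟨α, by simpa using hα⟩
  have hγ : (rootSystem H).root γ = wt i + wt j := by ext x; rfl
  exact ⟨⟨γ, i.2.add j.2 hγ⟩, hγ⟩

/-- This is the commutation hypothesis of `word_mem_span`, with the weight as degree, so
straightening preserves weights. -/
theorem lie_posVec_posVec_mem (i j : Pos b) :
    ⁅posVec i, posVec j⁆ ∈ Submodule.span ℂ (posVec '' {k : Pos b | wt k = wt i + wt j}) := by
  by_cases h : ⁅posVec i, posVec j⁆ = 0
  · rw [h]; exact zero_mem _
  obtain ⟨k, hk⟩ := exists_wt_of_lie_ne_zero i j (posVec_mem i) (posVec_mem j) h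
  obtain ⟨c, hc⟩ := exists_smul_posVec (i := k) (x := ⁅posVec i, posVec j⁆) (by
    rw [hk]; exact lie_mem_genWeightSpace_of_mem_genWeightSpace (posVec_mem i) (posVec_mem j))
  rw [← hc]
  exact Submodule.smul_mem _ _ (Submodule.subset_span ⟨k, hk, rfl⟩)

variable (H) in
/-- The Killing form on the Cartan subalgebra is nondegenerate. -/
theorem trace_nondegenerate : (LieModule.traceForm ℂ H L).Nondegenerate :=
  traceForm_cartan_nondegenerate ℂ L H

variable (H) in
/-- A basis of the Cartan subalgebra. -/
def cartanBasis : Module.Basis (Fin (finrank ℂ H)) ℂ H := Module.finBasis ℂ H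

variable (H) in
/-- The dual basis of the Cartan subalgebra with respect to the Killing form. -/
def cartanDual : Module.Basis (Fin (finrank ℂ H)) ℂ H :=
  LinearMap.BilinForm.dualBasis (LieModule.traceForm ℂ H L) (trace_nondegenerate H) (cartanBasis H)

theorem trace_cartanBasis_cartanDual (i j : Fin (finrank ℂ H)) :
    LieModule.traceForm ℂ H L (cartanBasis H i) (cartanDual H j) = if i = j then 1 else 0 := by
  rw [LieModule.traceForm_comm, cartanDual, LinearMap.BilinForm.apply_dualBasis_left]

theorem trace_eq_killing (x y : H) : LieModule.traceForm ℂ H L x y = killingForm ℂ L x y := rfl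

variable (b) in
/-- The index type of the root vectors together with a basis of the Cartan subalgebra. -/
abbrev Idx : Type u := Pos b ⊕ Pos b ⊕ Fin (finrank ℂ H)

variable (b) in
/-- Negative root vectors, positive root vectors, and a basis of the Cartan subalgebra. -/
def rootVec : Idx b → L := Sum.elim negVec (Sum.elim posVec fun j => (cartanBasis H j : L))

variable (b) in
/-- The dual basis of `rootVec` with respect to the Killing form. -/
def rootDual : Idx b → L := Sum.elim posVec (Sum.elim negVec fun j => (cartanDual H j : L))

theorem mem_rootSpace_zero (x : H) : (x : L) ∈ rootSpace H (0 : H → ℂ) :=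
  toLieSubmodule_le_rootSpace_zero ℂ L H x.2

theorem killing_eq_zero {χ ψ : Dual ℂ H} {x y : L} (hx : x ∈ rootSpace H χ)
    (hy : y ∈ rootSpace H ψ) (h : χ + ψ ≠ 0) : killingForm ℂ L x y = 0 :=
  killingForm_apply_eq_zero_of_mem_rootSpace_of_add_ne_zero ℂ L H hx hy
    fun h' => h (LinearMap.ext fun x => congrFun h' x)

variable [DecidableEq (Pos b)]

theorem killing_rootVec_rootDual (i j : Idx b) :
    killingForm ℂ L (rootVec b i) (rootDual b j) = if i = j then 1 else 0 := by
  have h0 : ∀ x : H, (x : L) ∈ rootSpace H ((0 : Dual ℂ H) : H → ℂ) := mem_rootSpace_zero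
  rcases i with i | i | i <;> rcases j with j | j | j <;> simp only [rootVec, rootDual, Sum.elim_inl,
    Sum.elim_inr, Sum.inl.injEq, Sum.inr.injEq, reduceCtorEq, if_false]
  · split_ifs with h
    · rw [LieModule.traceForm_comm, h, killing_posVec_negVec]
    · refine killing_eq_zero (negVec_mem i) (posVec_mem j) fun h' => h (wt_injective ?_)
      rw [neg_add_eq_zero] at h'; exact h'
  · refine killing_eq_zero (negVec_mem i) (negVec_mem j) fun h' => wt_add_wt_ne_zero i j ?_
    rw [← neg_add, neg_eq_zero] at h'; exact h'
  · exact killing_eq_zero (negVec_mem i) (h0 _) (by simpa using wt_ne_zero i)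
  · exact killing_eq_zero (posVec_mem i) (posVec_mem j) (wt_add_wt_ne_zero i j)
  · split_ifs with h
    · rw [h, killing_posVec_negVec]
    · refine killing_eq_zero (posVec_mem i) (negVec_mem j) fun h' => h (wt_injective ?_)
      rw [add_neg_eq_zero] at h'; exact h'
  · exact killing_eq_zero (posVec_mem i) (h0 _) (by simpa using wt_ne_zero i)
  · exact killing_eq_zero (h0 _) (posVec_mem j) (by simpa using wt_ne_zero j)
  · exact killing_eq_zero (h0 _) (negVec_mem j) (by simpa using wt_ne_zero j)
  · rw [← trace_eq_killing, trace_cartanBasis_cartanDual]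

omit [DecidableEq (Pos b)] in
theorem span_rootVec : ⊤ ≤ Submodule.span ℂ (Set.range (rootVec b)) := by
  have h : (⨆ χ : LieModule.Weight ℂ H L, (rootSpace H χ).toSubmodule) = ⊤ := by
    rw [← LieSubmodule.iSup_toSubmodule, LieModule.iSup_genWeightSpace_eq_top']
    rfl
  rw [← h]
  refine iSup_le fun χ x hx => ?_
  have hx : x ∈ rootSpace H χ := hx
  by_cases hχ : χ.IsZero
  · have hx' : x ∈ H := by
      have h₁ : x ∈ rootSpace H (0 : H → ℂ) := by rwa [← hχ.eq]
      rwa [rootSpace_zero_eq ℂ L H] at h₁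
    have h₂ := (cartanBasis H).mem_span ⟨x, hx'⟩
    have h₃ := Submodule.mem_map_of_mem (f := H.toSubmodule.subtype) h₂
    rw [Submodule.map_span, ← Set.range_comp] at h₃
    refine Submodule.span_mono ?_ h₃
    rintro _ ⟨j, rfl⟩
    exact ⟨Sum.inr (Sum.inr j), rfl⟩
  · let γ : H.root := ⟨χ, by simpa using hχ⟩
    by_cases hγ : b.IsPos γ
    · obtain ⟨c, hc⟩ := exists_smul_posVec (i := (⟨γ, hγ⟩ : Pos b)) (x := x) hx
      rw [← hc]
      exact Submodule.smul_mem _ _ (Submodule.subset_span ⟨Sum.inr (Sum.inl _), rfl⟩)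
    · obtain ⟨i, hi⟩ := root_neg_pos γ hγ
      obtain ⟨c, hc⟩ := exists_smul_negVec (i := i) (x := x) (by rw [hi, neg_neg]; exact hx)
      rw [← hc]
      exact Submodule.smul_mem _ _ (Submodule.subset_span ⟨Sum.inl _, rfl⟩)

omit [DecidableEq (Pos b)] in
theorem linearIndependent_rootVec : LinearIndependent ℂ (rootVec b) := by
  classical
  rw [linearIndependent_iff']
  intro S c hc i hi
  have h := congrArg (fun z => killingForm ℂ L z (rootDual b i)) hc
  simp only [map_sum, map_smul, LinearMap.sum_apply, LinearMap.smul_apply,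
    killing_rootVec_rootDual] at h
  simpa [hi] using h

variable (b) in
omit [DecidableEq (Pos b)] in
/-- The basis of the Lie algebra consisting of root vectors and a basis of the Cartan subalgebra. -/
def rootBasis : Module.Basis (Idx b) ℂ L := Module.Basis.mk linearIndependent_rootVec span_rootVec

omit [DecidableEq (Pos b)] in
@[simp] theorem rootBasis_apply (i : Idx b) : rootBasis b i = rootVec b i := by
  simp [rootBasis]

end Basis

end CatO
end

set_option linter.unusedSectionVars false

noncomputable section

namespace CatO

variable {L : Type u} [LieRing L] [LieAlgebra ℂ L]

/-! ### Generators of the enveloping algebra. -/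

section Gen

attribute [local instance 100] LieRing.ofAssociativeRing

variable (L) in
/-- The inclusion of the Lie algebra into its enveloping algebra, as a linear map. -/
def gen : L →ₗ[ℂ] Ug L := (UniversalEnvelopingAlgebra.ι ℂ : L →ₗ⁅ℂ⁆ Ug L).toLinearMap

theorem gen_eq (x : L) : gen L x = UniversalEnvelopingAlgebra.ι ℂ x := rfl

theorem gen_lie (x y : L) : gen L ⁅x, y⁆ = gen L x * gen L y - gen L y * gen L x := by
  rw [gen_eq, LieHom.map_lie]
  rfl

theorem gen_mul_gen (x y : L) : gen L x * gen L y = gen L y * gen L x + gen L ⁅x, y⁆ := by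
  rw [gen_lie]
  abel

theorem adjoin_gen : Algebra.adjoin ℂ (Set.range (gen L)) = ⊤ := by
  have h := congrArg (Subalgebra.map (UniversalEnvelopingAlgebra.mkAlgHom ℂ L))
    (TensorAlgebra.adjoin_range_ι (R := ℂ) (M := L))
  rw [AlgHom.map_adjoin, ← Set.range_comp, Algebra.map_top] at h
  have h₂ : (UniversalEnvelopingAlgebra.mkAlgHom ℂ L).range = ⊤ := by
    rw [AlgHom.range_eq_top]
    exact RingCon.mkₐ_surjective _
  rw [← h₂, ← h]
  rfl

theorem Ug_induction {p : Ug L → Prop} (hc : ∀ c : ℂ, p (algebraMap ℂ _ c)) (hg : ∀ x, p (gen L x))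
    (ha : ∀ y z, p y → p z → p (y + z)) (hm : ∀ y z, p y → p z → p (y * z)) (y : Ug L) : p y := by
  have h : y ∈ Algebra.adjoin ℂ (Set.range (gen L)) := by rw [adjoin_gen]; trivial
  induction h using Algebra.adjoin_induction with
  | mem x hx => obtain ⟨z, rfl⟩ := hx; exact hg z
  | algebraMap c => exact hc c
  | add y z _ _ hy hz => exact ha y z hy hz
  | mul y z _ _ hy hz => exact hm y z hy hz

/-- An element commuting with the Lie algebra is central. -/
theorem central_of_commute_gen {z : Ug L} (hz : ∀ x, z * gen L x = gen L x * z) (y : Ug L) :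
    z * y = y * z := by
  induction y using Ug_induction with
  | hc c => exact (Algebra.commutes c z).symm
  | hg x => exact hz x
  | ha x y hx hy => rw [mul_add, add_mul, hx, hy]
  | hm x y hx hy => rw [← mul_assoc, hx, mul_assoc, hy, mul_assoc]

theorem mem_span_words {ι : Type*} (B : Module.Basis ι ℂ L) (y : Ug L) :
    y ∈ Submodule.span ℂ {z | ∃ w : List ι, (w.map fun i => gen L (B i)).prod = z} := by
  induction y using Ug_induction with
  | hc c =>
    rw [Algebra.algebraMap_eq_smul_one]
    exact Submodule.smul_mem _ _ (Submodule.subset_span ⟨[], by simp⟩)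
  | hg x =>
    have h := Submodule.mem_map_of_mem (f := gen L) (B.mem_span x)
    rw [Submodule.map_span, ← Set.range_comp] at h
    refine Submodule.span_mono ?_ h
    rintro _ ⟨i, rfl⟩
    exact ⟨[i], by simp⟩
  | ha x y hx hy => exact add_mem hx hy
  | hm x y hx hy =>
    have h := Submodule.mul_mem_mul hx hy
    rw [Submodule.span_mul_span] at h
    refine Submodule.span_mono ?_ h
    rintro _ ⟨_, ⟨w, rfl⟩, _, ⟨w', rfl⟩, rfl⟩
    exact ⟨w ++ w', by simp⟩

end Gen

variable [FiniteDimensional ℂ L] [IsSemisimple ℂ L]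
  {H : LieSubalgebra ℂ L} [H.IsCartanSubalgebra] {b : (rootSystem H).Base}

/-! ### The PBW basis adapted to the triangular decomposition. -/

section PBW

/-- A normally ordered monomial in the negative root vectors. -/
def Fm (a : Multiset (Pos b)) : Ug L := (a.toList.map fun i => gen L (negVec i)).prod

/-- A normally ordered monomial in the positive root vectors. -/
def Em (a : Multiset (Pos b)) : Ug L := (a.toList.map fun i => gen L (posVec i)).prod

variable (H) in
/-- A monomial in the basis of the Cartan subalgebra. -/
def Hm (a : Multiset (Fin (finrank ℂ H))) : Ug L :=
  (a.toList.map fun j => gen L (cartanBasis H j : L)).prod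

@[simp] theorem Fm_zero : Fm (0 : Multiset (Pos b)) = 1 := by simp [Fm]
@[simp] theorem Em_zero : Em (0 : Multiset (Pos b)) = 1 := by simp [Em]
@[simp] theorem Hm_zero : Hm H 0 = 1 := by simp [Hm]

theorem Em_singleton (i : Pos b) : Em {i} = gen L (posVec i) := by simp [Em]

theorem gen_cartan_comm (x y : H) : gen L (x : L) * gen L (y : L) = gen L (y : L) * gen L (x : L) := by
  rw [gen_mul_gen]
  have h : ⁅(x : L), (y : L)⁆ = 0 := by
    rw [← LieSubalgebra.coe_bracket, trivial_lie_zero]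
    rfl
  rw [h, map_zero, add_zero]

theorem cartan_prod_perm {l l' : List (Fin (finrank ℂ H))} (h : l.Perm l') :
    (l.map fun j => gen L (cartanBasis H j : L)).prod =
      (l'.map fun j => gen L (cartanBasis H j : L)).prod := by
  induction h with
  | nil => rfl
  | cons i _ ih => simp [ih]
  | swap i j l => simp only [List.map_cons, List.prod_cons, ← mul_assoc, gen_cartan_comm]
  | trans _ _ h₁ h₂ => rw [h₁, h₂]

theorem Hm_mul_gen (h : Multiset (Fin (finrank ℂ H))) (j : Fin (finrank ℂ H)) :
    Hm H h * gen L (cartanBasis H j : L) = Hm H (j ::ₘ h) := by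
  have hp : (h.toList ++ [j]).Perm (j ::ₘ h).toList := by
    rw [← Multiset.coe_eq_coe, Multiset.coe_toList, ← Multiset.coe_add, Multiset.coe_toList,
      Multiset.coe_singleton, add_comm]
    rfl
  rw [Hm, Hm, ← cartan_prod_perm hp]
  simp

variable (b) in
/-- The index type of the Poincaré-Birkhoff-Witt basis. -/
abbrev PBWIdx : Type u := Multiset (Pos b) × Multiset (Pos b) × Multiset (Fin (finrank ℂ H))

/-- The word of a Poincaré-Birkhoff-Witt monomial. -/
def pbwRep (t : PBWIdx b) : List (Idx b) :=
  t.1.toList.map Sum.inl ++ (t.2.1.toList.map (Sum.inr ∘ Sum.inl) ++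
    t.2.2.toList.map (Sum.inr ∘ Sum.inr))

theorem coe_pbwRep (t : PBWIdx b) : (pbwRep t : Multiset (Idx b)) =
    t.1.map Sum.inl + (t.2.1.map (Sum.inr ∘ Sum.inl) + t.2.2.map (Sum.inr ∘ Sum.inr)) := by
  rw [pbwRep, ← Multiset.coe_add, ← Multiset.coe_add, ← Multiset.map_coe, ← Multiset.map_coe,
    ← Multiset.map_coe, Multiset.coe_toList, Multiset.coe_toList, Multiset.coe_toList]

theorem pbwRep_injective : Function.Injective fun t : PBWIdx b => (pbwRep t : Multiset (Idx b)) := by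
  classical
  rintro ⟨a, c, h⟩ ⟨a', c', h'⟩ heq
  simp only [coe_pbwRep] at heq
  have h₁ := fun i : Pos b => congrArg (Multiset.count (Sum.inl i)) heq
  have h₂ := fun i : Pos b => congrArg (Multiset.count (Sum.inr (Sum.inl i))) heq
  have h₃ := fun j => congrArg (Multiset.count (Sum.inr (Sum.inr j))) heq
  have e₁ : ∀ (s : Multiset (Pos b)) i,
      (s.map (Sum.inl : Pos b → Idx b)).count (Sum.inl i) = s.count i :=
    fun s i => Multiset.count_map_eq_count' _ _ Sum.inl_injective _
  have e₂ : ∀ (s : Multiset (Pos b)) i,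
      (s.map fun x => (Sum.inr (Sum.inl x) : Idx b)).count (Sum.inr (Sum.inl i)) = s.count i :=
    fun s i => Multiset.count_map_eq_count' (Sum.inr ∘ Sum.inl : Pos b → Idx b) _
      (Sum.inr_injective.comp Sum.inl_injective) i
  have e₃ : ∀ (s : Multiset (Fin (finrank ℂ H))) j,
      (s.map fun x => (Sum.inr (Sum.inr x) : Idx b)).count (Sum.inr (Sum.inr j)) = s.count j :=
    fun s j => Multiset.count_map_eq_count' (Sum.inr ∘ Sum.inr : _ → Idx b) _
      (Sum.inr_injective.comp Sum.inr_injective) j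
  have z : ∀ {α : Type u} (s : Multiset α) (f : α → Idx b) (k : Idx b), (∀ y, f y ≠ k) →
      (s.map f).count k = 0 := fun s f k hk => by
    rw [Multiset.count_eq_zero, Multiset.mem_map]; rintro ⟨y, -, hy⟩; exact hk y hy
  -- The Cartan indices live in `Type`, the positive roots in `Type u`, hence a second copy of `z`.
  have z' : ∀ {α : Type} (s : Multiset α) (f : α → Idx b) (k : Idx b), (∀ y, f y ≠ k) →
      (s.map f).count k = 0 := fun s f k hk => by
    rw [Multiset.count_eq_zero, Multiset.mem_map]; rintro ⟨y, -, hy⟩; exact hk y hy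
  refine Prod.ext (Multiset.ext.mpr fun i => ?_)
    (Prod.ext (Multiset.ext.mpr fun i => ?_) (Multiset.ext.mpr fun j => ?_))
  · simpa [Multiset.count_add, e₁, z c _ (Sum.inl i), z c' _ (Sum.inl i), z' h _ (Sum.inl i),
      z' h' _ (Sum.inl i)] using h₁ i
  · simpa [Multiset.count_add, e₂, z a _ (Sum.inr (Sum.inl i)), z a' _ (Sum.inr (Sum.inl i)),
      z' h _ (Sum.inr (Sum.inl i)), z' h' _ (Sum.inr (Sum.inl i))] using h₂ i
  · simpa [Multiset.count_add, e₃, z a _ (Sum.inr (Sum.inr j)), z a' _ (Sum.inr (Sum.inr j)),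
      z c _ (Sum.inr (Sum.inr j)), z c' _ (Sum.inr (Sum.inr j))] using h₃ j

theorem pbwRep_surjective (s : Multiset (Idx b)) : ∃ t : PBWIdx b, (pbwRep t : Multiset (Idx b)) = s := by
  simp only [coe_pbwRep]
  induction s using Multiset.induction_on with
  | empty => exact ⟨(0, 0, 0), by simp⟩
  | cons k s ih =>
    obtain ⟨⟨a, c, h⟩, rfl⟩ := ih
    rcases k with k | k | k
    · exact ⟨(k ::ₘ a, c, h), by simp⟩
    · exact ⟨(a, k ::ₘ c, h), by simp⟩
    · exact ⟨(a, c, k ::ₘ h), by simp⟩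

/-- With the Cartan factor rightmost, it acts on a weight vector by a scalar and disappears, leaving
the exponents of the negative and positive root vectors. -/
theorem pbw_prod (t : PBWIdx b) : ((pbwRep t).map fun i => gen L (rootBasis b i)).prod =
    Fm t.1 * Em t.2.1 * Hm H t.2.2 := by
  simp [pbwRep, Fm, Em, Hm, rootVec, mul_assoc, Function.comp_def]

variable (b) in
/-- The Poincaré-Birkhoff-Witt basis of the enveloping algebra. -/
def pbwBasis : Module.Basis (PBWIdx b) ℂ (Ug L) :=
  Module.Basis.mk (v := fun t : PBWIdx b => Fm t.1 * Em t.2.1 * Hm H t.2.2)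
    (by
      have h := linearIndependent_pbw (rootBasis b) (LieAlgebra.center_eq_bot ℂ L) pbwRep
        pbwRep_injective
      simp only [← gen_eq, pbw_prod] at h
      exact h)
    (by
      rintro y -
      have h := mem_span_words (rootBasis b) y
      refine Submodule.span_le.mpr ?_ h
      rintro _ ⟨w, rfl⟩
      have h₁ := word_mem_span (K := ℂ) (x := fun i => gen L (rootBasis b i)) (d := fun _ => ())
        (rep := pbwRep) pbwRep_surjective (by
          intro i j
          rw [← gen_lie]
          have h₂ := Submodule.mem_map_of_mem (f := gen L)
            ((rootBasis b).mem_span ⁅rootBasis b i, rootBasis b j⁆)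
          rw [Submodule.map_span, ← Set.range_comp] at h₂
          refine Submodule.span_mono ?_ h₂
          rintro _ ⟨k, rfl⟩
          exact ⟨k, rfl, rfl⟩) w
      refine Submodule.span_mono ?_ h₁
      rintro _ ⟨t, -, rfl⟩
      exact ⟨t, (pbw_prod t).symm⟩)

@[simp] theorem pbwBasis_apply (t : PBWIdx b) :
    pbwBasis b t = Fm t.1 * Em t.2.1 * Hm H t.2.2 := by
  simp [pbwBasis]

/-- Straightening of products of positive root vectors, keeping track of weights. -/
theorem Em_word_mem (w : List (Pos b)) : (w.map fun i => gen L (posVec i)).prod ∈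
    Submodule.span ℂ {y | ∃ c : Multiset (Pos b), wtm c = wtm (w : Multiset (Pos b)) ∧ Em c = y} := by
  have h₁ := word_mem_span (K := ℂ) (x := fun i : Pos b => gen L (posVec i)) (d := wt)
    (rep := Multiset.toList) (fun s => ⟨s, Multiset.coe_toList s⟩) (by
      intro i j
      rw [← gen_lie]
      have h₂ := Submodule.mem_map_of_mem (f := gen L) (lie_posVec_posVec_mem i j)
      rw [Submodule.map_span, ← Set.image_comp] at h₂
      exact h₂) w
  refine Submodule.span_mono ?_ h₁
  rintro _ ⟨c, hc, rfl⟩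
  refine ⟨c, ?_, rfl⟩
  have h₂ : ((c.toList : Multiset (Pos b)).map wt).sum = (c.toList.map wt).sum := by simp
  rw [Multiset.coe_toList] at h₂
  rw [wtm, h₂, hc, wtm]
  simp

theorem Em_mul_Em_mem (c d : Multiset (Pos b)) : Em c * Em d ∈
    Submodule.span ℂ {y | ∃ c' : Multiset (Pos b), wtm c' = wtm c + wtm d ∧ Em c' = y} := by
  have h := Em_word_mem (c.toList ++ d.toList)
  rw [← Multiset.coe_add, Multiset.coe_toList, Multiset.coe_toList, wtm_add, List.map_append,
    List.prod_append] at h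
  exact h

end PBW
end CatO
end

set_option linter.unusedSectionVars false

noncomputable section

namespace CatO

variable {L : Type u} [LieRing L] [LieAlgebra ℂ L] [FiniteDimensional ℂ L] [IsSemisimple ℂ L]
  {H : LieSubalgebra ℂ L} [H.IsCartanSubalgebra] {b : (rootSystem H).Base}

variable {M : Type v} [AddCommGroup M] [Module ℂ M] [Module (Ug L) M] [IsScalarTower ℂ (Ug L) M]
  {N : Type w} [AddCommGroup N] [Module ℂ N] [Module (Ug L) N] [IsScalarTower ℂ (Ug L) N]

/-! ### Weight spaces and weight modules. -/

section WeightSpaces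

variable (M) in
/-- The weight space of weight `μ`, as a complex subspace. -/
def wtSpace (μ : Dual ℂ H) : Submodule ℂ M where
  carrier := {v | ∀ h : H, gen L (h : L) • v = μ h • v}
  zero_mem' h := by simp
  add_mem' hv hw h := by rw [smul_add, smul_add, hv h, hw h]
  smul_mem' c v hv h := by rw [smul_algebra_smul_comm, hv h, smul_comm]

theorem mem_wtSpace {μ : Dual ℂ H} {v : M} :
    v ∈ wtSpace M μ ↔ ∀ h : H, gen L (h : L) • v = μ h • v := Iff.rfl

theorem mem_weightSpace_iff {μ : Dual ℂ H} {v : M} : v ∈ weightSpace M μ ↔ v ∈ wtSpace M μ := by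
  rw [mem_wtSpace]
  change (∀ h : H, _ = _) ↔ _
  simp only [algebraMap_smul, gen_eq]

variable (H M) in
/-- Weight modules: those spanned by their weight vectors. -/
def IsWt : Prop := ⨆ μ : Dual ℂ H, wtSpace M μ = ⊤

theorem isWt_iff : IsWt H M ↔ (⨆ μ : Dual ℂ H, weightSpace M μ) = ⊤ := by
  constructor
  · intro h
    rw [eq_top_iff]
    intro m _
    have hm : m ∈ ⨆ μ : Dual ℂ H, wtSpace M μ := by rw [h]; trivial
    induction hm using Submodule.iSup_induction' with
    | mem μ x hx => exact AddSubgroup.mem_iSup_of_mem μ (mem_weightSpace_iff.mpr hx)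
    | zero => exact zero_mem _
    | add x y _ _ hx hy => exact add_mem (hx trivial) (hy trivial)
  · intro h
    rw [IsWt, eq_top_iff]
    intro m _
    have hm : m ∈ ⨆ μ : Dual ℂ H, weightSpace M μ := by rw [h]; trivial
    induction hm using AddSubgroup.iSup_induction' with
    | hp μ x hx => exact Submodule.mem_iSup_of_mem μ (mem_weightSpace_iff.mp hx)
    | h1 => exact zero_mem _
    | hadd x y _ _ hx hy => exact add_mem (hx trivial) (hy trivial)

theorem IsWt.exists_finsupp (h : IsWt H M) (m : M) :
    ∃ f : Dual ℂ H →₀ M, (∀ μ, f μ ∈ wtSpace M μ) ∧ ∑ μ ∈ f.support, f μ = m := by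
  have hm : m ∈ ⨆ μ : Dual ℂ H, wtSpace M μ := by rw [h]; trivial
  exact (Submodule.mem_iSup_iff_exists_finsupp _ _).mp hm

theorem isWt_of_forall (h : ∀ m : M, ∃ (S : Finset (Dual ℂ H)) (f : Dual ℂ H → M),
    (∀ μ, f μ ∈ wtSpace M μ) ∧ ∑ μ ∈ S, f μ = m) : IsWt H M := by
  rw [IsWt, eq_top_iff]
  intro m _
  obtain ⟨S, f, hf, rfl⟩ := h m
  exact sum_mem fun μ _ => Submodule.mem_iSup_of_mem μ (hf μ)

theorem map_mem_wtSpace (g : M →ₗ[Ug L] N) {μ : Dual ℂ H} {v : M} (hv : v ∈ wtSpace M μ) :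
    g v ∈ wtSpace N μ := fun h => by
  rw [← map_smul, hv h]
  exact (g.restrictScalars ℂ).map_smul _ _

variable (M) in
/-- An element of the enveloping algebra which projects onto a weight space along finitely many
others. -/
theorem exists_projector (μ : Dual ℂ H) (S : Finset (Dual ℂ H)) (hμ : μ ∉ S) :
    ∃ p : Ug L, (∀ v ∈ wtSpace M μ, p • v = v) ∧ (∀ ν ∈ S, ∀ v ∈ wtSpace M ν, p • v = 0) ∧
      ∀ ν : Dual ℂ H, ∀ v ∈ wtSpace M ν, ∃ c : ℂ, p • v = c • v := by
  classical
  induction S using Finset.induction_on with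
  | empty => exact ⟨1, by simp, by simp, fun ν v _ => ⟨1, by simp⟩⟩
  | insert κ S _ ih =>
    obtain ⟨p, hp₁, hp₂, hp₃⟩ := ih fun h => hμ (Finset.mem_insert_of_mem h)
    have hne : μ ≠ κ := fun h => hμ (h ▸ Finset.mem_insert_self _ _)
    obtain ⟨h, hh⟩ : ∃ h, μ h ≠ κ h := by
      by_contra! h'
      exact hne (LinearMap.ext h')
    have hh' : μ h - κ h ≠ 0 := sub_ne_zero.mpr hh
    -- Lagrange interpolation, one linear factor for each weight to be killed, with `h` separating
    -- it from `μ`. The last clause of the statement lets the factor `q` still see a weight vector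
    -- after `p` has acted.
    let q : Ug L := (μ h - κ h)⁻¹ • (gen L (h : L) - algebraMap ℂ _ (κ h))
    have hq : ∀ ν : Dual ℂ H, ∀ v ∈ wtSpace M ν, q • v = ((μ h - κ h)⁻¹ * (ν h - κ h)) • v := by
      intro ν v hv
      rw [smul_assoc, sub_smul, hv h, algebraMap_smul, ← sub_smul, smul_smul]
    refine ⟨q * p, fun v hv => ?_, fun ν hν v hv => ?_, fun ν v hv => ?_⟩
    · rw [mul_smul, hp₁ v hv, hq μ v hv, inv_mul_cancel₀ hh', one_smul]
    · obtain ⟨c, hc⟩ := hp₃ ν v hv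
      rcases Finset.mem_insert.mp hν with rfl | hν
      · rw [mul_smul, hc, hq ν _ (Submodule.smul_mem _ _ hv), sub_self, mul_zero, zero_smul]
      · rw [mul_smul, hp₂ ν hν v hv, smul_zero]
    · obtain ⟨c, hc⟩ := hp₃ ν v hv
      exact ⟨_, by rw [mul_smul, hc, hq ν _ (Submodule.smul_mem _ _ hv), smul_smul]⟩

/-- Submodules contain the weight components of their elements. -/
theorem component_mem {N : Submodule (Ug L) M} {S : Finset (Dual ℂ H)} {f : Dual ℂ H → M}
    (hf : ∀ μ, f μ ∈ wtSpace M μ) (h : ∑ μ ∈ S, f μ ∈ N) {μ : Dual ℂ H} (hμ : μ ∈ S) : f μ ∈ N := by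
  classical
  obtain ⟨p, hp₁, hp₂, -⟩ := exists_projector M μ (S.erase μ) (Finset.notMem_erase _ _)
  have h₁ := N.smul_mem p h
  rw [Finset.smul_sum, ← Finset.add_sum_erase _ _ hμ, hp₁ _ (hf μ),
    Finset.sum_eq_zero fun ν hν => hp₂ ν hν _ (hf ν), add_zero] at h₁
  exact h₁

theorem IsWt.submodule (h : IsWt H M) (N : Submodule (Ug L) M) : IsWt H N := by
  refine isWt_of_forall fun n => ?_
  obtain ⟨f, hf, hs⟩ := h.exists_finsupp (n : M)
  have hfN : ∀ μ, f μ ∈ N := fun μ => by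
    by_cases hμ : μ ∈ f.support
    · exact component_mem hf (by rw [hs]; exact n.2) hμ
    · rw [Finsupp.notMem_support_iff.mp hμ]; exact zero_mem _
  refine ⟨f.support, fun μ => ⟨f μ, hfN μ⟩, fun μ => ?_, Subtype.ext ?_⟩
  · intro x
    exact Subtype.ext (hf μ x)
  · rw [AddSubmonoidClass.coe_finsetSum]
    exact hs

theorem IsWt.of_surjective (h : IsWt H M) (g : M →ₗ[Ug L] N) (hg : Function.Surjective g) :
    IsWt H N := by
  refine isWt_of_forall fun n => ?_
  obtain ⟨m, rfl⟩ := hg n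
  obtain ⟨f, hf, rfl⟩ := h.exists_finsupp m
  exact ⟨f.support, fun μ => g (f μ), fun μ => map_mem_wtSpace g (hf μ), (map_sum g _ _).symm⟩

/-- The component of weight `μ` of any preimage works: a projector onto weight `μ` kills the images
of the other components. -/
theorem IsWt.exists_lift (h : IsWt H M) (g : M →ₗ[Ug L] N) {μ : Dual ℂ H} {m : M}
    (hn : g m ∈ wtSpace N μ) : ∃ m' ∈ wtSpace M μ, g m' = g m := by
  classical
  obtain ⟨f, hf, hs⟩ := h.exists_finsupp m
  refine ⟨f μ, hf μ, ?_⟩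
  obtain ⟨p, hp₁, hp₂, -⟩ := exists_projector N μ (f.support.erase μ) (Finset.notMem_erase _ _)
  have h₁ := hp₁ _ hn
  rw [← hs, map_sum, Finset.smul_sum] at h₁
  rw [← hs, map_sum, ← h₁]
  by_cases hμ : μ ∈ f.support
  · rw [← Finset.add_sum_erase _ _ hμ, hp₁ _ (map_mem_wtSpace g (hf μ)),
      Finset.sum_eq_zero fun ν hν => hp₂ ν hν _ (map_mem_wtSpace g (hf ν)), add_zero]
  · rw [Finsupp.notMem_support_iff.mp hμ, map_zero]
    refine (Finset.sum_eq_zero fun ν hν => hp₂ ν ?_ _ (map_mem_wtSpace g (hf ν))).symm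
    exact Finset.mem_erase.mpr ⟨fun h => hμ (h ▸ hν), hν⟩

theorem exists_weight_of_span {I : Type*} {f : I → M} {ω : I → Dual ℂ H}
    (hf : ∀ i, f i ∈ wtSpace M (ω i)) (hs : ⊤ ≤ Submodule.span ℂ (Set.range f)) {ν : Dual ℂ H}
    (hν : wtSpace M ν ≠ ⊥) : ∃ i, ω i = ν := by
  classical
  by_contra! hne
  refine hν ((Submodule.eq_bot_iff _).mpr fun x hx => ?_)
  obtain ⟨c, hc⟩ := (Finsupp.mem_span_range_iff_exists_finsupp).mp (hs (Submodule.mem_top (x := x)))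
  obtain ⟨p, hp₁, hp₂, -⟩ := exists_projector M ν (c.support.image ω) (by
    simp only [Finset.mem_image, not_exists, not_and]
    exact fun i _ => hne i)
  rw [← hp₁ x hx, ← hc, Finsupp.sum, Finset.smul_sum]
  exact Finset.sum_eq_zero fun i hi => hp₂ (ω i) (Finset.mem_image_of_mem _ hi) _
    (Submodule.smul_mem _ _ (hf i))

theorem isWt_of_span {I : Type*} {f : I → M} {ω : I → Dual ℂ H}
    (hf : ∀ i, f i ∈ wtSpace M (ω i)) (hs : ⊤ ≤ Submodule.span ℂ (Set.range f)) : IsWt H M := by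
  rw [IsWt, eq_top_iff]
  refine hs.trans (Submodule.span_le.mpr ?_)
  rintro _ ⟨i, rfl⟩
  exact Submodule.mem_iSup_of_mem (ω i) (hf i)

theorem wtSpace_eq_span {I : Type*} {f : I → M} {ω : I → Dual ℂ H}
    (hf : ∀ i, f i ∈ wtSpace M (ω i)) (hs : ⊤ ≤ Submodule.span ℂ (Set.range f)) (ν : Dual ℂ H) :
    wtSpace M ν = Submodule.span ℂ (Set.range fun i : {i // ω i = ν} => f i) := by
  classical
  refine le_antisymm (fun x hx => ?_) (Submodule.span_le.mpr ?_)
  · obtain ⟨c, hc⟩ := (Finsupp.mem_span_range_iff_exists_finsupp).mp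
      (hs (Submodule.mem_top (x := x)))
    obtain ⟨p, hp₁, hp₂, -⟩ := exists_projector M ν ((c.support.image ω).erase ν)
      (Finset.notMem_erase _ _)
    rw [← hp₁ x hx, ← hc, Finsupp.sum, Finset.smul_sum]
    refine sum_mem fun i hi => ?_
    by_cases h : ω i = ν
    · rw [hp₁ _ (Submodule.smul_mem _ _ (h ▸ hf i))]
      exact Submodule.smul_mem _ _ (Submodule.subset_span ⟨⟨i, h⟩, rfl⟩)
    · rw [hp₂ (ω i) (Finset.mem_erase.mpr ⟨h, Finset.mem_image_of_mem _ hi⟩) _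
        (Submodule.smul_mem _ _ (hf i))]
      exact zero_mem _
  · rintro _ ⟨⟨i, rfl⟩, rfl⟩
    exact hf i

theorem finiteDimensional_wtSpace {I : Type*} {f : I → M} {ω : I → Dual ℂ H}
    (hf : ∀ i, f i ∈ wtSpace M (ω i)) (hs : ⊤ ≤ Submodule.span ℂ (Set.range f)) (ν : Dual ℂ H)
    [Finite {i // ω i = ν}] : FiniteDimensional ℂ (wtSpace M ν) := by
  rw [wtSpace_eq_span hf hs]
  exact FiniteDimensional.span_of_finite ℂ (Set.finite_range _)

theorem finrank_wtSpace {I : Type*} {f : I → M} {ω : I → Dual ℂ H}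
    (hf : ∀ i, f i ∈ wtSpace M (ω i)) (hi : LinearIndependent ℂ f)
    (hs : ⊤ ≤ Submodule.span ℂ (Set.range f)) (ν : Dual ℂ H) [Finite {i // ω i = ν}] :
    finrank ℂ (wtSpace M ν) = Nat.card {i // ω i = ν} := by
  have : Fintype {i // ω i = ν} := Fintype.ofFinite _
  have h := finrank_span_eq_card (hi.comp (Subtype.val : {i // ω i = ν} → I)
    Subtype.val_injective)
  rw [wtSpace_eq_span hf hs, Nat.card_eq_fintype_card]
  exact h

end WeightSpaces

/-! ### The action of root vectors and PBW monomials on weight spaces. -/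

section Action

theorem gen_smul_mem {x : L} {χ μ : Dual ℂ H} (hx : ∀ h : H, ⁅(h : L), x⁆ = χ h • x) {v : M}
    (hv : v ∈ wtSpace M μ) : gen L x • v ∈ wtSpace M (χ + μ) := fun h => by
  rw [← mul_smul, gen_mul_gen, add_smul, mul_smul, hv h, hx h, map_smul, smul_assoc,
    smul_algebra_smul_comm, LinearMap.add_apply, add_smul, add_comm]

theorem posVec_smul_mem {μ : Dual ℂ H} (i : Pos b) {v : M} (hv : v ∈ wtSpace M μ) :
    gen L (posVec i) • v ∈ wtSpace M (wt i + μ) :=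
  gen_smul_mem (fun h => lie_posVec h i) hv

theorem negVec_smul_mem {μ : Dual ℂ H} (i : Pos b) {v : M} (hv : v ∈ wtSpace M μ) :
    gen L (negVec i) • v ∈ wtSpace M (-wt i + μ) :=
  gen_smul_mem (fun h => lie_negVec h i) hv

theorem Em_smul_mem {μ : Dual ℂ H} (c : Multiset (Pos b)) {v : M} (hv : v ∈ wtSpace M μ) :
    Em c • v ∈ wtSpace M (wtm c + μ) := by
  have h : ∀ l : List (Pos b), (l.map fun i => gen L (posVec i)).prod • v ∈
      wtSpace M (wtm (l : Multiset (Pos b)) + μ) := by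
    intro l
    induction l with
    | nil => simpa using hv
    | cons i l ih =>
      rw [List.map_cons, List.prod_cons, mul_smul, ← Multiset.cons_coe, wtm_cons, add_assoc]
      exact posVec_smul_mem i ih
  have := h c.toList
  rwa [Multiset.coe_toList] at this

theorem Fm_smul_mem {μ : Dual ℂ H} (c : Multiset (Pos b)) {v : M} (hv : v ∈ wtSpace M μ) :
    Fm c • v ∈ wtSpace M (-wtm c + μ) := by
  have h : ∀ l : List (Pos b), (l.map fun i => gen L (negVec i)).prod • v ∈
      wtSpace M (-wtm (l : Multiset (Pos b)) + μ) := by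
    intro l
    induction l with
    | nil => simpa using hv
    | cons i l ih =>
      rw [List.map_cons, List.prod_cons, mul_smul, ← Multiset.cons_coe, wtm_cons, neg_add, add_assoc]
      exact negVec_smul_mem i ih
  have := h c.toList
  rwa [Multiset.coe_toList] at this

variable (H) in
/-- The scalar by which a Cartan monomial acts on a weight space. -/
def cartanScalar (μ : Dual ℂ H) (a : Multiset (Fin (finrank ℂ H))) : ℂ :=
  (a.map fun j => μ (cartanBasis H j)).prod

theorem Hm_smul {μ : Dual ℂ H} (a : Multiset (Fin (finrank ℂ H))) {v : M} (hv : v ∈ wtSpace M μ) :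
    Hm H a • v = cartanScalar H μ a • v := by
  have h : ∀ l : List (Fin (finrank ℂ H)),
      (l.map fun j => gen L (cartanBasis H j : L)).prod • v =
        cartanScalar H μ (l : Multiset (Fin (finrank ℂ H))) • v := by
    intro l
    induction l with
    | nil => simp [cartanScalar]
    | cons i l ih =>
      rw [List.map_cons, List.prod_cons, mul_smul, ih, smul_algebra_smul_comm, hv]
      simp [cartanScalar, smul_smul, mul_comm]
  have := h a.toList
  rwa [Multiset.coe_toList] at this

/-- A vector killed by all positive root vectors is killed by all nontrivial monomials in them. -/
theorem Em_smul_eq_zero {v : M} (hv : ∀ i : Pos b, gen L (posVec i) • v = 0)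
    {c : Multiset (Pos b)} (hc : c ≠ 0) : Em c • v = 0 := by
  have hl : c.toList ≠ [] := fun h => hc (Multiset.toList_eq_nil.mp h)
  rw [Em]
  generalize c.toList = l at hl ⊢
  induction l with
  | nil => exact absurd rfl hl
  | cons i l ih =>
    rcases l with _ | ⟨j, l⟩
    · simp [hv]
    · rw [List.map_cons, List.prod_cons, mul_smul, ih (List.cons_ne_nil _ _), smul_zero]

end Action

/-! ### Modules with weights bounded above, and their maximal weights. -/

section Bounded

variable (b M) in
/-- The weights lie in finitely many cones `ν - Q₊`. -/
def IsBdd : Prop :=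
  ∃ S : Finset (Dual ℂ H), ∀ μ : Dual ℂ H, wtSpace M μ ≠ ⊥ → ∃ ν ∈ S, ν - μ ∈ Qpos b

theorem isCategoryO_iff : IsCategoryO b M ↔ Module.Finite (Ug L) M ∧ IsWt H M ∧ IsBdd b M := by
  have h : ∀ μ : Dual ℂ H, weightSpace M μ = ⊥ ↔ wtSpace M μ = ⊥ := fun μ => by
    rw [Submodule.eq_bot_iff, AddSubgroup.eq_bot_iff_forall]
    simp only [mem_weightSpace_iff]
  rw [IsCategoryO, isWt_iff, IsBdd]
  simp only [ne_eq, h]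

theorem wtSpace_ne_bot_of_injective (g : M →ₗ[Ug L] N) (hg : Function.Injective g) {μ : Dual ℂ H}
    (h : wtSpace M μ ≠ ⊥) : wtSpace N μ ≠ ⊥ := by
  obtain ⟨v, hv, hv₀⟩ := (Submodule.ne_bot_iff _).mp h
  exact (Submodule.ne_bot_iff _).mpr ⟨g v, map_mem_wtSpace g hv, fun h => hv₀ (hg (by simpa using h))⟩

theorem wtSpace_ne_bot_of_surjective (hM : IsWt H M) (g : M →ₗ[Ug L] N)
    (hg : Function.Surjective g) {μ : Dual ℂ H} (h : wtSpace N μ ≠ ⊥) : wtSpace M μ ≠ ⊥ := by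
  obtain ⟨v, hv, hv₀⟩ := (Submodule.ne_bot_iff _).mp h
  obtain ⟨m, rfl⟩ := hg v
  obtain ⟨m', hm', h'⟩ := hM.exists_lift g hv
  exact (Submodule.ne_bot_iff _).mpr ⟨m', hm', fun h => hv₀ (by rw [← h', h, map_zero])⟩

theorem IsBdd.submodule (h : IsBdd b M) (N : Submodule (Ug L) M) : IsBdd b N := by
  obtain ⟨S, hS⟩ := h
  exact ⟨S, fun μ hμ => hS μ (wtSpace_ne_bot_of_injective N.subtype N.subtype_injective hμ)⟩

theorem IsBdd.of_surjective (h : IsBdd b M) (hM : IsWt H M) (g : M →ₗ[Ug L] N)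
    (hg : Function.Surjective g) : IsBdd b N := by
  obtain ⟨S, hS⟩ := h
  exact ⟨S, fun μ hμ => hS μ (wtSpace_ne_bot_of_surjective hM g hg hμ)⟩

/-- Above every weight of a bounded module there is a maximal one. -/
theorem IsBdd.exists_maximal (h : IsBdd b M) {μ : Dual ℂ H} (hμ : wtSpace M μ ≠ ⊥) :
    ∃ β ∈ Qpos b, wtSpace M (μ + β) ≠ ⊥ ∧
      ∀ γ ∈ Qpos b, wtSpace M (μ + β + γ) ≠ ⊥ → γ = 0 := by
  obtain ⟨S, hS⟩ := h
  -- If `μ + β` lies below `ν`, the height of `β` is at most that of `ν - μ`, and the cone has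
  -- finitely many elements of bounded height.
  have hfin : {β : Dual ℂ H | β ∈ Qpos b ∧ wtSpace M (μ + β) ≠ ⊥}.Finite := by
    refine (Set.Finite.biUnion S.finite_toSet fun ν _ =>
      finite_Qpos_hgt_le (b := b) (hgt b (ν - μ))).subset ?_
    rintro β ⟨hβ, hne⟩
    obtain ⟨ν, hν, h⟩ := hS _ hne
    refine Set.mem_biUnion hν ⟨hβ, ?_⟩
    have := hgt_nonneg h
    rw [← sub_sub, map_sub] at this
    linarith
  obtain ⟨β, hβ, hmax⟩ := hfin.toFinset.exists_max_image (hgt b) ⟨0, by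
    rw [hfin.mem_toFinset]
    exact ⟨zero_mem _, by rwa [add_zero]⟩⟩
  have hβ' := hfin.mem_toFinset.mp hβ
  refine ⟨β, hβ'.1, hβ'.2, fun γ hγ hne => eq_zero_of_hgt_le hγ ?_⟩
  have := hmax (β + γ) (hfin.mem_toFinset.mpr ⟨add_mem hβ'.1 hγ, by rwa [← add_assoc]⟩)
  rw [map_add] at this
  linarith

theorem IsWt.exists_ne_bot (h : IsWt H M) [Nontrivial M] : ∃ μ : Dual ℂ H, wtSpace M μ ≠ ⊥ := by
  by_contra! h'
  rw [IsWt] at h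
  simp only [h', iSup_bot] at h
  exact bot_ne_top h

end Bounded

/-! ### Closure properties of category O. -/

section CategoryO

theorem IsWt.quotient (h : IsWt H M) (N : Submodule (Ug L) M) : IsWt H (M ⧸ N) :=
  h.of_surjective N.mkQ N.mkQ_surjective

/-- Quotients of objects of category `O` are in category `O`. -/
theorem catO_of_surjective (h : IsCategoryO b M) (g : M →ₗ[Ug L] N) (hg : Function.Surjective g) :
    IsCategoryO b N := by
  rw [isCategoryO_iff] at h ⊢
  have := h.1
  exact ⟨Module.Finite.of_surjective g hg, h.2.1.of_surjective g hg, h.2.2.of_surjective h.2.1 g hg⟩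

theorem catO_quotient (h : IsCategoryO b M) (N : Submodule (Ug L) M) : IsCategoryO b (M ⧸ N) :=
  catO_of_surjective h N.mkQ N.mkQ_surjective

theorem catO_submodule [IsNoetherian (Ug L) M] (h : IsCategoryO b M) (N : Submodule (Ug L) M) :
    IsCategoryO b N := by
  rw [isCategoryO_iff] at h ⊢
  exact ⟨inferInstance, h.2.1.submodule N, h.2.2.submodule N⟩

end CategoryO

end CatO
end

set_option linter.unusedSectionVars false

noncomputable section

namespace CatO

variable {L : Type u} [LieRing L] [LieAlgebra ℂ L] [FiniteDimensional ℂ L] [IsSemisimple ℂ L]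
  {H : LieSubalgebra ℂ L} [H.IsCartanSubalgebra] (b : (rootSystem H).Base)

/-! ### The Casimir element and its scalar on highest weight vectors. -/

section Casimir

/-- The Casimir element. -/
def casimir : Ug L := ∑ k : Idx b, gen L (rootVec b k) * gen L (rootDual b k)

variable {b}

theorem rootBasis_repr (x : L) (k : Idx b) :
    (rootBasis b).repr x k = killingForm ℂ L x (rootDual b k) := by
  classical
  conv_rhs => rw [← (rootBasis b).sum_repr x]
  simp only [map_sum, map_smul, LinearMap.sum_apply, LinearMap.smul_apply, rootBasis_apply,
    killing_rootVec_rootDual, smul_eq_mul, mul_ite, mul_one, mul_zero, Finset.sum_ite_eq',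
    Finset.mem_univ, if_true]

variable (b) in
theorem eq_sum_rootVec (x : L) : x = ∑ k, killingForm ℂ L x (rootDual b k) • rootVec b k := by
  conv_lhs => rw [← (rootBasis b).sum_repr x]
  simp [rootBasis_repr]

variable (b) in
theorem eq_sum_rootDual (x : L) : x = ∑ k, killingForm ℂ L (rootVec b k) x • rootDual b k := by
  classical
  rw [← sub_eq_zero]
  have h : ∀ y : L, killingForm ℂ L (x - ∑ k, killingForm ℂ L (rootVec b k) x • rootDual b k) y = 0 := by
    intro y
    rw [LieModule.traceForm_comm, ← (rootBasis b).sum_repr y]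
    simp only [map_sum, map_smul, LinearMap.sum_apply, LinearMap.smul_apply, rootBasis_apply]
    refine Finset.sum_eq_zero fun k _ => ?_
    rw [map_sub, map_sum]
    simp [killing_rootVec_rootDual]
  have h₁ : (x - ∑ k, killingForm ℂ L (rootVec b k) x • rootDual b k) ∈
      LinearMap.ker (killingForm ℂ L) := LinearMap.mem_ker.mpr (LinearMap.ext h)
  rwa [LieAlgebra.IsKilling.ker_killingForm_eq_bot, Submodule.mem_bot] at h₁

variable (b) in
-- Expanding the action of `z` on both dual bases gives two coefficient matrices, which cancel by
-- invariance of the Killing form.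
theorem casimir_commute_gen (z : L) : casimir b * gen L z = gen L z * casimir b := by
  have h₁ : gen L z * casimir b - casimir b * gen L z =
      ∑ k, (gen L ⁅z, rootVec b k⁆ * gen L (rootDual b k) +
        gen L (rootVec b k) * gen L ⁅z, rootDual b k⁆) := by
    rw [casimir, Finset.mul_sum, Finset.sum_mul, ← Finset.sum_sub_distrib]
    refine Finset.sum_congr rfl fun k _ => ?_
    rw [gen_lie, gen_lie]
    noncomm_ring
  have h₂ : ∑ k, gen L ⁅z, rootVec b k⁆ * gen L (rootDual b k) =
      ∑ k, ∑ l, killingForm ℂ L ⁅z, rootVec b k⁆ (rootDual b l) •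
        (gen L (rootVec b l) * gen L (rootDual b k)) := by
    refine Finset.sum_congr rfl fun k _ => ?_
    conv_lhs => rw [eq_sum_rootVec b ⁅z, rootVec b k⁆, map_sum, Finset.sum_mul]
    exact Finset.sum_congr rfl fun l _ => by rw [map_smul, smul_mul_assoc]
  have h₃ : ∑ k, gen L (rootVec b k) * gen L ⁅z, rootDual b k⁆ =
      ∑ k, ∑ l, killingForm ℂ L (rootVec b k) ⁅z, rootDual b l⁆ •
        (gen L (rootVec b l) * gen L (rootDual b k)) := by
    rw [Finset.sum_comm]
    refine Finset.sum_congr rfl fun k _ => ?_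
    conv_lhs => rw [eq_sum_rootDual b ⁅z, rootDual b k⁆, map_sum, Finset.mul_sum]
    exact Finset.sum_congr rfl fun l _ => by rw [map_smul, mul_smul_comm]
  rw [← sub_eq_zero, ← neg_sub, h₁, neg_eq_zero, Finset.sum_add_distrib, h₂, h₃,
    ← Finset.sum_add_distrib]
  refine Finset.sum_eq_zero fun k _ => ?_
  rw [← Finset.sum_add_distrib]
  refine Finset.sum_eq_zero fun l _ => ?_
  rw [← add_smul, ← LieModule.traceForm_apply_lie_apply, ← lie_skew, map_neg, LinearMap.neg_apply,
    neg_add_cancel, zero_smul]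

variable (b) in
theorem casimir_central (y : Ug L) : casimir b * y = y * casimir b :=
  central_of_commute_gen (casimir_commute_gen b) y

/-- The element of the Cartan subalgebra representing a weight. -/
abbrev rep (φ : Dual ℂ H) : H := (cartanEquivDual H).symm φ

theorem trace_rep (φ : Dual ℂ H) (x : H) : LieModule.traceForm ℂ H L (rep φ) x = φ x := by
  have h : cartanEquivDual H (rep φ) x = φ x := by rw [rep, LinearEquiv.apply_symm_apply]
  exact h

theorem apply_rep_comm (φ ψ : Dual ℂ H) : φ (rep ψ) = ψ (rep φ) := by
  rw [← trace_rep φ, LieModule.traceForm_comm, trace_rep]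

theorem lie_posVec_negVec (i : Pos b) : ⁅posVec i, negVec i⁆ = (rep (wt i) : L) := by
  have h := lie_eq_killingForm_smul_of_mem_rootSpace_of_mem_rootSpace_neg
    (α := (i.1 : LieModule.Weight ℂ H L)) (posVec_mem i) (negVec_mem i)
  rw [killing_posVec_negVec, one_smul] at h
  exact h

variable (b) in
/-- The scalar by which the Casimir element acts on highest weight vectors. -/
def casScalar (μ : Dual ℂ H) : ℂ :=
  (∑ j, μ (cartanBasis H j) * μ (cartanDual H j)) + ∑ i : Pos b, μ (rep (wt i))

/-- The terms f·e vanish on `v`, the terms e·f reduce to their brackets in the Cartan subalgebra,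
and the rest acts by the weight. The resulting scalar is (μ, μ + 2ρ). -/
theorem casimir_smul {M : Type v} [AddCommGroup M] [Module ℂ M] [Module (Ug L) M]
    [IsScalarTower ℂ (Ug L) M] {μ : Dual ℂ H} {v : M} (hv : v ∈ wtSpace M μ)
    (hv' : ∀ i : Pos b, gen L (posVec i) • v = 0) : casimir b • v = casScalar b μ • v := by
  rw [casimir, Fintype.sum_sum_type, Fintype.sum_sum_type, add_smul, add_smul, Finset.sum_smul,
    Finset.sum_smul, Finset.sum_smul, casScalar, add_smul, Finset.sum_smul, Finset.sum_smul,
    Finset.sum_eq_zero (s := Finset.univ (α := Pos b)) (f := fun i => _ • v), zero_add, add_comm]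
  · congr 1
    · refine Finset.sum_congr rfl fun j _ => ?_
      simp only [rootVec, rootDual, Sum.elim_inr]
      rw [mul_smul, hv, smul_algebra_smul_comm, hv, smul_smul, mul_comm]
    · refine Finset.sum_congr rfl fun i _ => ?_
      simp only [rootVec, rootDual, Sum.elim_inr, Sum.elim_inl]
      rw [gen_mul_gen, add_smul, mul_smul, hv', smul_zero, zero_add, lie_posVec_negVec, hv]
  · intro i _
    simp only [rootVec, rootDual, Sum.elim_inl]
    rw [mul_smul, hv', smul_zero]

end Casimir

/-! ### Finiteness of the fibers of the Casimir scalar along Q₊. -/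

section Finiteness

variable {b}

/-- The Killing form on the Cartan subalgebra is the sum of the squares of the roots, so (φ, φ) is a
sum of squares, of real numbers when all (α, φ) are real. -/
theorem apply_rep_self (φ : Dual ℂ H) : φ (rep φ) =
    ∑ α : H.root, (rootSystem H).root α (rep φ) ^ 2 := by
  have h := congrArg (fun B : LinearMap.BilinForm ℂ H => B (rep φ) (rep φ))
    (restrict_killingForm_eq_sum (K := ℂ) (H := H))
  simp only [LinearMap.sum_apply, LinearMap.smulRight_apply] at h
  rw [← trace_rep φ]
  rw [← Finset.sum_coe_sort H.root] at h
  refine Eq.trans h (Finset.sum_congr rfl fun α _ => ?_)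
  rw [LinearMap.smul_apply, smul_eq_mul, sq]
  rfl

theorem sum_cartanBasis_smul_cartanDual (φ : Dual ℂ H) :
    ∑ j, φ (cartanBasis H j) • cartanDual H j = rep φ := by
  rw [← sub_eq_zero]
  refine (trace_nondegenerate H).1 _ fun y => ?_
  rw [← (cartanBasis H).sum_repr y]
  simp only [map_sum, map_smul]
  refine Finset.sum_eq_zero fun k _ => ?_
  rw [map_sub, LinearMap.sub_apply, trace_rep, map_sum, LinearMap.sum_apply]
  simp [LieModule.traceForm_comm ℂ H L (cartanDual H _), trace_cartanBasis_cartanDual]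

theorem sum_cartan (φ ψ : Dual ℂ H) :
    ∑ j, φ (cartanBasis H j) * ψ (cartanDual H j) = ψ (rep φ) := by
  rw [← sum_cartanBasis_smul_cartanDual φ, map_sum]
  simp

/-- Put q = (β, β). Integrality of coroot pairings gives (γ, β) = n_γ q / 2, and the sum-of-squares
formula becomes q = q² Σ n_γ² / 4. Hence q = 4 / Σ n_γ² is real, and so are all (α, β). -/
theorem root_apply_rep_real (α β : H.root) :
    (((rootSystem H).root α) (rep ((rootSystem H).root β))).im = 0 := by
  set q := (rootSystem H).root β (rep ((rootSystem H).root β)) with hq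
  have hβ : (β : LieModule.Weight ℂ H L).IsNonZero := LieSubalgebra.isNonZero_coe_root β
  have hq₀ : q ≠ 0 := root_apply_cartanEquivDual_symm_ne_zero hβ
  have h : ∀ γ : H.root, ∃ n : ℤ, (rootSystem H).root γ (rep ((rootSystem H).root β)) = n * (q / 2) := by
    intro γ
    obtain ⟨n, hn⟩ : ∃ n : ℤ, (γ : LieModule.Weight ℂ H L) (coroot (β : LieModule.Weight ℂ H L)) = n :=
      ⟨_, apply_coroot_eq_cast (β : LieModule.Weight ℂ H L) γ⟩
    refine ⟨n, ?_⟩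
    have h₁ : (rootSystem H).root γ (coroot (β : LieModule.Weight ℂ H L)) =
        2 * (q⁻¹ * (rootSystem H).root γ (rep ((rootSystem H).root β))) := by
      rw [coroot, map_nsmul, map_smul, nsmul_eq_mul, smul_eq_mul]
      rfl
    have h₂ : (rootSystem H).root γ (coroot (β : LieModule.Weight ℂ H L)) = n := hn
    rw [← h₂, h₁]
    field_simp
  choose n hn using h
  have h₁ := apply_rep_self ((rootSystem H).root β)
  rw [← hq] at h₁
  simp only [hn, mul_pow, ← Finset.sum_mul] at h₁
  set s : ℤ := ∑ γ, n γ ^ 2 with hs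
  have h₂ : (∑ γ, (n γ : ℂ) ^ 2) = s := by rw [hs]; push_cast; rfl
  rw [h₂] at h₁
  have h₃ : (s : ℂ) * q = 4 := by
    have h₄ : q * ((s : ℂ) * q - 4) = 0 := by linear_combination -4 * h₁
    rcases mul_eq_zero.mp h₄ with h | h
    · exact absurd h hq₀
    · linear_combination h
  have hs₀ : (s : ℂ) ≠ 0 := fun h => by rw [h, zero_mul] at h₃; norm_num at h₃
  have h₅ : q = ((4 / s : ℝ) : ℂ) := by
    push_cast
    rw [eq_div_iff hs₀, mul_comm, h₃]
  rw [hn, h₅]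
  have : (n α : ℂ) * (((4 / s : ℝ) : ℂ) / 2) = ((n α * ((4 / s : ℝ) / 2) : ℝ) : ℂ) := by push_cast; rfl
  rw [this, Complex.ofReal_im]

theorem root_apply_rep_real_of_mem (α : H.root) {β : Dual ℂ H} (hβ : β ∈ Qpos b) :
    (((rootSystem H).root α) (rep β)).im = 0 := by
  induction hβ using AddSubmonoid.closure_induction with
  | mem x hx => obtain ⟨j, -, rfl⟩ := hx; exact root_apply_rep_real α j
  | zero => simp
  | add x y _ _ hx hy => 
    have h : rep (x + y) = rep x + rep y := map_add _ _ _
    rw [h, map_add, Complex.add_im, hx, hy, add_zero]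

/-- Linear functionals of `φ`, among them the height, are thereby expressed in the coordinates (α,
φ) that diagonalize the quadratic form. -/
theorem exists_apply_eq_sum_rep (x : H) : ∃ k : H.root → ℂ, ∀ φ : Dual ℂ H,
    φ x = ∑ α, k α * (rootSystem H).root α (rep φ) := by
  have h : cartanEquivDual H x ∈ Submodule.span ℂ (Set.range (rootSystem H).root) := by
    rw [RootPairing.IsRootSystem.span_root_eq_top]; trivial
  obtain ⟨k, hk⟩ := (Submodule.mem_span_range_iff_exists_fun ℂ).mp h
  refine ⟨k, fun φ => ?_⟩
  have h₁ : x = rep (∑ α, k α • (rootSystem H).root α) := by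
    rw [hk, rep, LinearEquiv.symm_apply_apply]
  rw [h₁, apply_rep_comm, LinearMap.sum_apply]
  rfl

/-- In the real coordinates y_α = (α, β) the equation reads Σ (y_α² + k_α y_α) = c and the height is
the real part of Σ k'_α y_α. Completing squares bounds the height, and finitely many elements of the
cone remain. -/
theorem finite_quadratic (x : H) (c : ℂ) :
    {β : Dual ℂ H | β ∈ Qpos b ∧ β (rep β) + β x = c}.Finite := by
  obtain ⟨k, hk⟩ := exists_apply_eq_sum_rep x
  obtain ⟨k', hk'⟩ := exists_apply_eq_sum_rep (gradingElt b)
  refine (finite_Qpos_hgt_le (b := b) (c.re + ∑ α, ((k' α).re - (k α).re) ^ 2 / 4)).subset ?_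
  rintro β ⟨hβ, hc⟩
  refine ⟨hβ, ?_⟩
  have hre : ∀ α : H.root, (rootSystem H).root α (rep β) =
      ((((rootSystem H).root α) (rep β)).re : ℂ) := fun α =>
    Complex.ext rfl (by rw [root_apply_rep_real_of_mem α hβ, Complex.ofReal_im])
  rw [hgt_apply, hk', ← hc, apply_rep_self, hk, Complex.add_re, Complex.re_sum, Complex.re_sum,
    Complex.re_sum, ← Finset.sum_add_distrib, ← Finset.sum_add_distrib]
  refine Finset.sum_le_sum fun α _ => ?_
  rw [hre α]
  generalize (((rootSystem H).root α) (rep β)).re = y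
  rw [← Complex.ofReal_pow, Complex.ofReal_re, Complex.re_mul_ofReal, Complex.re_mul_ofReal]
  nlinarith [sq_nonneg (y - ((k' α).re - (k α).re) / 2)]

theorem casScalar_add (μ φ : Dual ℂ H) : casScalar b (μ + φ) =
    casScalar b μ + (φ (rep φ) + φ (rep μ + rep μ + ∑ i : Pos b, rep (wt i))) := by
  have h : rep (μ + φ) = rep μ + rep φ := map_add _ _ _
  simp only [casScalar, sum_cartan, h]
  simp only [LinearMap.add_apply, map_add, map_sum, Finset.sum_add_distrib, apply_rep_comm μ φ]
  ring

/-- The upward direction determines where to truncate (`blockBound`) and makes the induction for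
reciprocity well founded. -/
theorem finite_casScalar_add (μ : Dual ℂ H) (c : ℂ) :
    {β : Dual ℂ H | β ∈ Qpos b ∧ casScalar b (μ + β) = c}.Finite := by
  refine (finite_quadratic (b := b) (rep μ + rep μ + ∑ i : Pos b, rep (wt i)) (c - casScalar b μ)).subset ?_
  rintro β ⟨hβ, hc⟩
  exact ⟨hβ, by rw [← hc, casScalar_add]; ring⟩

/-- The downward direction serves the finite length of Verma modules. -/
theorem finite_casScalar_sub (μ : Dual ℂ H) (c : ℂ) :
    {β : Dual ℂ H | β ∈ Qpos b ∧ casScalar b (μ - β) = c}.Finite := by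
  refine (finite_quadratic (b := b) (-(rep μ + rep μ + ∑ i : Pos b, rep (wt i))) (c - casScalar b μ)).subset ?_
  rintro β ⟨hβ, hc⟩
  refine ⟨hβ, ?_⟩
  have h : rep (-β) = -rep β := map_neg _ _
  rw [← hc, sub_eq_add_neg μ, casScalar_add, h]
  simp only [LinearMap.neg_apply, map_neg]
  ring

end Finiteness

end CatO
end

set_option linter.unusedSectionVars false

noncomputable section

namespace CatO

variable {L : Type u} [LieRing L] [LieAlgebra ℂ L] [FiniteDimensional ℂ L] [IsSemisimple ℂ L]
  {H : LieSubalgebra ℂ L} [H.IsCartanSubalgebra] {b : (rootSystem H).Base}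

variable {M : Type v} [AddCommGroup M] [Module ℂ M] [Module (Ug L) M] [IsScalarTower ℂ (Ug L) M]

/-! ### The universal module on a weight vector. -/

section WMod

/-- The left ideal generated by the elements `h - μ(h)`. -/
def cartanIdeal (μ : Dual ℂ H) : Submodule (Ug L) (Ug L) :=
  Submodule.span (Ug L) {y | ∃ h : H, y = gen L (h : L) - algebraMap ℂ (Ug L) (μ h)}

/-- The universal module generated by a vector of weight `μ`. -/
abbrev WMod (μ : Dual ℂ H) : Type u := Ug L ⧸ cartanIdeal μ

/-- The generator of the universal module with a vector of weight `μ`. -/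
def wgen (μ : Dual ℂ H) : WMod μ := (cartanIdeal μ).mkQ 1

variable {μ : Dual ℂ H}

theorem smul_wgen (y : Ug L) : y • wgen μ = (cartanIdeal μ).mkQ y := by
  rw [wgen, ← map_smul, smul_eq_mul, mul_one]

theorem wgen_mem : wgen μ ∈ wtSpace (WMod μ) μ := fun h => by
  rw [← algebraMap_smul (Ug L) (μ h), smul_wgen, smul_wgen, ← sub_eq_zero, ← map_sub,
    Submodule.mkQ_apply, Submodule.Quotient.mk_eq_zero]
  exact Submodule.subset_span ⟨h, rfl⟩

theorem WMod.exists_smul (x : WMod μ) : ∃ y : Ug L, y • wgen μ = x := by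
  obtain ⟨y, rfl⟩ := Submodule.mkQ_surjective _ x
  exact ⟨y, smul_wgen y⟩

theorem WMod.span_eq_top : Submodule.span (Ug L) {wgen μ} = ⊤ := by
  rw [eq_top_iff]
  rintro x -
  obtain ⟨y, rfl⟩ := WMod.exists_smul x
  exact Submodule.smul_mem _ _ (Submodule.mem_span_singleton_self _)

theorem WMod.hom_ext {N : Type w} [AddCommGroup N] [Module (Ug L) N] {f g : WMod μ →ₗ[Ug L] N}
    (h : f (wgen μ) = g (wgen μ)) : f = g := by
  ext
  exact h

theorem WMod.exists_lift {v : M} (hv : v ∈ wtSpace M μ) :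
    ∃ f : WMod μ →ₗ[Ug L] M, f (wgen μ) = v := by
  refine ⟨(cartanIdeal μ).liftQ (LinearMap.toSpanSingleton (Ug L) M v) (Submodule.span_le.mpr ?_), ?_⟩
  · rintro _ ⟨h, rfl⟩
    simp [sub_smul, hv h]
  · exact (Submodule.liftQ_apply _ _ _).trans (one_smul _ v)

/-- The coordinates of an element of the enveloping algebra in the module `WMod μ`. -/
def wcoord (b : (rootSystem H).Base) (μ : Dual ℂ H) :
    Ug L →ₗ[ℂ] (Multiset (Pos b) × Multiset (Pos b) →₀ ℂ) :=
  (pbwBasis b).constr ℂ fun t => Finsupp.single (t.1, t.2.1) (cartanScalar H μ t.2.2)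

theorem wcoord_pbw (t : PBWIdx b) : wcoord b μ (Fm t.1 * Em t.2.1 * Hm H t.2.2) =
    Finsupp.single (t.1, t.2.1) (cartanScalar H μ t.2.2) := by
  rw [← pbwBasis_apply, wcoord, Module.Basis.constr_basis]

/-- Right multiplication by a Cartan basis element only lengthens the Cartan factor of a PBW
monomial, which `wcoord` evaluates at `μ`. -/
theorem wcoord_mul_eq_zero (y : Ug L) (h : H) :
    wcoord b μ (y * (gen L (h : L) - algebraMap ℂ (Ug L) (μ h))) = 0 := by
  have key : ∀ (t : PBWIdx b) (j : Fin (finrank ℂ H)),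
      wcoord b μ (pbwBasis b t * gen L (cartanBasis H j : L)) =
        μ (cartanBasis H j) • wcoord b μ (pbwBasis b t) := by
    intro t j
    have h₁ := wcoord_pbw (μ := μ) ((t.1, t.2.1, j ::ₘ t.2.2) : PBWIdx b)
    simp only at h₁
    rw [pbwBasis_apply, mul_assoc, Hm_mul_gen, h₁, wcoord_pbw, Finsupp.smul_single]
    simp [cartanScalar]
  have key₂ : ∀ t : PBWIdx b, wcoord b μ (pbwBasis b t * gen L (h : L)) =
      μ h • wcoord b μ (pbwBasis b t) := by
    intro t
    have h₁ : (h : L) = ∑ j, (cartanBasis H).repr h j • (cartanBasis H j : L) := by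
      have h₀ := congrArg (H.toSubmodule.subtype) ((cartanBasis H).sum_repr h)
      rw [map_sum] at h₀
      exact h₀.symm
    have h₂ : μ h = ∑ j, (cartanBasis H).repr h j * μ (cartanBasis H j) := by
      have h₀ := congrArg μ ((cartanBasis H).sum_repr h)
      simp only [map_sum, map_smul, smul_eq_mul] at h₀
      exact h₀.symm
    rw [h₁, map_sum, Finset.mul_sum, map_sum, h₂, Finset.sum_smul]
    refine Finset.sum_congr rfl fun j _ => ?_
    rw [map_smul, mul_smul_comm, map_smul, key, smul_smul]
  rw [mul_sub, map_sub, sub_eq_zero, ← Algebra.commutes, ← Algebra.smul_def, map_smul]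
  have h₃ : (wcoord b μ) ∘ₗ LinearMap.mulRight ℂ (gen L (h : L)) = μ h • wcoord b μ :=
    (pbwBasis b).ext fun t => by simpa using key₂ t
  exact LinearMap.congr_fun h₃ y

theorem wcoord_eq_zero {y : Ug L} (hy : y ∈ cartanIdeal μ) : wcoord b μ y = 0 := by
  have h : ∀ z : Ug L, wcoord b μ (z * y) = 0 := by
    induction hy using Submodule.span_induction with
    | mem y hy => obtain ⟨h, rfl⟩ := hy; exact fun z => wcoord_mul_eq_zero z h
    | zero => simp
    | add y y' _ _ h₁ h₂ => intro z; rw [mul_add, map_add, h₁, h₂, add_zero]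
    | smul c y _ h => intro z; rw [smul_eq_mul, ← mul_assoc, h]
  simpa using h 1

variable (b μ) in
/-- The basis vectors of `WMod μ`. -/
def wvec (p : Multiset (Pos b) × Multiset (Pos b)) : WMod μ := (Fm p.1 * Em p.2) • wgen μ

theorem wvec_mem (p : Multiset (Pos b) × Multiset (Pos b)) :
    wvec b μ p ∈ wtSpace (WMod μ) (-wtm p.1 + (wtm p.2 + μ)) := by
  rw [wvec, mul_smul]
  exact Fm_smul_mem _ (Em_smul_mem _ wgen_mem)

theorem linearIndependent_wvec : LinearIndependent ℂ (wvec b μ) := by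
  let f : WMod μ →ₗ[ℂ] (Multiset (Pos b) × Multiset (Pos b) →₀ ℂ) :=
    ((cartanIdeal μ).restrictScalars ℂ).liftQ (wcoord b μ) fun y hy => wcoord_eq_zero hy
  refine LinearIndependent.of_comp f ?_
  have h : f ∘ wvec b μ = fun p => Finsupp.single p 1 := by
    funext p
    have h₁ := wcoord_pbw (μ := μ) ((p.1, p.2, 0) : PBWIdx b)
    simp only [Hm_zero, mul_one, cartanScalar, Multiset.map_zero, Multiset.prod_zero] at h₁
    rw [Function.comp_apply, wvec, smul_wgen]
    exact h₁
  rw [h]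
  exact Finsupp.linearIndependent_single_one ℂ _

theorem pbw_smul_wgen (t : PBWIdx b) :
    pbwBasis b t • wgen μ = cartanScalar H μ t.2.2 • wvec b μ (t.1, t.2.1) := by
  rw [pbwBasis_apply, mul_smul, Hm_smul _ wgen_mem, smul_algebra_smul_comm, wvec]

theorem Ug_smul_mem {X : Submodule ℂ M} {v : M} (h : ∀ t : PBWIdx b, pbwBasis b t • v ∈ X)
    (y : Ug L) : y • v ∈ X := by
  have hy := (pbwBasis b).mem_span y
  induction hy using Submodule.span_induction with
  | mem y hy => obtain ⟨t, rfl⟩ := hy; exact h t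
  | zero => simp
  | add y z _ _ hy hz => rw [add_smul]; exact add_mem hy hz
  | smul c y _ hy => rw [smul_assoc]; exact X.smul_mem c hy

theorem span_wvec : ⊤ ≤ Submodule.span ℂ (Set.range (wvec b μ)) := by
  rintro x -
  obtain ⟨y, rfl⟩ := WMod.exists_smul x
  refine Ug_smul_mem (b := b) (fun t => ?_) y
  rw [pbw_smul_wgen]
  exact Submodule.smul_mem _ _ (Submodule.subset_span ⟨_, rfl⟩)

variable (b μ) in
/-- The basis of `WMod μ` coming from the Poincaré-Birkhoff-Witt theorem. -/
def wBasis : Module.Basis (Multiset (Pos b) × Multiset (Pos b)) ℂ (WMod μ) :=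
  Module.Basis.mk linearIndependent_wvec span_wvec

@[simp] theorem wBasis_apply (p : Multiset (Pos b) × Multiset (Pos b)) :
    wBasis b μ p = wvec b μ p := by simp [wBasis]

end WMod

/-! ### Truncations of the universal module and their bases. -/

section QMod

variable (μ : Dual ℂ H)

/-- Sets of exponents closed under raising the weight. -/
def UpClosed (T : Set (Multiset (Pos b))) : Prop :=
  ∀ c ∈ T, ∀ d d' : Multiset (Pos b), d' ≠ 0 → wtm d = wtm c + wtm d' → d ∈ T

/-- The submodule of `WMod μ` generated by the `Em c • wgen μ` with `c ∈ T`. -/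
def upSub (T : Set (Multiset (Pos b))) : Submodule (Ug L) (WMod μ) :=
  Submodule.span (Ug L) ((fun c => Em c • wgen μ) '' T)

variable {T : Set (Multiset (Pos b))}

/-- A Cartan monomial acts by a scalar. Straightening a product of positive monomials preserves
total weight, so left multiplication by a nontrivial positive monomial leads to exponents which
up-closedness keeps in `T`. The negative factor leaves the positive exponent alone. -/
theorem smul_mem_of_mem_upSub (hT : UpClosed T) {x : WMod μ}
    (hx : x ∈ Submodule.span (Ug L) ((fun c => Em c • wgen μ) '' T)) :
    ∀ y : Ug L, y • x ∈ Submodule.span ℂ (wBasis b μ '' {p | p.2 ∈ T}) := by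
  induction hx using Submodule.span_induction with
  | mem x hx =>
    obtain ⟨c, hc, rfl⟩ := hx
    refine Ug_smul_mem (b := b) fun t => ?_
    simp only
    rw [pbwBasis_apply, mul_smul, Hm_smul _ (Em_smul_mem c wgen_mem), smul_algebra_smul_comm]
    refine Submodule.smul_mem _ _ ?_
    by_cases ht : t.2.1 = 0
    · rw [ht, Em_zero, mul_one, ← mul_smul]
      exact Submodule.subset_span ⟨(t.1, c), hc, by simp [wvec]⟩
    · rw [← mul_smul, mul_assoc]
      have h := Em_mul_Em_mem t.2.1 c
      generalize Em t.2.1 * Em c = z at h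
      induction h using Submodule.span_induction with
      | mem z hz =>
        obtain ⟨c', hc', rfl⟩ := hz
        exact Submodule.subset_span ⟨(t.1, c'), hT c hc c' t.2.1 ht (by rw [hc', add_comm]),
          by simp [wvec]⟩
      | zero => simp
      | add y z _ _ hy hz => rw [mul_add, add_smul]; exact add_mem hy hz
      | smul k y _ hy => rw [mul_smul_comm, smul_assoc]; exact Submodule.smul_mem _ _ hy
  | zero => simp
  | add x y _ _ hx hy => intro z; rw [smul_add]; exact add_mem (hx z) (hy z)
  | smul k y _ hy => intro z; rw [← mul_smul]; exact hy _

/-- The submodule is spanned by part of the PBW basis, so the remaining basis vectors form a basis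
of the quotient. -/
theorem restrictScalars_upSub (hT : UpClosed T) : (upSub μ T).restrictScalars ℂ =
    Submodule.span ℂ (wBasis b μ '' {p | p.2 ∈ T}) := by
  refine le_antisymm (fun x hx => ?_) (Submodule.span_le.mpr ?_)
  · simpa using smul_mem_of_mem_upSub μ hT hx 1
  · rintro _ ⟨p, hp, rfl⟩
    rw [wBasis_apply, wvec, mul_smul]
    exact Submodule.smul_mem (upSub μ T) _ (Submodule.subset_span ⟨p.2, hp, rfl⟩)

theorem upSub_mono {T' : Set (Multiset (Pos b))} (h : T ⊆ T') : upSub μ T ≤ upSub μ T' :=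
  Submodule.span_mono (Set.image_mono h)

variable (T) in
/-- The quotient of `WMod μ` by the `Em c • wgen μ` with `c ∈ T`. -/
abbrev QMod : Type u := WMod μ ⧸ upSub μ T

variable (T) in
/-- The generator of `QMod μ T`. -/
def qgen : QMod μ T := (upSub μ T).mkQ (wgen μ)

variable {μ}

theorem qgen_mem : qgen μ T ∈ wtSpace (QMod μ T) μ := map_mem_wtSpace _ wgen_mem

theorem QMod.hom_ext {N : Type w} [AddCommGroup N] [Module (Ug L) N] {f g : QMod μ T →ₗ[Ug L] N}
    (h : f (qgen μ T) = g (qgen μ T)) : f = g :=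
  Submodule.linearMap_qext _ (WMod.hom_ext h)

theorem QMod.exists_lift {v : M} (hv : v ∈ wtSpace M μ) (hT : ∀ c ∈ T, Em c • v = 0) :
    ∃ f : QMod μ T →ₗ[Ug L] M, f (qgen μ T) = v := by
  obtain ⟨f, hf⟩ := WMod.exists_lift hv
  refine ⟨(upSub μ T).liftQ f (Submodule.span_le.mpr ?_), ?_⟩
  · rintro _ ⟨c, hc, rfl⟩
    simp [hf, hT c hc]
  · exact (Submodule.liftQ_apply _ _ _).trans hf

theorem QMod.span_eq_top : Submodule.span (Ug L) {qgen μ T} = ⊤ := by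
  have h := congrArg (Submodule.map (upSub μ T).mkQ) (WMod.span_eq_top (μ := μ))
  rw [Submodule.map_span, Set.image_singleton, Submodule.map_top, Submodule.range_mkQ] at h
  exact h

variable (μ T) in
/-- The basis vectors of `QMod μ T`. -/
def qvec (p : {p : Multiset (Pos b) × Multiset (Pos b) // p.2 ∉ T}) : QMod μ T :=
  (upSub μ T).mkQ (wvec b μ p.1)

theorem qvec_mem (p : {p : Multiset (Pos b) × Multiset (Pos b) // p.2 ∉ T}) :
    qvec μ T p ∈ wtSpace (QMod μ T) (-wtm p.1.1 + (wtm p.1.2 + μ)) :=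
  map_mem_wtSpace _ (wvec_mem _)

theorem span_qvec : ⊤ ≤ Submodule.span ℂ (Set.range (qvec μ T)) := by
  rintro x -
  obtain ⟨y, rfl⟩ := Submodule.mkQ_surjective _ x
  have h := span_wvec (b := b) (Submodule.mem_top (x := y))
  induction h using Submodule.span_induction with
  | mem y hy =>
    obtain ⟨p, rfl⟩ := hy
    by_cases hp : p.2 ∈ T
    · have : wvec b μ p ∈ upSub μ T := by
        rw [wvec, mul_smul]
        exact Submodule.smul_mem _ _ (Submodule.subset_span ⟨p.2, hp, rfl⟩)
      rw [Submodule.mkQ_apply, (Submodule.Quotient.mk_eq_zero _).mpr this]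
      exact zero_mem _
    · exact Submodule.subset_span ⟨⟨p, hp⟩, rfl⟩
  | zero => simp
  | add x y _ _ hx hy => rw [map_add]; exact add_mem hx hy
  | smul c y _ hy =>
    have h : (upSub μ T).mkQ (c • y) = c • (upSub μ T).mkQ y := rfl
    rw [h]; exact Submodule.smul_mem _ _ hy

theorem linearIndependent_qvec (hT : UpClosed T) : LinearIndependent ℂ (qvec μ T) := by
  have h₁ : LinearIndependent ℂ fun p : {p : Multiset (Pos b) × Multiset (Pos b) // p.2 ∉ T} =>
      wBasis b μ p := (wBasis b μ).linearIndependent.comp _ Subtype.val_injective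
  have h₄ : LinearIndependent ℂ ((upSub μ T).mkQ.restrictScalars ℂ ∘
      fun p : {p : Multiset (Pos b) × Multiset (Pos b) // p.2 ∉ T} => wBasis b μ p) :=
    h₁.map ?_
  · have h₅ : qvec μ T = (upSub μ T).mkQ.restrictScalars ℂ ∘
        fun p : {p : Multiset (Pos b) × Multiset (Pos b) // p.2 ∉ T} => wBasis b μ p := by
      funext p
      simp [qvec]
    rw [h₅]
    exact h₄
  · have h₂ : LinearMap.ker ((upSub μ T).mkQ.restrictScalars ℂ) =
        Submodule.span ℂ (wBasis b μ '' {p | p.2 ∈ T}) := by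
      rw [← restrictScalars_upSub μ hT]
      ext x
      simp
    rw [h₂]
    have h₃ : Set.range (fun p : {p : Multiset (Pos b) × Multiset (Pos b) // p.2 ∉ T} =>
        wBasis b μ p) = wBasis b μ '' {p | p.2 ∉ T} := by
      ext x
      simp
    rw [h₃]
    exact (wBasis b μ).linearIndependent.disjoint_span_image
      (Set.disjoint_left.mpr fun p hp hp' => hp hp')

end QMod

end CatO
end

set_option linter.unusedSectionVars false

noncomputable section

namespace CatO

variable {L : Type u} [LieRing L] [LieAlgebra ℂ L] [FiniteDimensional ℂ L] [IsSemisimple ℂ L]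
  {H : LieSubalgebra ℂ L} [H.IsCartanSubalgebra] {b : (rootSystem H).Base}

variable {M : Type v} [AddCommGroup M] [Module ℂ M] [Module (Ug L) M] [IsScalarTower ℂ (Ug L) M]
  {N : Type w} [AddCommGroup N] [Module ℂ N] [Module (Ug L) N] [IsScalarTower ℂ (Ug L) N]

theorem injective_of_linearIndependent_comp {K V W ι : Type*} [Ring K] [AddCommGroup V]
    [AddCommGroup W] [Module K V] [Module K W] {x : ι → V} (hs : ⊤ ≤ Submodule.span K (Set.range x))
    (f : V →ₗ[K] W) (hf : LinearIndependent K (f ∘ x)) : Function.Injective f := by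
  rw [injective_iff_map_eq_zero]
  intro v hv
  obtain ⟨c, rfl⟩ := Finsupp.mem_span_range_iff_exists_finsupp.mp (hs (Submodule.mem_top (x := v)))
  rw [map_finsuppSum] at hv
  simp only [map_smul] at hv
  have hc : c = 0 := linearIndependent_iff.mp hf c (by rw [Finsupp.linearCombination_apply]; exact hv)
  simp [hc]

/-! ### Verma modules: bases, weights and the Casimir scalar. -/

section Verma

variable (b) (μ : Dual ℂ H)

/-- The highest weight vector of a Verma module. -/
def vgen : Verma b μ := (vermaIdeal b μ).mkQ 1

variable {b μ}

theorem smul_vgen (y : Ug L) : y • vgen b μ = (vermaIdeal b μ).mkQ y := by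
  rw [vgen, ← map_smul, smul_eq_mul, mul_one]

theorem vgen_mem : vgen b μ ∈ wtSpace (Verma b μ) μ := fun h => by
  rw [← algebraMap_smul (Ug L) (μ h), smul_vgen, smul_vgen, ← sub_eq_zero, ← map_sub,
    Submodule.mkQ_apply, Submodule.Quotient.mk_eq_zero]
  exact Submodule.subset_span (Or.inl ⟨h, rfl⟩)

theorem posVec_smul_vgen (i : Pos b) : gen L (posVec i) • vgen b μ = 0 := by
  rw [smul_vgen, Submodule.mkQ_apply, Submodule.Quotient.mk_eq_zero]
  exact Submodule.subset_span (Or.inr ⟨i.1, i.2, posVec i, posVec_mem i, rfl⟩)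

theorem Verma.exists_smul (x : Verma b μ) : ∃ y : Ug L, y • vgen b μ = x := by
  obtain ⟨y, rfl⟩ := Submodule.mkQ_surjective _ x
  exact ⟨y, smul_vgen y⟩

theorem Verma.span_eq_top : Submodule.span (Ug L) {vgen b μ} = ⊤ := by
  rw [eq_top_iff]
  rintro x -
  obtain ⟨y, rfl⟩ := Verma.exists_smul x
  exact Submodule.smul_mem _ _ (Submodule.mem_span_singleton_self _)

theorem Verma.hom_ext {X : Type w} [AddCommGroup X] [Module (Ug L) X] {f g : Verma b μ →ₗ[Ug L] X}
    (h : f (vgen b μ) = g (vgen b μ)) : f = g := by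
  ext
  exact h

theorem Verma.exists_lift {v : M} (hv : v ∈ wtSpace M μ)
    (hv' : ∀ i : Pos b, gen L (posVec i) • v = 0) :
    ∃ f : Verma b μ →ₗ[Ug L] M, f (vgen b μ) = v := by
  refine ⟨(vermaIdeal b μ).liftQ (LinearMap.toSpanSingleton (Ug L) M v)
    (Submodule.span_le.mpr ?_), (Submodule.liftQ_apply _ _ _).trans (one_smul _ v)⟩
  rintro _ (⟨h, rfl⟩ | ⟨α, hα, x, hx, rfl⟩)
  · simp only [SetLike.mem_coe, LinearMap.mem_ker, LinearMap.toSpanSingleton_apply, sub_smul,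
      algebraMap_smul]
    exact sub_eq_zero.mpr (hv h)
  · obtain ⟨c, rfl⟩ := exists_smul_posVec (i := ⟨α, hα⟩) hx
    rw [← gen_eq, map_smul]
    simp only [SetLike.mem_coe, LinearMap.mem_ker, LinearMap.toSpanSingleton_apply, smul_assoc, hv',
      smul_zero]

variable (b μ) in
/-- The basis vectors of a Verma module. -/
def vvec (a : Multiset (Pos b)) : Verma b μ := Fm a • vgen b μ

theorem vvec_mem (a : Multiset (Pos b)) : vvec b μ a ∈ wtSpace (Verma b μ) (-wtm a + μ) :=
  Fm_smul_mem a vgen_mem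

theorem span_vvec : ⊤ ≤ Submodule.span ℂ (Set.range (vvec b μ)) := by
  rintro x -
  obtain ⟨y, rfl⟩ := Verma.exists_smul x
  refine Ug_smul_mem (b := b) (fun t => ?_) y
  rw [pbwBasis_apply, mul_smul, Hm_smul _ vgen_mem, smul_algebra_smul_comm]
  refine Submodule.smul_mem _ _ ?_
  by_cases ht : t.2.1 = 0
  · rw [ht, Em_zero, mul_one]
    exact Submodule.subset_span ⟨t.1, rfl⟩
  · rw [mul_smul, Em_smul_eq_zero posVec_smul_vgen ht, smul_zero]
    exact zero_mem _

theorem htm_lt_of_wtm_eq {c d d' : Multiset (Pos b)} (hd' : d' ≠ 0) (h : wtm d = wtm c + wtm d') :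
    htm c < htm d := by
  rw [← wtm_add] at h
  have h₁ := htm_eq_of_wtm_eq h
  have h₂ : htm (c + d') = htm c + htm d' := by simp [htm]
  have h₃ : htm d' ≠ 0 := fun h => hd' (eq_zero_of_htm_eq_zero h)
  omega

theorem upClosed_ne_zero : UpClosed {c : Multiset (Pos b) | c ≠ 0} := by
  rintro c - d d' hd' h rfl
  have := htm_lt_of_wtm_eq hd' h
  simp at this

theorem upClosed_le_htm (n : ℕ) : UpClosed {c : Multiset (Pos b) | n ≤ htm c} :=
  fun _ hc _ _ hd' h => le_trans hc (htm_lt_of_wtm_eq hd' h).le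

theorem Em_smul_qgen {T : Set (Multiset (Pos b))} {c : Multiset (Pos b)} (hc : c ∈ T) :
    Em c • qgen μ T = 0 := by
  rw [qgen, ← map_smul, Submodule.mkQ_apply, Submodule.Quotient.mk_eq_zero]
  exact Submodule.subset_span ⟨c, hc, rfl⟩

/-- The Verma module maps to the truncation killing every nontrivial positive monomial, where the
images are known basis vectors. -/
theorem linearIndependent_vvec : LinearIndependent ℂ (vvec b μ) := by
  obtain ⟨f, hf⟩ := Verma.exists_lift (b := b) (qgen_mem (μ := μ) (T := {c : Multiset (Pos b) | c ≠ 0}))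
    fun i => by rw [← Em_singleton]; exact Em_smul_qgen (by simp)
  refine LinearIndependent.of_comp (f.restrictScalars ℂ) ?_
  have h₁ := (linearIndependent_qvec (μ := μ) (upClosed_ne_zero (b := b))).comp
    (fun a => ⟨(a, 0), by simp⟩) fun a a' h => by simpa using h
  have h₂ : (f.restrictScalars ℂ) ∘ vvec b μ = qvec μ {c : Multiset (Pos b) | c ≠ 0} ∘
      fun a => ⟨(a, 0), by simp⟩ := by
    funext a
    simp [vvec, hf, qvec, wvec, qgen]
  rw [h₂]
  exact h₁

variable (b) in
/-- Kostant's partition function. -/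
def pfun (β : Dual ℂ H) : ℕ := Nat.card {a : Multiset (Pos b) // wtm a = β}

instance finite_wtm_eq (β : Dual ℂ H) : Finite {a : Multiset (Pos b) // wtm a = β} := by
  rcases isEmpty_or_nonempty {a : Multiset (Pos b) // wtm a = β} with h | ⟨⟨a₀, h₀⟩⟩
  · infer_instance
  · have := (finite_htm_le (b := b) (htm a₀)).to_subtype
    exact Finite.of_injective (β := {a : Multiset (Pos b) | htm a ≤ htm a₀})
      (fun a => ⟨a.1, (htm_eq_of_wtm_eq (a.2.trans h₀.symm)).le⟩) fun a a' h => by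
        simpa [Subtype.ext_iff] using h

def wtmEquiv (μ ν : Dual ℂ H) : {a : Multiset (Pos b) // -wtm a + μ = ν} ≃
    {a : Multiset (Pos b) // wtm a = μ - ν} :=
  Equiv.subtypeEquivRight fun a => by
    constructor
    · rintro rfl; abel
    · intro h; rw [h]; abel

instance (μ ν : Dual ℂ H) : Finite {a : Multiset (Pos b) // -wtm a + μ = ν} :=
  Finite.of_equiv _ (wtmEquiv μ ν).symm

instance (ν : Dual ℂ H) : FiniteDimensional ℂ (wtSpace (Verma b μ) ν) :=
  finiteDimensional_wtSpace vvec_mem span_vvec ν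

theorem finrank_wtSpace_verma (ν : Dual ℂ H) :
    finrank ℂ (wtSpace (Verma b μ) ν) = pfun b (μ - ν) := by
  rw [finrank_wtSpace vvec_mem linearIndependent_vvec span_vvec, pfun]
  exact Nat.card_congr (wtmEquiv μ ν)

theorem pfun_zero : pfun b 0 = 1 := by
  rw [pfun, Nat.card_eq_one_iff_exists]
  refine ⟨⟨0, rfl⟩, fun a => Subtype.ext ?_⟩
  have h := htm_eq_of_wtm_eq (a.2.trans (wtm_zero (b := b)).symm)
  exact eq_zero_of_htm_eq_zero h

theorem isWt_verma : IsWt H (Verma b μ) := isWt_of_span vvec_mem span_vvec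

theorem sub_mem_of_wtSpace_verma {ν : Dual ℂ H} (h : wtSpace (Verma b μ) ν ≠ ⊥) :
    μ - ν ∈ Qpos b := by
  obtain ⟨a, rfl⟩ := exists_weight_of_span vvec_mem span_vvec h
  have : μ - (-wtm a + μ) = wtm a := by abel
  rw [this]
  exact wtm_mem_Qpos a

theorem vgen_ne_zero : vgen b μ ≠ 0 := by
  have := (linearIndependent_vvec (b := b) (μ := μ)).ne_zero 0
  simpa [vvec] using this

theorem catO_verma : IsCategoryO b (Verma b μ) := by
  rw [isCategoryO_iff]
  exact ⟨⟨⟨{vgen b μ}, by simpa using Verma.span_eq_top⟩⟩, isWt_verma, {μ}, fun ν hν =>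
    ⟨μ, Finset.mem_singleton_self _, sub_mem_of_wtSpace_verma hν⟩⟩

theorem casimir_smul_verma (x : Verma b μ) : casimir b • x = casScalar b μ • x := by
  obtain ⟨y, rfl⟩ := Verma.exists_smul x
  rw [← mul_smul, casimir_central, mul_smul, casimir_smul vgen_mem posVec_smul_vgen,
    smul_algebra_smul_comm]

theorem mem_span_vgen {x : Verma b μ} (hx : x ∈ wtSpace (Verma b μ) μ) :
    ∃ c : ℂ, c • vgen b μ = x := by
  have h₁ : finrank ℂ (wtSpace (Verma b μ) μ) = 1 := by
    rw [finrank_wtSpace_verma, sub_self, pfun_zero]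
  obtain ⟨c, hc⟩ := exists_smul_eq_of_finrank_eq_one h₁ (x := ⟨vgen b μ, vgen_mem⟩)
    (fun h => vgen_ne_zero (congrArg Subtype.val h)) ⟨x, hx⟩
  exact ⟨c, congrArg Subtype.val hc⟩

end Verma

/-! ### Splitting one Verma module off a truncation. -/

section QStep

variable {μ : Dual ℂ H} {T : Set (Multiset (Pos b))}

theorem catO_QMod (hT : Tᶜ.Finite) : IsCategoryO b (QMod μ T) := by
  classical
  rw [isCategoryO_iff]
  refine ⟨⟨⟨{qgen μ T}, by simpa using QMod.span_eq_top⟩⟩, isWt_of_span qvec_mem span_qvec,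
    hT.toFinset.image fun c => wtm c + μ, fun ν hν => ?_⟩
  obtain ⟨p, rfl⟩ := exists_weight_of_span qvec_mem span_qvec hν
  refine ⟨wtm p.1.2 + μ, Finset.mem_image.mpr ⟨p.1.2, by simpa using p.2, rfl⟩, ?_⟩
  have : wtm p.1.2 + μ - (-wtm p.1.1 + (wtm p.1.2 + μ)) = wtm p.1.1 := by abel
  rw [this]
  exact wtm_mem_Qpos _

/-- Enlarging `T` by one element splits off a Verma submodule of `QMod μ T`. -/
theorem QMod.exists_submodule (hT : UpClosed T) {c : Multiset (Pos b)} (hc : c ∉ T)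
    (hT' : UpClosed (insert c T)) : ∃ X : Submodule (Ug L) (QMod μ T),
      Nonempty (X ≃ₗ[Ug L] Verma b (wtm c + μ)) ∧
      Nonempty ((QMod μ T ⧸ X) ≃ₗ[Ug L] QMod μ (insert c T)) := by
  -- Raising the weight from `c` leads into `insert c T` and never back to `c`, whose height is
  -- smaller; so it leads into `T`.
  have hkill : ∀ i : Pos b, gen L (posVec i) • Em c • qgen μ T = 0 := by
    intro i
    rw [← mul_smul, ← Em_singleton]
    have h := Em_mul_Em_mem {i} c
    generalize Em {i} * Em c = z at h
    induction h using Submodule.span_induction with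
    | mem z hz =>
      obtain ⟨c', hc', rfl⟩ := hz
      refine Em_smul_qgen ?_
      rw [add_comm] at hc'
      refine Set.mem_of_mem_insert_of_ne (hT' c (Set.mem_insert _ _) c' {i} (by simp) hc') ?_
      rintro rfl
      exact lt_irrefl _ (htm_lt_of_wtm_eq (by simp) hc')
    | zero => simp
    | add y z _ _ hy hz => rw [add_smul, hy, hz, add_zero]
    | smul k y _ hy => rw [smul_assoc, hy, smul_zero]
  obtain ⟨f, hf⟩ := Verma.exists_lift (Em_smul_mem c (qgen_mem (μ := μ) (T := T))) hkill
  -- The Verma basis goes to the basis vectors of the truncation with positive exponent `c`.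
  have hinj : Function.Injective f := by
    refine injective_of_linearIndependent_comp (span_vvec (b := b)) (f.restrictScalars ℂ) ?_
    have h₁ := (linearIndependent_qvec (μ := μ) hT).comp
      (fun a : Multiset (Pos b) => ⟨(a, c), hc⟩) fun a a' h => by simpa using h
    have h₂ : (f.restrictScalars ℂ) ∘ vvec b (wtm c + μ) = qvec μ T ∘
        fun a : Multiset (Pos b) => ⟨(a, c), hc⟩ := by
      funext a
      simp [vvec, hf, qvec, wvec, qgen, mul_smul]
    rw [h₂]
    exact h₁
  have hrange : LinearMap.range f = (upSub μ (insert c T)).map (upSub μ T).mkQ := by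
    have h₁ : LinearMap.range f = Submodule.span (Ug L) {Em c • qgen μ T} := by
      rw [LinearMap.range_eq_map, ← Verma.span_eq_top, Submodule.map_span, Set.image_singleton, hf]
    have h₃ : upSub μ (insert c T) =
        Submodule.span (Ug L) ((fun c => Em c • wgen μ) '' insert c T) := rfl
    rw [h₁, h₃, Submodule.map_span, Set.image_insert_eq, Set.image_insert_eq,
      Submodule.span_insert]
    have h₂ : Submodule.span (Ug L) ((upSub μ T).mkQ '' ((fun c => Em c • wgen μ) '' T)) = ⊥ := by
      rw [← Submodule.map_span, eq_bot_iff, Submodule.map_le_iff_le_comap, Submodule.comap_bot,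
        Submodule.ker_mkQ]
      exact le_rfl
    rw [h₂, sup_bot_eq]
    rfl
  refine ⟨LinearMap.range f, ⟨(LinearEquiv.ofInjective f hinj).symm⟩, ?_⟩
  rw [hrange]
  exact ⟨Submodule.quotientQuotientEquivQuotient _ _ (upSub_mono μ (Set.subset_insert c T))⟩

end QStep

end CatO
end

set_option linter.unusedSectionVars false

noncomputable section

namespace CatO

variable {L : Type u} [LieRing L] [LieAlgebra ℂ L] [FiniteDimensional ℂ L] [IsSemisimple ℂ L]
  {H : LieSubalgebra ℂ L} [H.IsCartanSubalgebra] {b : (rootSystem H).Base}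

variable {M : Type v} [AddCommGroup M] [Module ℂ M] [Module (Ug L) M] [IsScalarTower ℂ (Ug L) M]
  {N : Type w} [AddCommGroup N] [Module ℂ N] [Module (Ug L) N] [IsScalarTower ℂ (Ug L) N]

/-! ### Exactness of passing to weight spaces. -/

section WtMap

/-- The map induced on weight spaces. -/
def wtMap (g : M →ₗ[Ug L] N) (ν : Dual ℂ H) : wtSpace M ν →ₗ[ℂ] wtSpace N ν :=
  (g.restrictScalars ℂ).restrict fun _ hv => map_mem_wtSpace g hv

@[simp] theorem wtMap_coe (g : M →ₗ[Ug L] N) (ν : Dual ℂ H) (x : wtSpace M ν) :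
    (wtMap g ν x : N) = g x := rfl

theorem wtMap_injective (g : M →ₗ[Ug L] N) (hg : Function.Injective g) (ν : Dual ℂ H) :
    Function.Injective (wtMap g ν) := fun _ _ h => Subtype.ext (hg (congrArg Subtype.val h))

theorem wtMap_surjective (hM : IsWt H M) (g : M →ₗ[Ug L] N) (hg : Function.Surjective g)
    (ν : Dual ℂ H) : Function.Surjective (wtMap g ν) := by
  rintro ⟨x, hx⟩
  obtain ⟨m, rfl⟩ := hg x
  obtain ⟨m', hm', h⟩ := hM.exists_lift g hx
  exact ⟨⟨m', hm'⟩, Subtype.ext h⟩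

theorem ker_wtMap_mkQ (X : Submodule (Ug L) M) (ν : Dual ℂ H) :
    LinearMap.ker (wtMap X.mkQ ν) = LinearMap.range (wtMap X.subtype ν) := by
  ext ⟨x, hx⟩
  rw [LinearMap.mem_ker, LinearMap.mem_range, ← Subtype.coe_inj, wtMap_coe]
  simp only [Submodule.mkQ_apply, ZeroMemClass.coe_zero, Submodule.Quotient.mk_eq_zero]
  constructor
  · intro h
    exact ⟨⟨⟨x, h⟩, fun z => Subtype.ext (hx z)⟩, rfl⟩
  · rintro ⟨y, hy⟩
    have := congrArg Subtype.val hy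
    simp only [wtMap_coe, Submodule.subtype_apply] at this
    rw [← this]
    exact y.1.2

end WtMap

/-! ### Finite length together with finite-dimensional weight spaces. -/

section IsFin

variable (H M) in
/-- Noetherian and Artinian modules with finite-dimensional weight spaces. -/
def IsFin : Prop := IsNoetherian (Ug L) M ∧ IsArtinian (Ug L) M ∧
  ∀ ν : Dual ℂ H, FiniteDimensional ℂ (wtSpace M ν)

theorem IsFin.of_injective (h : IsFin H N) (g : M →ₗ[Ug L] N) (hg : Function.Injective g) :
    IsFin H M := by
  obtain ⟨_, _, h₃⟩ := h
  exact ⟨isNoetherian_of_injective g hg, isArtinian_of_injective g hg, fun ν =>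
    FiniteDimensional.of_injective (wtMap g ν) (wtMap_injective g hg ν)⟩

theorem IsFin.of_surjective (h : IsFin H M) (hM : IsWt H M) (g : M →ₗ[Ug L] N)
    (hg : Function.Surjective g) : IsFin H N := by
  obtain ⟨_, _, h₃⟩ := h
  exact ⟨isNoetherian_of_surjective g (LinearMap.range_eq_top.mpr hg),
    isArtinian_of_surjective _ g hg, fun ν =>
    Module.Finite.of_surjective (wtMap g ν) (wtMap_surjective hM g hg ν)⟩

theorem IsFin.of_submodule_quotient (X : Submodule (Ug L) M) (h₁ : IsFin H X)
    (h₂ : IsFin H (M ⧸ X)) : IsFin H M := by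
  refine ⟨(isNoetherian_iff_submodule_quotient X).mpr ⟨h₁.1, h₂.1⟩,
    (isArtinian_iff_submodule_quotient X).mpr ⟨h₁.2.1, h₂.2.1⟩, fun ν => ?_⟩
  have := h₁.2.2 ν
  have := h₂.2.2 ν
  have h₃ : FiniteDimensional ℂ (LinearMap.ker (wtMap X.mkQ ν)) := by
    rw [ker_wtMap_mkQ]
    infer_instance
  have h₄ : FiniteDimensional ℂ (wtSpace M ν ⧸ LinearMap.ker (wtMap X.mkQ ν)) :=
    Module.Finite.equiv (LinearMap.quotKerEquivRange (wtMap X.mkQ ν)).symm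
  exact Module.Finite.of_submodule_quotient (LinearMap.ker (wtMap X.mkQ ν))

theorem finrank_inf_lt {K V : Type*} [Field K] [AddCommGroup V] [Module K V] {A B W : Submodule K V}
    [FiniteDimensional K W] (h : A ≤ B) {x : V} (hx : x ∈ B) (hxA : x ∉ A) (hxW : x ∈ W) :
    finrank K ↥(A ⊓ W) < finrank K ↥(B ⊓ W) := by
  refine Submodule.finrank_lt_finrank_of_lt (lt_of_le_of_ne (inf_le_inf_right W h) fun h' => hxA ?_)
  have : x ∈ B ⊓ W := ⟨hx, hxW⟩
  rw [← h'] at this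
  exact this.1

/-- A module such that any two nested submodules differ in one of finitely many finite-dimensional
weight spaces is Noetherian and Artinian. -/
theorem noetherian_artinian_of_weights (T : Finset (Dual ℂ H))
    (hT : ∀ ν ∈ T, FiniteDimensional ℂ (wtSpace M ν))
    (h : ∀ A B : Submodule (Ug L) M, A < B → ∃ ν ∈ T, ∃ x ∈ wtSpace M ν, x ∈ B ∧ x ∉ A) :
    IsNoetherian (Ug L) M ∧ IsArtinian (Ug L) M := by
  -- The total dimension in the weights of `T` is strictly monotone in the submodule and bounded,
  -- which gives both chain conditions.
  let φ : Submodule (Ug L) M → ℕ := fun X =>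
    ∑ ν ∈ T, finrank ℂ ↥(X.restrictScalars ℂ ⊓ wtSpace M ν)
  have hφ : StrictMono φ := by
    intro A B hAB
    obtain ⟨ν, hν, x, hx, hxB, hxA⟩ := h A B hAB
    refine Finset.sum_lt_sum (fun κ hκ => ?_) ⟨ν, hν, ?_⟩
    · have := hT κ hκ
      exact Submodule.finrank_mono (inf_le_inf_right _ fun y hy => hAB.le hy)
    · have := hT ν hν
      exact finrank_inf_lt (fun y hy => hAB.le hy) hxB hxA hx
  have hanti : StrictAnti fun X => φ ⊤ - φ X := by
    intro A B hAB
    have h₁ := hφ hAB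
    have h₂ : φ B ≤ φ ⊤ := hφ.monotone le_top
    show φ ⊤ - φ B < φ ⊤ - φ A
    omega
  exact ⟨isNoetherian_iff'.mpr hanti.wellFoundedGT, hφ.wellFoundedLT⟩

end IsFin

/-! ### Maximal weights and highest weight vectors. -/

section Maximal

variable (b M) in
/-- Weights such that no weight strictly above them occurs. -/
def IsMaxWt (μ : Dual ℂ H) : Prop :=
  wtSpace M μ ≠ ⊥ ∧ ∀ γ ∈ Qpos b, wtSpace M (μ + γ) ≠ ⊥ → γ = 0

theorem IsMaxWt.posVec_smul {μ : Dual ℂ H} (h : IsMaxWt b M μ) {v : M} (hv : v ∈ wtSpace M μ)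
    (i : Pos b) : gen L (posVec i) • v = 0 := by
  by_contra hne
  refine wt_ne_zero i (h.2 (wt i) (wt_mem_Qpos i) ((Submodule.ne_bot_iff _).mpr
    ⟨_, ?_, hne⟩))
  rw [add_comm]
  exact posVec_smul_mem i hv

theorem IsBdd.exists_isMaxWt (h : IsBdd b M) {μ : Dual ℂ H} (hμ : wtSpace M μ ≠ ⊥) :
    ∃ β ∈ Qpos b, IsMaxWt b M (μ + β) := by
  obtain ⟨β, h₁, h₂, h₃⟩ := h.exists_maximal hμ
  exact ⟨β, h₁, h₂, h₃⟩

theorem exists_isMaxWt (hW : IsWt H M) (h : IsBdd b M) [Nontrivial M] : ∃ μ, IsMaxWt b M μ := by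
  obtain ⟨μ, hμ⟩ := hW.exists_ne_bot
  obtain ⟨β, -, hβ⟩ := h.exists_isMaxWt hμ
  exact ⟨_, hβ⟩

theorem IsBdd.exists_forall_Em_smul (h : IsBdd b M) {μ : Dual ℂ H} {v : M}
    (hv : v ∈ wtSpace M μ) : ∃ n : ℕ, ∀ c : Multiset (Pos b), n ≤ htm c → Em c • v = 0 := by
  obtain ⟨S, hS⟩ := h
  obtain ⟨n, hn⟩ : ∃ n : ℕ, ∀ ν ∈ S, hgt b (ν - μ) < n := by
    obtain ⟨C, hC⟩ := (S.image fun ν => hgt b (ν - μ)).bddAbove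
    obtain ⟨n, hn⟩ := exists_nat_gt C
    exact ⟨n, fun ν hν => (hC (Finset.mem_coe.mpr (Finset.mem_image_of_mem _ hν))).trans_lt hn⟩
  refine ⟨n, fun c hc => ?_⟩
  by_contra hne
  obtain ⟨ν, hν, hQ⟩ := hS (wtm c + μ) ((Submodule.ne_bot_iff _).mpr ⟨_, Em_smul_mem c hv, hne⟩)
  have h₁ := hgt_nonneg hQ
  have h₂ : ν - (wtm c + μ) = (ν - μ) - wtm c := by abel
  rw [h₂, map_sub, hgt_wtm] at h₁
  have h₃ := hn ν hν
  have h₄ : (n : ℝ) ≤ htm c := by exact_mod_cast hc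
  linarith

end Maximal

/-! ### Finite length of Verma modules. -/

section VermaFin

variable {μ : Dual ℂ H}

theorem casScalar_eq_of_smul {c : ℂ} {κ : Dual ℂ H} {x : M} (hx : x ∈ wtSpace M κ) (hx₀ : x ≠ 0)
    (hx' : ∀ i : Pos b, gen L (posVec i) • x = 0) (h : casimir b • x = c • x) :
    casScalar b κ = c := by
  rw [casimir_smul hx hx'] at h
  exact smul_left_injective ℂ hx₀ h

/-- A nonzero subquotient has a highest weight vector. Its weight lies below `μ` and has the Casimir
scalar of `μ`, which leaves finitely many weights; their finite-dimensional weight spaces detect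
every strict inclusion. -/
theorem isFin_verma : IsFin H (Verma b μ) := by
  classical
  have hfin := finite_casScalar_sub (b := b) μ (casScalar b μ)
  have h := noetherian_artinian_of_weights (M := Verma b μ) (hfin.toFinset.image fun β => μ - β)
    (fun ν _ => inferInstance) (fun A B hAB => ?_)
  · exact ⟨h.1, h.2, fun ν => inferInstance⟩
  obtain ⟨z, hzB, hzA⟩ := Set.exists_of_ssubset hAB
  let X := B ⧸ A.submoduleOf B
  have hWB : IsWt H B := isWt_verma.submodule B
  have hBB : IsBdd b B := (isCategoryO_iff.mp (catO_verma (b := b) (μ := μ))).2.2.submodule B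
  have : Nontrivial X := ⟨⟨(A.submoduleOf B).mkQ ⟨z, hzB⟩, 0, fun h => hzA (by
    rwa [Submodule.mkQ_apply, Submodule.Quotient.mk_eq_zero] at h)⟩⟩
  obtain ⟨κ, hκ⟩ := exists_isMaxWt (hWB.quotient (A.submoduleOf B))
    (hBB.of_surjective hWB (A.submoduleOf B).mkQ (Submodule.mkQ_surjective _))
  obtain ⟨x, hx, hx₀⟩ := (Submodule.ne_bot_iff _).mp hκ.1
  obtain ⟨y, rfl⟩ := Submodule.mkQ_surjective _ x
  obtain ⟨y', hy', hyy⟩ := hWB.exists_lift _ hx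
  have hy'' := map_mem_wtSpace B.subtype hy'
  refine ⟨κ, ?_, y', hy'', y'.2, fun hA => hx₀ ?_⟩
  · have h₁ : (y' : Verma b μ) ≠ 0 := fun h => hx₀ (by
      rw [← hyy, show y' = 0 from Subtype.ext h, map_zero])
    have h₂ := sub_mem_of_wtSpace_verma ((Submodule.ne_bot_iff _).mpr ⟨_, hy'', h₁⟩)
    have h₃ : casScalar b κ = casScalar b μ := by
      refine casScalar_eq_of_smul hx hx₀ (hκ.posVec_smul hx) ?_
      rw [← map_smul]
      have : casimir b • y = casScalar b μ • y := Subtype.ext (casimir_smul_verma _)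
      rw [this]
      rfl
    refine Finset.mem_image.mpr ⟨μ - κ, ?_, sub_sub_cancel _ _⟩
    rw [Set.Finite.mem_toFinset]
    exact ⟨h₂, by rw [sub_sub_cancel, h₃]⟩
  · rw [← hyy, Submodule.mkQ_apply, Submodule.Quotient.mk_eq_zero]
    exact hA

end VermaFin

/-! ### Verma filtrations recorded by lists, and those of truncations. -/

section StdF

/-- Modules with a filtration whose successive subquotients, from the bottom, are the Verma modules
with highest weights given by a list. -/
def StdF (b : (rootSystem H).Base) : List (Dual ℂ H) → (M : Type v) → [AddCommGroup M] →
    [Module (Ug L) M] → Prop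
  | [], M, _, _ => Subsingleton M
  | μ :: l, M, _, _ => ∃ X : Submodule (Ug L) M, Nonempty (X ≃ₗ[Ug L] Verma b μ) ∧ StdF b l (M ⧸ X)

theorem StdF.congr {l : List (Dual ℂ H)} {M : Type v} [AddCommGroup M] [Module (Ug L) M]
    {M' : Type w} [AddCommGroup M'] [Module (Ug L) M'] (h : StdF b l M) (e : M ≃ₗ[Ug L] M') :
    StdF b l M' := by
  induction l generalizing M M' with
  | nil => have : Subsingleton M := h; exact e.symm.toEquiv.subsingleton
  | cons μ l ih =>
    obtain ⟨X, ⟨f⟩, hX⟩ := h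
    exact ⟨X.map e.toLinearMap, ⟨(e.submoduleMap X).symm.trans f⟩,
      ih hX (Submodule.Quotient.equiv X _ e rfl)⟩

theorem StdF.isFin {l : List (Dual ℂ H)} (h : StdF b l M) : IsFin H M := by
  induction l generalizing M with
  | nil =>
    have : Subsingleton M := h
    exact ⟨inferInstance, inferInstance, fun ν => inferInstance⟩
  | cons μ l ih =>
    obtain ⟨X, ⟨f⟩, hX⟩ := h
    exact IsFin.of_submodule_quotient X (isFin_verma.of_injective f.toLinearMap f.injective) (ih hX)

variable {μ : Dual ℂ H} {T : Set (Multiset (Pos b))}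

/-- Adjoin the missing exponents to `T` in order of decreasing height: this keeps `T` up-closed, and
each exponent splits a Verma submodule off at the bottom. -/
theorem stdF_QMod (hT : UpClosed T) (hf : Tᶜ.Finite) : ∃ l : List (Dual ℂ H),
    StdF b l (QMod μ T) ∧
      (l : Multiset (Dual ℂ H)) = hf.toFinset.val.map fun c => wtm c + μ := by
  classical
  obtain ⟨n, hn⟩ : ∃ n, hf.toFinset.card = n := ⟨_, rfl⟩
  induction n generalizing T with
  | zero =>
    refine ⟨[], ?_, ?_⟩
    · have h₀ : (0 : Multiset (Pos b)) ∈ T := by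
        by_contra h
        have := Finset.card_eq_zero.mp hn
        exact Finset.notMem_empty _ (this ▸ (hf.mem_toFinset.mpr h))
      have h₁ := Em_smul_qgen (μ := μ) h₀
      rw [Em_zero, one_smul] at h₁
      have h₂ := QMod.span_eq_top (μ := μ) (T := T)
      rw [h₁, Submodule.span_zero_singleton] at h₂
      exact (Submodule.subsingleton_iff (Ug L)).mp (subsingleton_of_bot_eq_top h₂)
    · rw [Finset.card_eq_zero.mp hn]
      rfl
  | succ n ih =>
    obtain ⟨c, hc, hmax⟩ := hf.toFinset.exists_max_image htm
      (Finset.card_pos.mp (by omega))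
    have hcT : c ∉ T := by simpa using hc
    have hT' : UpClosed (insert c T) := by
      rintro c' (rfl | hc') d d' hd' h
      · refine Set.mem_insert_of_mem _ ?_
        by_contra hd
        exact absurd (hmax d (hf.mem_toFinset.mpr hd)) (not_le.mpr (htm_lt_of_wtm_eq hd' h))
      · exact Set.mem_insert_of_mem _ (hT c' hc' d d' hd' h)
    have hf' : (insert c T)ᶜ.Finite := hf.subset (Set.compl_subset_compl.mpr (Set.subset_insert c T))
    have he : hf.toFinset = insert c hf'.toFinset := by
      ext d
      simp only [Set.Finite.mem_toFinset, Finset.mem_insert, Set.mem_compl_iff, Set.mem_insert_iff]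
      by_cases h : d = c
      · simp [h, hcT]
      · simp [h]
    have hc' : c ∉ hf'.toFinset := by simp
    obtain ⟨l, hl, hl'⟩ := ih hT' hf' (by rw [he, Finset.card_insert_of_notMem hc'] at hn; omega)
    obtain ⟨X, hX, ⟨e⟩⟩ := QMod.exists_submodule (μ := μ) hT hcT hT'
    refine ⟨(wtm c + μ) :: l, ⟨X, hX, hl.congr e.symm⟩, ?_⟩
    rw [he, Finset.insert_val_of_notMem hc', Multiset.map_cons, ← hl', Multiset.cons_coe]

theorem finite_compl_le_htm (n : ℕ) : ({c : Multiset (Pos b) | n ≤ htm c}ᶜ).Finite :=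
  (finite_htm_le n).subset fun c hc => by
    simp only [Set.mem_compl_iff, Set.mem_ofPred_eq, not_le] at hc
    exact hc.le

end StdF

/-! ### Finite length for all of category O. -/

section CatOFin

/-- Bounded weights force positive monomials of large height to kill `v`, so a weight generator
spans a quotient of a truncation. Induction on the number of generators does the rest. -/
theorem isFin_of_span (l : List M) (hl : ∀ v ∈ l, ∃ μ : Dual ℂ H, v ∈ wtSpace M μ)
    (hs : Submodule.span (Ug L) {v | v ∈ l} = ⊤) (hW : IsWt H M) (hB : IsBdd b M) : IsFin H M := by
  obtain ⟨n, hn⟩ : ∃ n, l.length = n := ⟨_, rfl⟩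
  induction n generalizing M with
  | zero =>
    rw [List.length_eq_zero_iff] at hn
    have : Subsingleton M := by
      refine (Submodule.subsingleton_iff (Ug L)).mp (subsingleton_of_bot_eq_top ?_)
      rw [← hs, hn]
      simp
    exact ⟨inferInstance, inferInstance, fun ν => inferInstance⟩
  | succ m ih =>
    obtain ⟨v, l, rfl⟩ := List.exists_cons_of_length_eq_add_one hn
    obtain ⟨μ, hμ⟩ := hl v List.mem_cons_self
    obtain ⟨n, hv⟩ := hB.exists_forall_Em_smul hμ
    obtain ⟨f, hf⟩ := QMod.exists_lift (T := {c : Multiset (Pos b) | n ≤ htm c}) hμ hv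
    have hr : LinearMap.range f = Submodule.span (Ug L) {v} := by
      rw [LinearMap.range_eq_map, ← QMod.span_eq_top, Submodule.map_span, Set.image_singleton, hf]
    have hQ : IsFin H (QMod μ {c : Multiset (Pos b) | n ≤ htm c}) := by
      obtain ⟨l', hl', -⟩ := stdF_QMod (μ := μ) (upClosed_le_htm (b := b) n) (finite_compl_le_htm n)
      exact hl'.isFin
    refine IsFin.of_submodule_quotient (LinearMap.range f)
      (hQ.of_surjective (isWt_of_span qvec_mem span_qvec) f.rangeRestrict
        f.surjective_rangeRestrict) (ih (l.map (LinearMap.range f).mkQ) ?_ ?_ (hW.quotient _)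
        (hB.of_surjective hW _ (Submodule.mkQ_surjective _)) (by simpa using hn))
    · intro x hx
      obtain ⟨y, hy, rfl⟩ := List.mem_map.mp hx
      obtain ⟨ν, hν⟩ := hl y (List.mem_cons_of_mem _ hy)
      exact ⟨ν, map_mem_wtSpace _ hν⟩
    · rw [eq_top_iff, ← Submodule.range_mkQ (LinearMap.range f),
        LinearMap.range_eq_map (LinearMap.range f).mkQ, ← hs,
        Submodule.map_span, Submodule.span_le]
      rintro _ ⟨x, hx, rfl⟩
      rcases List.mem_cons.mp hx with rfl | hx
      · have : x ∈ LinearMap.range f := ⟨_, hf⟩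
        rw [Submodule.mkQ_apply, (Submodule.Quotient.mk_eq_zero _).mpr this]
        exact zero_mem _
      · exact Submodule.subset_span (List.mem_map_of_mem hx)

theorem exists_weight_generators (h : IsCategoryO b M) : ∃ l : List M,
    (∀ v ∈ l, ∃ μ : Dual ℂ H, v ∈ wtSpace M μ) ∧ Submodule.span (Ug L) {v | v ∈ l} = ⊤ := by
  classical
  rw [isCategoryO_iff] at h
  obtain ⟨s, hs⟩ := h.1.1
  choose f hf hsum using h.2.1.exists_finsupp
  let t : Finset M := s.biUnion fun m => (f m).support.image (f m)
  refine ⟨t.toList, fun v hv => ?_, ?_⟩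
  · simp only [t, Finset.mem_toList, Finset.mem_biUnion, Finset.mem_image] at hv
    obtain ⟨m, -, μ, -, rfl⟩ := hv
    exact ⟨μ, hf m μ⟩
  · rw [eq_top_iff, ← hs, Submodule.span_le]
    intro m hm
    rw [← hsum m]
    refine sum_mem fun μ hμ => Submodule.subset_span ?_
    simp only [t, Finset.mem_toList, Finset.mem_biUnion, Finset.mem_image, Set.mem_ofPred_eq]
    exact ⟨m, hm, μ, hμ, rfl⟩

theorem isFin_of_catO (h : IsCategoryO b M) : IsFin H M := by
  obtain ⟨l, hl, hs⟩ := exists_weight_generators h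
  exact isFin_of_span l hl hs (isCategoryO_iff.mp h).2.1 (isCategoryO_iff.mp h).2.2

end CatOFin

end CatO
end

set_option linter.unusedSectionVars false

noncomputable section

namespace CatO

variable {L : Type u} [LieRing L] [LieAlgebra ℂ L] [FiniteDimensional ℂ L] [IsSemisimple ℂ L]
  {H : LieSubalgebra ℂ L} [H.IsCartanSubalgebra] {b : (rootSystem H).Base}

variable {M : Type v} [AddCommGroup M] [Module ℂ M] [Module (Ug L) M] [IsScalarTower ℂ (Ug L) M]
  {N : Type w} [AddCommGroup N] [Module ℂ N] [Module (Ug L) N] [IsScalarTower ℂ (Ug L) N]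

/-! ### The simple objects of category O. -/

section Irr

variable {μ : Dual ℂ H}

theorem notMem_iSup_wtSpace {v : M} (hv : v ∈ wtSpace M μ) (hv₀ : v ≠ 0) :
    v ∉ ⨆ ν : {ν : Dual ℂ H // ν ≠ μ}, wtSpace M ν.1 := by
  classical
  intro h
  obtain ⟨f, hf, hs⟩ := (Submodule.mem_iSup_iff_exists_finsupp _ _).mp h
  obtain ⟨p, hp₁, hp₂, -⟩ := exists_projector M μ (f.support.image Subtype.val) (by simp)
  refine hv₀ ?_
  rw [← hp₁ v hv, ← hs, Finsupp.sum, Finset.smul_sum]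
  exact Finset.sum_eq_zero fun ν hν => hp₂ _ (Finset.mem_image_of_mem _ hν) _ (hf ν)

theorem Verma.eq_top_of_vgen_mem {X : Submodule (Ug L) (Verma b μ)} (h : vgen b μ ∈ X) : X = ⊤ := by
  rw [eq_top_iff, ← Verma.span_eq_top, Submodule.span_singleton_le_iff_mem]
  exact h

/-- The weight space of `μ` is the line of the generator, so a proper submodule has no component
there. The same then holds for sums of proper submodules. -/
theorem Verma.mem_iSup_of_ne_top {X : Submodule (Ug L) (Verma b μ)} (hX : X ≠ ⊤) {x : Verma b μ}
    (hx : x ∈ X) : x ∈ ⨆ ν : {ν : Dual ℂ H // ν ≠ μ}, wtSpace (Verma b μ) ν.1 := by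
  obtain ⟨f, hf, rfl⟩ := (isWt_verma (b := b) (μ := μ)).exists_finsupp x
  refine sum_mem fun ν hν => ?_
  by_cases h : ν = μ
  · subst h
    have h₁ := component_mem hf hx hν
    obtain ⟨c, hc⟩ := mem_span_vgen (hf ν)
    have hc₀ : c = 0 := by
      by_contra hc₀
      refine hX (Verma.eq_top_of_vgen_mem ?_)
      have h₂ := (X.restrictScalars ℂ).smul_mem c⁻¹ h₁
      rw [← hc, smul_smul, inv_mul_cancel₀ hc₀, one_smul] at h₂
      exact h₂
    rw [← hc, hc₀, zero_smul]
    exact zero_mem _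
  · exact Submodule.mem_iSup_of_mem (⟨ν, h⟩ : {ν : Dual ℂ H // ν ≠ μ}) (hf ν)

theorem vgen_notMem_sSup : vgen b μ ∉ sSup {X : Submodule (Ug L) (Verma b μ) | X ≠ ⊤} := by
  intro h
  rw [sSup_eq_iSup'] at h
  refine notMem_iSup_wtSpace (vgen_mem (b := b) (μ := μ)) vgen_ne_zero ?_
  generalize vgen b μ = x at h
  induction h using Submodule.iSup_induction' with
  | mem X x hx => exact Verma.mem_iSup_of_ne_top X.2 hx
  | zero => exact zero_mem _
  | add x y _ _ hx hy => exact add_mem hx hy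

variable (b μ) in
/-- The highest weight vector of `Irr b μ`. -/
def igen : Irr b μ := (sSup {X : Submodule (Ug L) (Verma b μ) | X ≠ ⊤}).mkQ (vgen b μ)

theorem igen_ne_zero : igen b μ ≠ 0 := fun h => vgen_notMem_sSup (b := b) (μ := μ) (by
  rwa [igen, Submodule.mkQ_apply, Submodule.Quotient.mk_eq_zero] at h)

theorem igen_mem : igen b μ ∈ wtSpace (Irr b μ) μ := map_mem_wtSpace _ vgen_mem

instance isSimpleModule_irr : IsSimpleModule (Ug L) (Irr b μ) := by
  have : Nontrivial (Irr b μ) := ⟨⟨igen b μ, 0, igen_ne_zero⟩⟩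
  refine (isSimpleModule_iff _ _).mpr { eq_bot_or_eq_top := fun X => ?_ }
  by_contra! hX
  refine hX.1 ?_
  rw [← Submodule.map_comap_eq_of_surjective (Submodule.mkQ_surjective _) X,
    eq_bot_iff, Submodule.map_le_iff_le_comap, Submodule.comap_bot, Submodule.ker_mkQ]
  refine le_sSup fun h => hX.2 ?_
  have h₁ := Submodule.map_comap_eq_of_surjective (Submodule.mkQ_surjective _) X
  rw [h, Submodule.map_top, Submodule.range_mkQ] at h₁
  exact h₁.symm

theorem catO_irr : IsCategoryO b (Irr b μ) := catO_quotient catO_verma _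

theorem sub_mem_of_wtSpace_irr {ν : Dual ℂ H} (h : wtSpace (Irr b μ) ν ≠ ⊥) : μ - ν ∈ Qpos b :=
  sub_mem_of_wtSpace_verma (wtSpace_ne_bot_of_surjective isWt_verma _
    (Submodule.mkQ_surjective _) h)

theorem wtSpace_verma_ne_bot : wtSpace (Verma b μ) μ ≠ ⊥ :=
  (Submodule.ne_bot_iff _).mpr ⟨_, vgen_mem, vgen_ne_zero⟩

theorem casimir_smul_irr (x : Irr b μ) : casimir b • x = casScalar b μ • x := by
  obtain ⟨y, rfl⟩ := Submodule.mkQ_surjective _ x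
  rw [← map_smul, casimir_smul_verma]
  rfl

theorem mem_span_igen {x : Irr b μ} (hx : x ∈ wtSpace (Irr b μ) μ) : ∃ c : ℂ, c • igen b μ = x := by
  obtain ⟨y, hy⟩ := wtMap_surjective isWt_verma (Submodule.mkQ _) (Submodule.mkQ_surjective _) μ
    (⟨x, hx⟩ : wtSpace (Irr b μ) μ)
  obtain ⟨c, hc⟩ := mem_span_vgen y.2
  refine ⟨c, ?_⟩
  have h := congrArg Subtype.val hy
  rw [wtMap_coe, ← hc] at h
  exact h

theorem finrank_wtSpace_irr : finrank ℂ (wtSpace (Irr b μ) μ) = 1 := by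
  rw [finrank_eq_one_iff']
  refine ⟨⟨igen b μ, igen_mem⟩, fun h => igen_ne_zero (congrArg Subtype.val h), fun x => ?_⟩
  obtain ⟨c, hc⟩ := mem_span_igen x.2
  exact ⟨c, Subtype.ext hc⟩

theorem Irr.hom_ext {X : Type w} [AddCommGroup X] [Module (Ug L) X] {f g : Irr b μ →ₗ[Ug L] X}
    (h : f (igen b μ) = g (igen b μ)) : f = g :=
  Submodule.linearMap_qext _ (Verma.hom_ext h)

theorem wtSpace_ne_bot_of_equiv (e : M ≃ₗ[Ug L] N) {ν : Dual ℂ H} (h : wtSpace M ν ≠ ⊥) :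
    wtSpace N ν ≠ ⊥ := wtSpace_ne_bot_of_injective e.toLinearMap e.injective h

theorem eq_of_verma_equiv {ν : Dual ℂ H} (h : Nonempty (Verma b μ ≃ₗ[Ug L] Verma b ν)) : μ = ν := by
  obtain ⟨e⟩ := h
  exact eq_of_sub_mem_Qpos
    (sub_mem_of_wtSpace_verma (wtSpace_ne_bot_of_equiv e.symm wtSpace_verma_ne_bot))
    (sub_mem_of_wtSpace_verma (wtSpace_ne_bot_of_equiv e wtSpace_verma_ne_bot))

/-- The simple objects of category `O` are the modules `Irr b ν`. -/
theorem exists_equiv_irr (hS : IsCategoryO b M) [IsSimpleModule (Ug L) M] :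
    ∃ ν : Dual ℂ H, Nonempty (M ≃ₗ[Ug L] Irr b ν) := by
  have := IsSimpleModule.nontrivial (Ug L) M
  rw [isCategoryO_iff] at hS
  obtain ⟨ν, hν⟩ := exists_isMaxWt hS.2.1 hS.2.2
  obtain ⟨v, hv, hv₀⟩ := (Submodule.ne_bot_iff _).mp hν.1
  obtain ⟨f, hf⟩ := Verma.exists_lift hv (hν.posVec_smul hv)
  have hf₀ : f ≠ 0 := fun h => hv₀ (by rw [← hf, h]; rfl)
  have hsurj : Function.Surjective f := LinearMap.surjective_of_ne_zero hf₀
  have hker : LinearMap.ker f = sSup {X : Submodule (Ug L) (Verma b ν) | X ≠ ⊤} := by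
    have h₁ : IsCoatom (LinearMap.ker f) := LinearMap.isCoatom_ker_of_surjective hsurj
    refine (h₁.le_iff.mp (le_sSup h₁.1)).resolve_left ?_ |>.symm
    intro h
    refine vgen_notMem_sSup (b := b) (μ := ν) ?_
    rw [h]
    trivial
  exact ⟨ν, ⟨(f.quotKerEquivOfSurjective hsurj).symm.trans (Submodule.quotEquivOfEq _ _ hker)⟩⟩

end Irr

/-! ### Uniqueness of Verma multiplicities and passage to direct summands. -/

section StdF

theorem mem_range_vgen {μ : Dual ℂ H} (f : Verma b μ →ₗ[Ug L] M) {X : Submodule (Ug L) M}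
    (h : f (vgen b μ) ∈ X) : LinearMap.range f ≤ X := by
  rw [LinearMap.range_eq_map, ← Verma.span_eq_top, Submodule.map_span, Set.image_singleton,
    Submodule.span_singleton_le_iff_mem]
  exact h

/-- In a module with a Verma filtration, a vector of maximal weight generates a Verma module, and
the quotient is again filtered. -/
theorem StdF.peel {l : List (Dual ℂ H)} (h : StdF b l M) (hW : IsWt H M) {lam : Dual ℂ H}
    (hlam : IsMaxWt b M lam) (f : Verma b lam →ₗ[Ug L] M) (hf : f (vgen b lam) ≠ 0) :
    Function.Injective f ∧ ∃ l', (lam :: l').Perm l ∧ StdF b l' (M ⧸ LinearMap.range f) := by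
  induction l generalizing M with
  | nil =>
    have : Subsingleton M := h
    exact absurd (Subsingleton.elim _ _) hf
  | cons μ l ih =>
    obtain ⟨X, ⟨e⟩, hX⟩ := h
    -- If the vector lies in the bottom step, a Verma module of highest weight `μ`, maximality of
    -- `lam` forces `μ = lam`, and `f` is an isomorphism onto that step. Otherwise its image in `M ⧸
    -- X` is nonzero and induction applies there.
    by_cases hv : f (vgen b lam) ∈ X
    · obtain rfl : μ = lam := by
        have h₁ : wtSpace X lam ≠ ⊥ := (Submodule.ne_bot_iff _).mpr
          ⟨⟨_, hv⟩, fun z => Subtype.ext (map_mem_wtSpace f vgen_mem z),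
            fun h => hf (congrArg Subtype.val h)⟩
        have h₂ := sub_mem_of_wtSpace_verma (wtSpace_ne_bot_of_equiv e h₁)
        have h₃ : wtSpace M μ ≠ ⊥ := wtSpace_ne_bot_of_injective X.subtype X.subtype_injective
          (wtSpace_ne_bot_of_equiv e.symm wtSpace_verma_ne_bot)
        have h₄ := hlam.2 _ h₂ (by rwa [add_sub_cancel])
        exact sub_eq_zero.mp h₄
      have hr : LinearMap.range f ≤ X := mem_range_vgen f hv
      let g : Verma b μ →ₗ[Ug L] X := f.codRestrict X fun x => hr ⟨x, rfl⟩
      obtain ⟨c, hc⟩ := mem_span_vgen (x := e (g (vgen b μ)))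
        (map_mem_wtSpace (e.toLinearMap ∘ₗ g) vgen_mem)
      have hc₀ : c ≠ 0 := by
        rintro rfl
        rw [zero_smul] at hc
        exact hf (congrArg Subtype.val (e.map_eq_zero_iff.mp hc.symm))
      have heg : e.toLinearMap ∘ₗ g = c • LinearMap.id := Verma.hom_ext hc.symm
      have hinj : Function.Injective f := by
        intro x y hxy
        have h₁ : g x = g y := Subtype.ext hxy
        have h₂ : c • x = c • y := by
          have h₃ := LinearMap.congr_fun heg x
          have h₄ := LinearMap.congr_fun heg y
          simp only [LinearMap.comp_apply, h₁, LinearMap.smul_apply, LinearMap.id_apply] at h₃ h₄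
          rw [← h₃, ← h₄]
        exact smul_right_injective _ hc₀ h₂
      have hrX : LinearMap.range f = X := by
        refine le_antisymm hr fun x hx => ?_
        refine ⟨c⁻¹ • e ⟨x, hx⟩, ?_⟩
        have h₁ := LinearMap.congr_fun heg (c⁻¹ • e ⟨x, hx⟩)
        simp only [LinearMap.comp_apply, LinearMap.smul_apply, LinearMap.id_apply, smul_smul,
          mul_inv_cancel₀ hc₀, one_smul] at h₁
        exact congrArg Subtype.val (e.injective h₁)
      exact ⟨hinj, l, List.Perm.refl _, hrX ▸ hX⟩
    · have hlam' : IsMaxWt b (M ⧸ X) lam := by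
        refine ⟨(Submodule.ne_bot_iff _).mpr ⟨X.mkQ (f (vgen b lam)),
          map_mem_wtSpace (X.mkQ ∘ₗ f) vgen_mem, fun h => hv ?_⟩, fun γ hγ h =>
          hlam.2 γ hγ (wtSpace_ne_bot_of_surjective hW X.mkQ X.mkQ_surjective h)⟩
        rwa [Submodule.mkQ_apply, Submodule.Quotient.mk_eq_zero] at h
      obtain ⟨hinj, l', hp, hl'⟩ := ih hX (hW.quotient X) hlam' (X.mkQ ∘ₗ f) (fun h => hv (by
        rwa [LinearMap.comp_apply, Submodule.mkQ_apply, Submodule.Quotient.mk_eq_zero] at h))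
      -- Thus `X` embeds in the quotient by the range of `f` and can serve as its bottom step.
      have hdisj : ∀ x, f x ∈ X → x = 0 := fun x hx => hinj (by
        rw [LinearMap.comp_apply, Submodule.mkQ_apply, (Submodule.Quotient.mk_eq_zero _).mpr hx,
          map_zero])
      refine ⟨fun x y hxy => hinj (congrArg X.mkQ hxy), μ :: l', ?_, ?_⟩
      · exact (List.Perm.swap _ _ _).trans (hp.cons μ)
      · refine ⟨X.map (LinearMap.range f).mkQ, ?_, ?_⟩
        · have h₁ : Function.Injective ((LinearMap.range f).mkQ ∘ₗ X.subtype) := by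
            rw [injective_iff_map_eq_zero]
            intro x hx
            rw [LinearMap.comp_apply, Submodule.mkQ_apply, Submodule.Quotient.mk_eq_zero] at hx
            obtain ⟨y, hy⟩ := hx
            have : y = 0 := hdisj y (by rw [hy]; exact x.2)
            rw [this, map_zero] at hy
            exact Subtype.ext hy.symm
          have h₂ : LinearMap.range ((LinearMap.range f).mkQ ∘ₗ X.subtype) =
              X.map (LinearMap.range f).mkQ := by
            rw [LinearMap.range_comp, Submodule.range_subtype]
          exact ⟨(LinearEquiv.ofEq _ _ h₂.symm).trans
            ((LinearEquiv.ofInjective _ h₁).symm.trans e)⟩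
        · rw [LinearMap.range_comp] at hl'
          exact hl'.congr ((Submodule.quotientQuotientEquivQuotientSup _ _).trans
            ((Submodule.quotEquivOfEq _ _ (sup_comm _ _)).trans
              (Submodule.quotientQuotientEquivQuotientSup _ _).symm))

theorem StdF.nil_of_subsingleton [Subsingleton M] {l : List (Dual ℂ H)} (h : StdF b l M) :
    l = [] := by
  cases l with
  | nil => rfl
  | cons μ l =>
    obtain ⟨X, ⟨e⟩, -⟩ := h
    have : Subsingleton (Verma b μ) := e.symm.toEquiv.subsingleton
    exact absurd (Subsingleton.elim _ _) (vgen_ne_zero (b := b) (μ := μ))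

theorem exists_hom_verma (hW : IsWt H M) (hB : IsBdd b M)
    [Nontrivial M] : ∃ (lam : Dual ℂ H) (f : Verma b lam →ₗ[Ug L] M), IsMaxWt b M lam ∧
      f (vgen b lam) ≠ 0 := by
  obtain ⟨lam, hlam⟩ := exists_isMaxWt hW hB
  obtain ⟨v, hv, hv₀⟩ := (Submodule.ne_bot_iff _).mp hlam.1
  obtain ⟨f, hf⟩ := Verma.exists_lift hv (hlam.posVec_smul hv)
  exact ⟨lam, f, hlam, by rwa [hf]⟩

/-- The same Verma submodule of maximal weight can be peeled off both filtrations. -/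
theorem StdF.perm {l l' : List (Dual ℂ H)} (h : StdF b l M) (h' : StdF b l' M) (hW : IsWt H M)
    (hB : IsBdd b M) : l.Perm l' := by
  obtain ⟨n, hn⟩ : ∃ n, l.length = n := ⟨_, rfl⟩
  induction n generalizing M l l' with
  | zero =>
    rw [List.length_eq_zero_iff] at hn
    subst hn
    have : Subsingleton M := h
    rw [h'.nil_of_subsingleton]
  | succ n ih =>
    rcases subsingleton_or_nontrivial M with hM | hM
    · rw [h.nil_of_subsingleton, h'.nil_of_subsingleton]
    obtain ⟨lam, f, hlam, hf⟩ := exists_hom_verma hW hB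
    obtain ⟨-, l₁, hp₁, hl₁⟩ := h.peel hW hlam f hf
    obtain ⟨-, l₂, hp₂, hl₂⟩ := h'.peel hW hlam f hf
    have h₁ := hp₁.length_eq
    rw [hn, List.length_cons] at h₁
    exact hp₁.symm.trans (((ih hl₁ hl₂ (hW.quotient _)
      (hB.of_surjective hW _ (Submodule.mkQ_surjective _)) (by omega)).cons lam).trans hp₂)

/-- Direct summands of modules with a Verma filtration have a Verma filtration. -/
theorem StdF.retract {l : List (Dual ℂ H)} (h : StdF b l M) (hW : IsWt H M) (hB : IsBdd b M)
    (i : N →ₗ[Ug L] M) (p : M →ₗ[Ug L] N) (hip : ∀ x, p (i x) = x) : ∃ l', StdF b l' N := by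
  obtain ⟨n, hn⟩ : ∃ n, l.length = n := ⟨_, rfl⟩
  induction n generalizing M N l with
  | zero =>
    rw [List.length_eq_zero_iff] at hn
    subst hn
    have : Subsingleton M := h
    exact ⟨[], (Function.LeftInverse.injective (g := p) hip).subsingleton⟩
  | succ n ih =>
    rcases subsingleton_or_nontrivial M with hM | hM
    · exact ⟨[], (Function.LeftInverse.injective (g := p) hip).subsingleton⟩
    obtain ⟨lam, f, hlam, hf⟩ := exists_hom_verma hW hB
    -- If `lam` is not a weight of `N`, then `p` kills the peeled Verma module and `N` is a retract
    -- of the quotient.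
    by_cases hN : wtSpace N lam = ⊥
    · obtain ⟨-, l', hp', hl'⟩ := h.peel hW hlam f hf
      have h₁ := hp'.length_eq
      rw [hn, List.length_cons] at h₁
      have h₂ : LinearMap.range f ≤ LinearMap.ker p := by
        refine mem_range_vgen f ?_
        have h₃ : p (f (vgen b lam)) ∈ wtSpace N lam := map_mem_wtSpace (p ∘ₗ f) vgen_mem
        rw [hN, Submodule.mem_bot] at h₃
        exact h₃
      exact ih hl' (hW.quotient _) (hB.of_surjective hW _ (Submodule.mkQ_surjective _))
        ((LinearMap.range f).mkQ ∘ₗ i) ((LinearMap.range f).liftQ p h₂) (fun x => hip x) (by omega)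
    -- Otherwise the Verma module to be peeled is generated by a vector of `N`, and both modules are
    -- divided by it compatibly.
    · obtain ⟨a, ha, ha₀⟩ := (Submodule.ne_bot_iff _).mp hN
      have hmax : IsMaxWt b N lam := ⟨hN, fun γ hγ h => hlam.2 γ hγ
        (wtSpace_ne_bot_of_injective i (Function.LeftInverse.injective (g := p) hip) h)⟩
      obtain ⟨g, hg⟩ := Verma.exists_lift ha (hmax.posVec_smul ha)
      obtain ⟨hinj, l', hp', hl'⟩ := h.peel hW hlam (i ∘ₗ g) (fun h => ha₀ (by
        rw [LinearMap.comp_apply, hg] at h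
        rw [← hip a, h, map_zero]))
      have h₁ := hp'.length_eq
      rw [hn, List.length_cons] at h₁
      have hi : LinearMap.range g ≤ (LinearMap.range (i ∘ₗ g)).comap i := by
        rintro _ ⟨x, rfl⟩
        exact ⟨x, rfl⟩
      have hp : LinearMap.range (i ∘ₗ g) ≤ (LinearMap.range g).comap p := by
        rintro _ ⟨x, rfl⟩
        exact ⟨x, (hip _).symm⟩
      obtain ⟨l'', hl''⟩ := ih hl' (hW.quotient _)
        (hB.of_surjective hW _ (Submodule.mkQ_surjective _))
        (Submodule.mapQ _ _ i hi) (Submodule.mapQ _ _ p hp) (fun x => by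
          obtain ⟨y, rfl⟩ := Submodule.mkQ_surjective _ x
          simp [hip]) (by omega)
      refine ⟨lam :: l'', LinearMap.range g, ⟨(LinearEquiv.ofInjective g ?_).symm⟩, hl''⟩
      intro x y hxy
      exact hinj (congrArg i hxy)

theorem StdF.append {l l' : List (Dual ℂ H)} {X : Submodule (Ug L) M} (h : StdF b l X)
    (h' : StdF b l' (M ⧸ X)) : StdF b (l ++ l') M := by
  induction l generalizing M with
  | nil =>
    have h₁ : Subsingleton X := h
    have h₂ : X = ⊥ := Submodule.eq_bot_of_subsingleton
    exact h'.congr (Submodule.quotEquivOfEqBot X h₂)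
  | cons μ l ih =>
    obtain ⟨Y, ⟨e⟩, hY⟩ := h
    have hle : Y.map X.subtype ≤ X := Submodule.map_subtype_le X Y
    refine ⟨Y.map X.subtype, ⟨(Submodule.equivSubtypeMap X Y).symm.trans e⟩, ?_⟩
    refine ih (X := X.map (Y.map X.subtype).mkQ) (hY.congr ?_)
      (h'.congr (Submodule.quotientQuotientEquivQuotient _ _ hle).symm)
    let g : X →ₗ[Ug L] M ⧸ Y.map X.subtype := (Y.map X.subtype).mkQ ∘ₗ X.subtype
    have hker : LinearMap.ker g = Y := by
      rw [LinearMap.ker_comp, Submodule.ker_mkQ,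
        Submodule.comap_map_eq_of_injective X.subtype_injective]
    have hrange : LinearMap.range g = X.map (Y.map X.subtype).mkQ := by
      rw [LinearMap.range_comp, Submodule.range_subtype]
    exact (Submodule.quotEquivOfEq _ _ hker.symm).trans
      (g.quotKerEquivRange.trans (LinearEquiv.ofEq _ _ hrange))

end StdF

end CatO
end

set_option linter.unusedSectionVars false

noncomputable section

namespace CatO

variable {L : Type u} [LieRing L] [LieAlgebra ℂ L] [FiniteDimensional ℂ L] [IsSemisimple ℂ L]
  {H : LieSubalgebra ℂ L} [H.IsCartanSubalgebra] {b : (rootSystem H).Base}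

/-! ### Translation between chains of submodules and lists. -/

section Filtration

variable {M : Type v} [AddCommGroup M] [Module (Ug L) M]

/-- The subquotient `B / A` as a submodule of the quotient by `A`. -/
def subquotientEquiv {R : Type*} [Ring R] {V : Type*} [AddCommGroup V] [Module R V]
    (A B : Submodule R V) : Subquotient A B ≃ₗ[R] B.map A.mkQ :=
  (Submodule.quotEquivOfEq _ _ (by rw [LinearMap.ker_comp, Submodule.ker_mkQ]; rfl)).trans
    ((A.mkQ ∘ₗ B.subtype).quotKerEquivRange.trans
      (LinearEquiv.ofEq _ _ (by rw [LinearMap.range_comp, Submodule.range_subtype])))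

theorem stdF_of_chain {n : ℕ} (F : Fin (n + 1) → Submodule (Ug L) M) (w : Fin n → Dual ℂ H)
    (hlast : F (Fin.last n) = ⊤) (hle : ∀ i : Fin n, F i.castSucc ≤ F i.succ)
    (hq : ∀ i : Fin n, Nonempty (Subquotient (F i.castSucc) (F i.succ) ≃ₗ[Ug L] Verma b (w i))) :
    StdF b (List.ofFn w) (M ⧸ F 0) := by
  induction n with
  | zero =>
    rw [List.ofFn_zero]
    exact Submodule.Quotient.subsingleton_iff.mpr hlast
  | succ n ih =>
    rw [List.ofFn_succ]
    obtain ⟨e⟩ := hq 0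
    refine ⟨(F 1).map (F 0).mkQ, ⟨(subquotientEquiv (F 0) (F 1)).symm.trans e⟩, ?_⟩
    exact (ih (fun i => F i.succ) (fun i => w i.succ) hlast (fun i => hle i.succ)
      fun i => hq i.succ).congr (Submodule.quotientQuotientEquivQuotient _ _ (hle 0)).symm

theorem StdF.exists_chain {l : List (Dual ℂ H)} {A : Submodule (Ug L) M} (h : StdF b l (M ⧸ A)) :
    ∃ (n : ℕ) (F : Fin (n + 1) → Submodule (Ug L) M), F 0 = A ∧ F (Fin.last n) = ⊤ ∧
      (∀ i : Fin n, F i.castSucc ≤ F i.succ) ∧ ∀ i : Fin n, ∃ μ : Dual ℂ H,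
        Nonempty (Subquotient (F i.castSucc) (F i.succ) ≃ₗ[Ug L] Verma b μ) := by
  induction l generalizing A with
  | nil =>
    exact ⟨0, fun _ => A, rfl, Submodule.Quotient.subsingleton_iff.mp h, fun i => i.elim0,
      fun i => i.elim0⟩
  | cons μ l ih =>
    obtain ⟨X, ⟨e⟩, hX⟩ := h
    have hmap : (X.comap A.mkQ).map A.mkQ = X :=
      Submodule.map_comap_eq_of_surjective A.mkQ_surjective X
    have hle : A ≤ X.comap A.mkQ := by
      rw [← Submodule.map_le_iff_le_comap, Submodule.mkQ_map_self]
      exact bot_le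
    obtain ⟨n, F, h₀, h₁, h₂, h₃⟩ := ih (A := X.comap A.mkQ) (hX.congr
      ((Submodule.quotEquivOfEq _ _ hmap.symm).trans
        (Submodule.quotientQuotientEquivQuotient _ _ hle)))
    refine ⟨n + 1, Fin.cons A F, rfl, ?_, ?_, ?_⟩
    · rw [← Fin.succ_last, Fin.cons_succ]
      exact h₁
    · intro i
      refine Fin.cases ?_ (fun i => ?_) i
      · rw [Fin.castSucc_zero, Fin.cons_zero, Fin.cons_succ, h₀]
        exact hle
      · rw [Fin.castSucc_succ, Fin.cons_succ, Fin.cons_succ]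
        exact h₂ i
    · intro i
      refine Fin.cases ?_ (fun i => ?_) i
      · rw [Fin.castSucc_zero, Fin.cons_zero, Fin.cons_succ, h₀]
        exact ⟨μ, ⟨(subquotientEquiv _ _).trans ((LinearEquiv.ofEq _ _ hmap).trans e)⟩⟩
      · rw [Fin.castSucc_succ, Fin.cons_succ, Fin.cons_succ]
        exact h₃ i

theorem StdF.nonempty_standardFiltration {l : List (Dual ℂ H)} (h : StdF b l M) :
    Nonempty (StandardFiltration b M) := by
  obtain ⟨n, F, h₀, h₁, h₂, h₃⟩ := (h.congr (Submodule.quotEquivOfEqBot (⊥ : Submodule (Ug L) M)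
    rfl).symm).exists_chain
  exact ⟨⟨n, F, h₀, h₁, h₂, h₃⟩⟩

theorem StandardFiltration.exists_stdF (F : StandardFiltration b M) :
    ∃ l : List (Dual ℂ H), StdF b l M ∧
      ∀ (μ : Dual ℂ H) [DecidableEq (Dual ℂ H)], l.count μ = F.mult μ := by
  choose w hw using F.quot
  refine ⟨List.ofFn w, (stdF_of_chain F.sub w F.sub_last F.sub_le hw).congr
    (Submodule.quotEquivOfEqBot _ F.sub_zero), fun μ _ => ?_⟩
  rw [StandardFiltration.mult]
  have h : ∀ i, Nonempty (Subquotient (F.sub i.castSucc) (F.sub i.succ) ≃ₗ[Ug L] Verma b μ) ↔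
      w i = μ := by
    intro i
    obtain ⟨e⟩ := hw i
    constructor
    · rintro ⟨e'⟩
      exact eq_of_verma_equiv ⟨e.symm.trans e'⟩
    · rintro rfl
      exact ⟨e⟩
  rw [Nat.card_congr (Equiv.subtypeEquivRight h), Nat.card_eq_fintype_card, Fintype.card_subtype,
    ← Multiset.coe_count, ← Fin.univ_val_map, Multiset.count_map]
  simp only [eq_comm (a := μ)]
  rfl

end Filtration

end CatO
end

set_option linter.unusedSectionVars false

noncomputable section

namespace CatO

variable {L : Type u} [LieRing L] [LieAlgebra ℂ L] [FiniteDimensional ℂ L] [IsSemisimple ℂ L]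
  {H : LieSubalgebra ℂ L} [H.IsCartanSubalgebra] {b : (rootSystem H).Base}

/-! ### Dimensions of Hom spaces. -/

section Hom

variable {M : Type v} [AddCommGroup M] [Module ℂ M] [Module (Ug L) M] [IsScalarTower ℂ (Ug L) M]
  {N : Type w} [AddCommGroup N] [Module ℂ N] [Module (Ug L) N] [IsScalarTower ℂ (Ug L) N]
  {P : Type*} [AddCommGroup P] [Module (Ug L) P]

variable (P) in
/-- Composition with a homomorphism on the left. -/
def postcomp (g : M →ₗ[Ug L] N) : (P →ₗ[Ug L] M) →ₗ[ℂ] (P →ₗ[Ug L] N) where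
  toFun f := g ∘ₗ f
  map_add' _ _ := LinearMap.comp_add _ _ _
  map_smul' c f := LinearMap.ext fun x => (g.restrictScalars ℂ).map_smul c (f x)

variable (M) in
/-- Composition with a homomorphism on the right. -/
def precomp {Q : Type*} [AddCommGroup Q] [Module (Ug L) Q] (f : P →ₗ[Ug L] Q) :
    (Q →ₗ[Ug L] M) →ₗ[ℂ] (P →ₗ[Ug L] M) where
  toFun g := g ∘ₗ f
  map_add' _ _ := rfl
  map_smul' _ _ := rfl

theorem postcomp_injective {g : M →ₗ[Ug L] N} (hg : Function.Injective g) :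
    Function.Injective (postcomp P g) := fun _ _ h =>
  LinearMap.ext fun x => hg (LinearMap.congr_fun h x)

theorem precomp_injective {Q : Type*} [AddCommGroup Q] [Module (Ug L) Q] {f : P →ₗ[Ug L] Q}
    (hf : Function.Surjective f) : Function.Injective (precomp M f) := fun g g' h =>
  LinearMap.ext fun x => by
    obtain ⟨y, rfl⟩ := hf x
    exact LinearMap.congr_fun h y

theorem finrank_hom_congr_right (e : M ≃ₗ[Ug L] N) :
    finrank ℂ (P →ₗ[Ug L] M) = finrank ℂ (P →ₗ[Ug L] N) :=
  LinearEquiv.finrank_eq (LinearEquiv.ofBijective (postcomp P e.toLinearMap)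
    ⟨postcomp_injective e.injective, fun f => ⟨e.symm.toLinearMap ∘ₗ f, LinearMap.ext fun x =>
      e.apply_symm_apply (f x)⟩⟩)

theorem finrank_hom_congr_left {Q : Type*} [AddCommGroup Q] [Module (Ug L) Q] (e : P ≃ₗ[Ug L] Q) :
    finrank ℂ (P →ₗ[Ug L] M) = finrank ℂ (Q →ₗ[Ug L] M) :=
  LinearEquiv.finrank_eq (LinearEquiv.ofBijective (precomp M e.symm.toLinearMap)
    ⟨precomp_injective e.symm.surjective, fun f => ⟨f ∘ₗ e.toLinearMap, LinearMap.ext fun x =>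
      congrArg f (e.apply_symm_apply x)⟩⟩)

/-- A homomorphism is determined by its values on finitely many weight generators, which lie in
finite-dimensional weight spaces. -/
theorem finiteDimensional_hom [Module ℂ P] [IsScalarTower ℂ (Ug L) P] (hP : IsCategoryO b P)
    (hM : IsFin H M) : FiniteDimensional ℂ (P →ₗ[Ug L] M) := by
  obtain ⟨l, hl, hs⟩ := exists_weight_generators hP
  have hl' : ∀ i : Fin l.length, ∃ μ : Dual ℂ H, l.get i ∈ wtSpace P μ := fun i =>
    hl _ (List.get_mem l i)
  choose μ hμ using hl'
  let ev : (P →ₗ[Ug L] M) →ₗ[ℂ] ∀ i : Fin l.length, wtSpace M (μ i) :=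
    { toFun := fun f i => ⟨f (l.get i), map_mem_wtSpace f (hμ i)⟩
      map_add' := fun _ _ => rfl
      map_smul' := fun _ _ => rfl }
  have := hM.2.2
  refine FiniteDimensional.of_injective ev fun f g h => ?_
  refine LinearMap.ext_on hs fun x hx => ?_
  obtain ⟨i, rfl⟩ := List.get_of_mem hx
  exact congrArg Subtype.val (congrFun h i)

theorem finrank_hom_isCompl [Module ℂ P] [IsScalarTower ℂ (Ug L) P] (hP : IsCategoryO b P)
    (hM : IsFin H M) {A B : Submodule (Ug L) P} (h : IsCompl A B) :
    finrank ℂ (P →ₗ[Ug L] M) = finrank ℂ (A →ₗ[Ug L] M) + finrank ℂ (B →ₗ[Ug L] M) := by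
  have := finiteDimensional_hom hP hM
  have hA : FiniteDimensional ℂ (A →ₗ[Ug L] M) := FiniteDimensional.of_injective
    (precomp M (A.projectionOnto B h)) (precomp_injective (Submodule.projectionOnto_surjective h))
  have hB : FiniteDimensional ℂ (B →ₗ[Ug L] M) := FiniteDimensional.of_injective
    (precomp M (B.projectionOnto A h.symm))
    (precomp_injective (Submodule.projectionOnto_surjective h.symm))
  rw [← Module.finrank_prod]
  refine LinearEquiv.finrank_eq (LinearEquiv.ofBijective
    ((precomp M A.subtype).prod (precomp M B.subtype)) ⟨fun f g hfg => ?_, fun fg => ?_⟩)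
  · have h₁ := (Prod.ext_iff.mp hfg).1
    have h₂ := (Prod.ext_iff.mp hfg).2
    refine LinearMap.ext fun x => ?_
    obtain ⟨y, hy, z, hz, rfl⟩ := Submodule.mem_sup.mp
      (h.codisjoint.eq_top ▸ Submodule.mem_top : x ∈ A ⊔ B)
    rw [map_add, map_add]
    exact congrArg₂ _ (LinearMap.congr_fun h₁ ⟨y, hy⟩) (LinearMap.congr_fun h₂ ⟨z, hz⟩)
  · refine ⟨fg.1 ∘ₗ A.projectionOnto B h + fg.2 ∘ₗ B.projectionOnto A h.symm, Prod.ext ?_ ?_⟩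
    · refine LinearMap.ext fun x => ?_
      simp [precomp]
    · refine LinearMap.ext fun x => ?_
      simp [precomp]

end Hom

/-! ### Projective objects, projective covers and multiplicities. -/

section Projective

variable {P : Type u} [AddCommGroup P] [Module ℂ P] [Module (Ug L) P] [IsScalarTower ℂ (Ug L) P]
  {M : Type u} [AddCommGroup M] [Module ℂ M] [Module (Ug L) M] [IsScalarTower ℂ (Ug L) M]
  {A : Type u} [AddCommGroup A] [Module ℂ A] [Module (Ug L) A] [IsScalarTower ℂ (Ug L) A]

theorem isNoetherian_of_catO (h : IsCategoryO b M) : IsNoetherian (Ug L) M := (isFin_of_catO h).1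

theorem catO_sub (h : IsCategoryO b M) (X : Submodule (Ug L) M) : IsCategoryO b X := by
  have := isNoetherian_of_catO h
  exact catO_submodule h X

theorem finrank_hom_add (hP : IsProjectiveO b P) (hM : IsCategoryO b M)
    (X : Submodule (Ug L) M) : finrank ℂ (P →ₗ[Ug L] M) =
      finrank ℂ (P →ₗ[Ug L] X) + finrank ℂ (P →ₗ[Ug L] M ⧸ X) := by
  have := finiteDimensional_hom hP.1 (isFin_of_catO hM)
  have hker : LinearMap.ker (postcomp P X.mkQ) = LinearMap.range (postcomp P X.subtype) := by
    ext f
    rw [LinearMap.mem_ker, LinearMap.mem_range]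
    constructor
    · intro h
      have h₁ : ∀ x, f x ∈ X := fun x => by
        have h₂ : X.mkQ (f x) = 0 := LinearMap.congr_fun h x
        rwa [Submodule.mkQ_apply, Submodule.Quotient.mk_eq_zero] at h₂
      exact ⟨f.codRestrict X h₁, rfl⟩
    · rintro ⟨g, rfl⟩
      refine LinearMap.ext fun x => ?_
      exact (Submodule.Quotient.mk_eq_zero _).mpr (g x).2
  have hsurj : LinearMap.range (postcomp P X.mkQ) = ⊤ := LinearMap.range_eq_top.mpr fun f =>
    hP.2 M (M ⧸ X) hM (catO_quotient hM X) X.mkQ f X.mkQ_surjective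
  rw [← LinearMap.finrank_range_add_finrank_ker (postcomp P X.mkQ), hker, hsurj, finrank_top,
    LinearMap.finrank_range_of_inj (postcomp_injective X.subtype_injective), add_comm]

theorem IsProjectiveO.retract (hP : IsProjectiveO b P) (i : A →ₗ[Ug L] P) (p : P →ₗ[Ug L] A)
    (hip : ∀ x, p (i x) = x) : IsProjectiveO b A := by
  refine ⟨catO_of_surjective hP.1 p (Function.RightInverse.surjective hip), ?_⟩
  intro M N _ _ _ _ hM hN g f hg
  obtain ⟨f', hf'⟩ := hP.2 M N hM hN g (f ∘ₗ p) hg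
  refine ⟨f' ∘ₗ i, LinearMap.ext fun x => ?_⟩
  have h := LinearMap.congr_fun hf' (i x)
  simp only [LinearMap.comp_apply, hip] at h
  exact h

theorem IsProjectiveO.of_isCompl (hP : IsProjectiveO b P) {A B : Submodule (Ug L) P}
    (h : IsCompl A B) : IsProjectiveO b A :=
  hP.retract A.subtype (A.projectionOnto B h) fun x => by simp

/-- Lifting one covering map through the other gives `f`, surjective because the kernel of `ρ` is
superfluous. Its section `g` is surjective because the kernel of `π` is, hence bijective. -/
theorem IsProjectiveCover.exists_equiv {lam : Dual ℂ H} (hP : IsProjectiveCover b lam P)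
    (hA : IsProjectiveCover b lam A) : Nonempty (P ≃ₗ[Ug L] A) := by
  obtain ⟨hP, π, hπ, hπs⟩ := hP
  obtain ⟨hA, ρ, hρ, hρs⟩ := hA
  obtain ⟨f, hf⟩ := hP.2 A (Irr b lam) hA.1 catO_irr ρ π hρ
  have hfs : Function.Surjective f := by
    rw [← LinearMap.range_eq_top]
    refine hρs _ (eq_top_iff.mpr fun x _ => ?_)
    obtain ⟨y, hy⟩ := hπ (ρ x)
    refine Submodule.mem_sup.mpr ⟨f y, ⟨y, rfl⟩, x - f y, ?_, add_sub_cancel _ _⟩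
    rw [LinearMap.mem_ker, map_sub, ← hy, sub_eq_zero]
    exact (LinearMap.congr_fun hf y).symm
  obtain ⟨g, hg⟩ := hA.2 P A hP.1 hA.1 f LinearMap.id hfs
  have hfg : ∀ x, f (g x) = x := LinearMap.congr_fun hg
  have hgs : Function.Surjective g := by
    rw [← LinearMap.range_eq_top]
    refine hπs _ (eq_top_iff.mpr fun x _ => ?_)
    refine Submodule.mem_sup.mpr ⟨g (f x), ⟨f x, rfl⟩, x - g (f x), ?_, add_sub_cancel _ _⟩
    rw [LinearMap.mem_ker, map_sub, sub_eq_zero, ← LinearMap.congr_fun hf x,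
      ← LinearMap.congr_fun hf (g (f x)), LinearMap.comp_apply, LinearMap.comp_apply, hfg]
  exact ⟨(LinearEquiv.ofBijective g ⟨Function.LeftInverse.injective hfg, hgs⟩).symm⟩

/-- The kernel of a nonzero map to a simple module is maximal; if it missed part of a superfluous
submodule, the two would sum to everything. -/
theorem ker_le_ker_of_superfluous {R V S T : Type*} [Ring R] [AddCommGroup V] [Module R V]
    [AddCommGroup S] [Module R S] [AddCommGroup T] [Module R T] [IsSimpleModule R T]
    {π : V →ₗ[R] S} (hπ : ∀ N : Submodule R V, N ⊔ LinearMap.ker π = ⊤ → N = ⊤) (f : V →ₗ[R] T) :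
    LinearMap.ker π ≤ LinearMap.ker f := by
  by_cases hf : f = 0
  · rw [hf, LinearMap.ker_zero]
    exact le_top
  have h₁ : IsCoatom (LinearMap.ker f) :=
    LinearMap.isCoatom_ker_of_surjective (LinearMap.surjective_of_ne_zero hf)
  by_contra h
  exact h₁.1 (hπ _ (h₁.2 _ (left_lt_sup.mpr h)))

variable {lam : Dual ℂ H}

theorem IsProjectiveCover.finrank_hom_irr (hP : IsProjectiveCover b lam P) :
    finrank ℂ (P →ₗ[Ug L] Irr b lam) = 1 := by
  obtain ⟨hP, π, hπ, hπs⟩ := hP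
  rw [finrank_eq_one_iff']
  refine ⟨π, ?_, fun f => ?_⟩
  · rintro rfl
    obtain ⟨x, hx⟩ := hπ (igen b lam)
    exact igen_ne_zero hx.symm
  · obtain ⟨g, rfl⟩ : ∃ g : Irr b lam →ₗ[Ug L] Irr b lam, g ∘ₗ π = f :=
      ⟨(LinearMap.ker π).liftQ f (ker_le_ker_of_superfluous hπs f) ∘ₗ
        (π.quotKerEquivOfSurjective hπ).symm.toLinearMap, LinearMap.ext fun x => by
          have : (π.quotKerEquivOfSurjective hπ).symm (π x) = (LinearMap.ker π).mkQ x := by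
            rw [LinearEquiv.symm_apply_eq]
            rfl
          simp [this]⟩
    obtain ⟨c, hc⟩ := mem_span_igen (map_mem_wtSpace g igen_mem)
    refine ⟨c, ?_⟩
    have h : g = c • LinearMap.id := Irr.hom_ext hc.symm
    rw [h]
    rfl

theorem IsProjectiveCover.nonempty_equiv_of_hom_ne_zero {S : Type*} [AddCommGroup S]
    [Module (Ug L) S] [IsSimpleModule (Ug L) S]
    (hP : IsProjectiveCover b lam P) {f : P →ₗ[Ug L] S} (hf : f ≠ 0) :
    Nonempty (S ≃ₗ[Ug L] Irr b lam) := by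
  obtain ⟨hP, π, hπ, hπs⟩ := hP
  have h₁ := LinearMap.isCoatom_ker_of_surjective (LinearMap.surjective_of_ne_zero hf)
  have h₂ : IsCoatom (LinearMap.ker π) := LinearMap.isCoatom_ker_of_surjective hπ
  have h₃ := (h₂.le_iff.mp (ker_le_ker_of_superfluous hπs f)).resolve_left h₁.1
  exact ⟨((f.quotKerEquivOfSurjective (LinearMap.surjective_of_ne_zero hf)).symm.trans
    (Submodule.quotEquivOfEq _ _ h₃)).trans (π.quotKerEquivOfSurjective hπ)⟩

open Classical in
theorem IsProjectiveCover.finrank_hom_simple {S : Type*} [AddCommGroup S] [Module ℂ S]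
    [Module (Ug L) S] [IsScalarTower ℂ (Ug L) S] [IsSimpleModule (Ug L) S]
    (hP : IsProjectiveCover b lam P) : finrank ℂ (P →ₗ[Ug L] S) =
      if Nonempty (S ≃ₗ[Ug L] Irr b lam) then 1 else 0 := by
  split_ifs with h
  · obtain ⟨e⟩ := h
    rw [finrank_hom_congr_right e, hP.finrank_hom_irr]
  · have : Subsingleton (P →ₗ[Ug L] S) := subsingleton_of_forall_eq 0 fun f => by
      by_contra hf
      exact h (hP.nonempty_equiv_of_hom_ne_zero hf)
    exact finrank_zero_of_subsingleton

theorem fin_telescope {n : ℕ} (d : Fin (n + 1) → ℕ) (g : Fin n → ℕ)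
    (h : ∀ i : Fin n, d i.succ = d i.castSucc + g i) : d (Fin.last n) = d 0 + ∑ i, g i := by
  induction n with
  | zero => simp
  | succ n ih =>
    rw [Fin.sum_univ_castSucc, ← Fin.succ_last, h, ← add_assoc]
    exact congrArg (· + g (Fin.last n)) (ih (fun i => d i.castSucc) (fun i => g i.castSucc)
      fun i => h i.castSucc)

/-- Homomorphisms from a projective cover count Jordan-Hölder multiplicities. -/
theorem IsProjectiveCover.finrank_hom (hP : IsProjectiveCover b lam P) (hM : IsCategoryO b M) :
    finrank ℂ (P →ₗ[Ug L] M) = jhMult (Ug L) M (Irr b lam) := by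
  classical
  have hfin := isFin_of_catO hM
  obtain ⟨s, h₀, h₁⟩ := isFiniteLength_iff_exists_compositionSeries.mp
    (isFiniteLength_iff_isNoetherian_isArtinian.mpr ⟨hfin.1, hfin.2.1⟩)
  rw [jhMult_eq s h₀ h₁, factorCount, Nat.card_eq_fintype_card, Fintype.card_subtype,
    Finset.card_filter]
  -- By exactness of Hom(P, -), each composition factor contributes one or zero according to whether
  -- it is `Irr b lam`.
  have hstep : ∀ i : Fin s.length, finrank ℂ (P →ₗ[Ug L] ↥(s i.succ)) =
      finrank ℂ (P →ₗ[Ug L] ↥(s i.castSucc)) +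
        if Nonempty (Subquotient (s i.castSucc) (s i.succ) ≃ₗ[Ug L] Irr b lam) then 1 else 0 := by
    intro i
    have hcov : s i.castSucc ⋖ s i.succ := s.step i
    have hle : s i.castSucc ≤ s i.succ := hcov.le
    have hsimple : IsSimpleModule (Ug L) (Subquotient (s i.castSucc) (s i.succ)) :=
      (covBy_iff_quot_is_simple hle).mp hcov
    rw [finrank_hom_add hP.1 (catO_sub hM (s i.succ)) ((s i.castSucc).submoduleOf (s i.succ)),
      finrank_hom_congr_right (Submodule.submoduleOfEquivOfLe hle),
      hP.finrank_hom_simple (S := Subquotient (s i.castSucc) (s i.succ))]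
  have h := fin_telescope (fun i => finrank ℂ (P →ₗ[Ug L] ↥(s i))) _ hstep
  have hbot : finrank ℂ (P →ₗ[Ug L] ↥(s 0)) = 0 := by
    have h₂ : s 0 = ⊥ := h₀
    have : Subsingleton ↥(s 0) := by rw [h₂]; infer_instance
    exact finrank_zero_of_subsingleton
  have htop : finrank ℂ (P →ₗ[Ug L] ↥(s (Fin.last _))) = finrank ℂ (P →ₗ[Ug L] M) := by
    have h₂ : s (Fin.last _) = ⊤ := h₁
    exact finrank_hom_congr_right ((LinearEquiv.ofEq _ _ h₂).trans Submodule.topEquiv)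
  rw [hbot, zero_add, htop] at h
  exact h

end Projective

end CatO
end

set_option linter.unusedSectionVars false

noncomputable section

namespace CatO

variable {L : Type u} [LieRing L] [LieAlgebra ℂ L] [FiniteDimensional ℂ L] [IsSemisimple ℂ L]
  {H : LieSubalgebra ℂ L} [H.IsCartanSubalgebra] {b : (rootSystem H).Base}

variable {M : Type v} [AddCommGroup M] [Module ℂ M] [Module (Ug L) M] [IsScalarTower ℂ (Ug L) M]
  {N : Type w} [AddCommGroup N] [Module ℂ N] [Module (Ug L) N] [IsScalarTower ℂ (Ug L) N]

/-! ### The Casimir element as a module endomorphism. -/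

section CasEnd

variable (b M) in
/-- The action of the Casimir element minus a scalar. -/
def casEnd (c : ℂ) : Module.End (Ug L) M where
  toFun x := casimir b • x - c • x
  map_add' x y := by rw [smul_add, smul_add]; abel
  map_smul' y x := by
    rw [← mul_smul, casimir_central, mul_smul, RingHom.id_apply, smul_sub, smul_algebra_smul_comm]

theorem casEnd_apply (c : ℂ) (x : M) : casEnd b M c x = casimir b • x - c • x := rfl

theorem map_casEnd_pow (f : M →ₗ[Ug L] N) (c : ℂ) (k : ℕ) (x : M) :
    f ((casEnd b M c ^ k) x) = (casEnd b N c ^ k) (f x) := by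
  induction k generalizing x with
  | zero => rfl
  | succ k ih =>
    have h : f (casEnd b M c x) = casEnd b N c (f x) := by
      rw [casEnd_apply, casEnd_apply, map_sub, map_smul]
      exact congrArg _ ((f.restrictScalars ℂ).map_smul c x)
    rw [pow_succ, pow_succ, Module.End.mul_apply, Module.End.mul_apply, ih, h]

theorem casEnd_pow_apply {c d : ℂ} {x : M} (hx : casimir b • x = d • x) (k : ℕ) :
    (casEnd b M c ^ k) x = (d - c) ^ k • x := by
  induction k with
  | zero => simp
  | succ k ih =>
    have h : casEnd b M c x = (d - c) • x := by rw [casEnd_apply, hx, sub_smul]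
    rw [pow_succ, Module.End.mul_apply, h]
    have h₂ := ((casEnd b M c ^ k).restrictScalars ℂ).map_smul (d - c) x
    rw [LinearMap.restrictScalars_apply] at h₂
    rw [h₂, LinearMap.restrictScalars_apply, ih, smul_smul, pow_succ']

theorem eq_of_casEnd_pow_eq_zero {c d : ℂ} {x : M} (hx : casimir b • x = d • x) (hx₀ : x ≠ 0)
    {k : ℕ} (h : (casEnd b M c ^ k) x = 0) : d = c := by
  rw [casEnd_pow_apply hx] at h
  exact sub_eq_zero.mp (eq_zero_of_pow_eq_zero ((smul_eq_zero.mp h).resolve_right hx₀))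

end CasEnd

/-! ### A projective object with computable Verma multiplicities. -/

section Block

variable (b) (lam : Dual ℂ H)

theorem exists_blockBound : ∃ n : ℕ, ∀ β ∈ Qpos b, casScalar b (lam + β) = casScalar b lam →
    hgt b β < n := by
  obtain ⟨C, hC⟩ := ((finite_casScalar_add (b := b) lam (casScalar b lam)).image (hgt b)).bddAbove
  obtain ⟨n, hn⟩ := exists_nat_gt C
  exact ⟨n, fun β hβ h => (hC ⟨β, ⟨hβ, h⟩, rfl⟩).trans_lt hn⟩

/-- A bound for the heights of the `β` such that `lam + β` has the same central character on the
Casimir element as `lam`. -/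
def blockBound : ℕ := (exists_blockBound b lam).choose

/-- The exponents of large height. -/
def blockSet : Set (Multiset (Pos b)) := {d | blockBound b lam ≤ htm d}

variable {b lam} in
theorem htm_lt_blockBound {d : Multiset (Pos b)}
    (h : casScalar b (lam + wtm d) = casScalar b lam) : htm d < blockBound b lam := by
  have h₁ := (exists_blockBound b lam).choose_spec _ (wtm_mem_Qpos d) h
  rw [hgt_wtm] at h₁
  exact_mod_cast h₁

theorem upClosed_blockSet : UpClosed (blockSet b lam) := upClosed_le_htm _

theorem finite_compl_blockSet : ((blockSet b lam)ᶜ).Finite := finite_compl_le_htm _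

/-- The truncation of `WMod lam` above the block of `lam`. -/
abbrev BQ : Type u := QMod lam (blockSet b lam)

theorem catO_BQ : IsCategoryO b (BQ b lam) := catO_QMod (finite_compl_blockSet b lam)

/-- Fitting's lemma, for all large exponents, so that one exponent can serve several modules in
`exists_lift_BP`. -/
theorem exists_isCompl_casEnd (hM : IsFin H M) (c : ℂ) : ∃ K : ℕ, ∀ k, K ≤ k →
    IsCompl (LinearMap.ker (casEnd b M c ^ k)) (LinearMap.range (casEnd b M c ^ k)) := by
  obtain ⟨_, _, -⟩ := hM
  exact Filter.eventually_atTop.mp (LinearMap.eventually_isCompl_ker_pow_range_pow _)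

theorem exists_blockExp : ∃ k : ℕ, 0 < k ∧
    IsCompl (LinearMap.ker (casEnd b (BQ b lam) (casScalar b lam) ^ k))
      (LinearMap.range (casEnd b (BQ b lam) (casScalar b lam) ^ k)) := by
  obtain ⟨K, hK⟩ := exists_isCompl_casEnd b (isFin_of_catO (catO_BQ b lam)) (casScalar b lam)
  exact ⟨K + 1, K.succ_pos, hK _ K.le_succ⟩

/-- The exponent of the Fitting decomposition of `BQ b lam`. -/
def blockExp : ℕ := (exists_blockExp b lam).choose

theorem blockExp_pos : 0 < blockExp b lam := (exists_blockExp b lam).choose_spec.1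

/-- The generalized eigenspace of the Casimir element in `BQ b lam`. -/
def BP : Submodule (Ug L) (BQ b lam) :=
  LinearMap.ker (casEnd b (BQ b lam) (casScalar b lam) ^ blockExp b lam)

/-- The complement of `BP b lam`. -/
def BR : Submodule (Ug L) (BQ b lam) :=
  LinearMap.range (casEnd b (BQ b lam) (casScalar b lam) ^ blockExp b lam)

theorem isCompl_BP_BR : IsCompl (BP b lam) (BR b lam) := (exists_blockExp b lam).choose_spec.2

/-- The projection onto `BP b lam`. -/
def bproj : BQ b lam →ₗ[Ug L] BP b lam := (BP b lam).projectionOnto (BR b lam) (isCompl_BP_BR b lam)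

/-- The generator of `BP b lam`. -/
def bgen : BP b lam := bproj b lam (qgen lam (blockSet b lam))

variable {b lam}

theorem bproj_surjective : Function.Surjective (bproj b lam) :=
  Submodule.projectionOnto_surjective (isCompl_BP_BR b lam)

theorem bproj_coe (x : BP b lam) : bproj b lam x = x :=
  Submodule.projectionOnto_apply_left (isCompl_BP_BR b lam) x

theorem bgen_mem : bgen b lam ∈ wtSpace (BP b lam) lam := map_mem_wtSpace _ qgen_mem

theorem catO_BP : IsCategoryO b (BP b lam) := catO_sub (catO_BQ b lam) _

theorem casEnd_pow_BP (x : BP b lam) :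
    (casEnd b (BP b lam) (casScalar b lam) ^ blockExp b lam) x = 0 := by
  refine Subtype.ext ?_
  have h := map_casEnd_pow (b := b) (BP b lam).subtype (casScalar b lam) (blockExp b lam) x
  exact h.trans x.2

theorem BP.hom_ext {X : Type w} [AddCommGroup X] [Module (Ug L) X] {f g : BP b lam →ₗ[Ug L] X}
    (h : f (bgen b lam) = g (bgen b lam)) : f = g := by
  have h₁ : f ∘ₗ bproj b lam = g ∘ₗ bproj b lam := QMod.hom_ext h
  refine LinearMap.ext fun x => ?_
  obtain ⟨y, rfl⟩ := bproj_surjective x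
  exact LinearMap.congr_fun h₁ y

/-- A nonzero `Em d • x` would generate a submodule with a highest weight vector of weight `lam +
wtm (d + e)`. That vector is a generalized Casimir eigenvector for the scalar of `lam`, so its
weight has this scalar, contrary to the choice of `blockBound`. -/
theorem Em_smul_eq_zero_of_block (hB : IsBdd b M) {x : M} (hx : x ∈ wtSpace M lam)
    {k : ℕ} (hk : (casEnd b M (casScalar b lam) ^ k) x = 0) {d : Multiset (Pos b)}
    (hd : d ∈ blockSet b lam) : Em d • x = 0 := by
  by_contra hne
  let Z : Submodule (Ug L) M := Submodule.span (Ug L) {Em d • x}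
  have hZker : Z ≤ LinearMap.ker (casEnd b M (casScalar b lam) ^ k) := by
    rw [Submodule.span_singleton_le_iff_mem, LinearMap.mem_ker, map_smul, hk, smul_zero]
  have hz₀ : wtSpace Z (wtm d + lam) ≠ ⊥ := (Submodule.ne_bot_iff _).mpr
    ⟨⟨_, Submodule.mem_span_singleton_self _⟩, fun h => Subtype.ext (Em_smul_mem d hx h),
      fun h => hne (congrArg Subtype.val h)⟩
  obtain ⟨β, hβ, hmax⟩ := (hB.submodule Z).exists_isMaxWt hz₀
  obtain ⟨z, hz, hz'⟩ := (Submodule.ne_bot_iff _).mp hmax.1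
  have h₁ : casimir b • z = casScalar b (wtm d + lam + β) • z :=
    casimir_smul hz (hmax.posVec_smul hz)
  have h₂ : (casEnd b Z (casScalar b lam) ^ k) z = 0 :=
    Subtype.ext ((map_casEnd_pow Z.subtype _ k z).trans (hZker z.2))
  have h₃ := eq_of_casEnd_pow_eq_zero h₁ hz' h₂
  obtain ⟨e, rfl⟩ := exists_wtm_eq hβ
  have h₄ : wtm d + lam + wtm e = lam + wtm (d + e) := by rw [wtm_add]; abel
  rw [h₄] at h₃
  have h₅ := htm_lt_blockBound h₃
  have h₆ : htm (d + e) = htm d + htm e := by simp [htm]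
  have h₇ : blockBound b lam ≤ htm d := hd
  omega

theorem exists_hom_BQ (hM : IsCategoryO b M) {x : M} (hx : x ∈ wtSpace M lam) {k : ℕ}
    (hk : (casEnd b M (casScalar b lam) ^ k) x = 0) :
    ∃ f : BQ b lam →ₗ[Ug L] M, f (qgen lam (blockSet b lam)) = x := by
  rw [isCategoryO_iff] at hM
  exact QMod.exists_lift hx fun d hd => Em_smul_eq_zero_of_block hM.2.2 hx hk hd

/-- Lift the image of the generator to a weight vector `m` and keep its Fitting component `p m`. The
discarded part maps into both Fitting summands of `N`, hence to zero, and `p m` extends to a map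
from `BQ`. -/
theorem exists_lift_BP {M N : Type u} [AddCommGroup M] [Module ℂ M] [Module (Ug L) M]
    [IsScalarTower ℂ (Ug L) M] [AddCommGroup N] [Module ℂ N] [Module (Ug L) N]
    [IsScalarTower ℂ (Ug L) N] (hM : IsCategoryO b M) (hN : IsCategoryO b N) (g : M →ₗ[Ug L] N)
    (f : BP b lam →ₗ[Ug L] N) (hg : Function.Surjective g) : ∃ f' : BP b lam →ₗ[Ug L] M, g ∘ₗ f' = f := by
  obtain ⟨K₁, hK₁⟩ := exists_isCompl_casEnd b (isFin_of_catO hM) (casScalar b lam)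
  obtain ⟨K₂, hK₂⟩ := exists_isCompl_casEnd b (isFin_of_catO hN) (casScalar b lam)
  set K := max (max K₁ K₂) (blockExp b lam) with hK
  have h₁ := hK₁ K (by omega)
  have h₂ := hK₂ K (by omega)
  obtain ⟨⟨m, hm⟩, hm'⟩ := wtMap_surjective (isCategoryO_iff.mp hM).2.1 g hg lam
    ⟨f (bgen b lam), map_mem_wtSpace f bgen_mem⟩
  have hm'' : g m = f (bgen b lam) := congrArg Subtype.val hm'
  have hfb : (casEnd b N (casScalar b lam) ^ K) (f (bgen b lam)) = 0 := by
    rw [← map_casEnd_pow, ← Nat.sub_add_cancel (show blockExp b lam ≤ K by omega), pow_add,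
      Module.End.mul_apply, casEnd_pow_BP, map_zero, map_zero]
  let p := (LinearMap.ker (casEnd b M (casScalar b lam) ^ K)).projectionOnto _ h₁
  have hgp : g (p m) = f (bgen b lam) := by
    have h₃ : m - p m ∈ LinearMap.range (casEnd b M (casScalar b lam) ^ K) := by
      rw [← Submodule.ker_projectionOnto h₁, LinearMap.mem_ker, map_sub,
        Submodule.projectionOnto_apply_left, sub_self]
    obtain ⟨y, hy⟩ := h₃
    have h₄ : g (m - p m) ∈ LinearMap.range (casEnd b N (casScalar b lam) ^ K) :=
      ⟨g y, by rw [← map_casEnd_pow, hy]⟩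
    have h₅ : g (m - p m) ∈ LinearMap.ker (casEnd b N (casScalar b lam) ^ K) := by
      rw [map_sub, hm'', LinearMap.mem_ker, map_sub, hfb, ← map_casEnd_pow]
      have h₆ : (casEnd b M (casScalar b lam) ^ K) (p m) = 0 := (p m).2
      rw [h₆, map_zero, sub_zero]
    have h₇ := Submodule.disjoint_def.mp h₂.disjoint _ h₅ h₄
    rw [map_sub, sub_eq_zero] at h₇
    rw [← h₇, hm'']
  have hpm : (p m : M) ∈ wtSpace M lam :=
    map_mem_wtSpace ((LinearMap.ker (casEnd b M (casScalar b lam) ^ K)).subtype ∘ₗ p) hm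
  obtain ⟨h, hh⟩ := exists_hom_BQ hM hpm (k := K) (p m).2
  have hgh : g ∘ₗ h = f ∘ₗ bproj b lam := QMod.hom_ext (by
    rw [LinearMap.comp_apply, hh, hgp]
    rfl)
  refine ⟨h ∘ₗ (BP b lam).subtype, LinearMap.ext fun x => ?_⟩
  have h₈ := LinearMap.congr_fun hgh x
  simp only [LinearMap.comp_apply, bproj_coe] at h₈
  exact h₈

/-- Projectivity tests against modules without a given complex structure; restriction of scalars
supplies one. -/
theorem compHom_isScalarTower (M : Type v) [AddCommGroup M] [Module (Ug L) M] :
    letI : Module ℂ M := Module.compHom M (algebraMap ℂ (Ug L))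
    IsScalarTower ℂ (Ug L) M :=
  letI : Module ℂ M := Module.compHom M (algebraMap ℂ (Ug L))
  ⟨fun c y x => by
    rw [Algebra.smul_def, mul_smul]
    rfl⟩

theorem isProjectiveO_BP : IsProjectiveO b (BP b lam) := by
  refine ⟨catO_BP, ?_⟩
  intro M N _ _ _ _ hM hN g f hg
  let _ : Module ℂ M := Module.compHom M (algebraMap ℂ (Ug L))
  have := compHom_isScalarTower (L := L) M
  let _ : Module ℂ N := Module.compHom N (algebraMap ℂ (Ug L))
  have := compHom_isScalarTower (L := L) N
  exact exists_lift_BP hM hN g f hg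

/-- Evaluation at the generator is bijective: every weight-`lam` vector is an eigenvector for the
right scalar and so is the image of the generator under a map from `BQ`. -/
theorem finrank_hom_BP (hM : IsCategoryO b M)
    (hc : ∀ x : M, casimir b • x = casScalar b lam • x) :
    finrank ℂ (BP b lam →ₗ[Ug L] M) = finrank ℂ (wtSpace M lam) := by
  have h₀ : ∀ x : M, (casEnd b M (casScalar b lam) ^ blockExp b lam) x = 0 := fun x => by
    rw [casEnd_pow_apply (hc x), sub_self, zero_pow (blockExp_pos b lam).ne', zero_smul]
  let ev : (BP b lam →ₗ[Ug L] M) →ₗ[ℂ] wtSpace M lam :=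
    { toFun := fun f => ⟨f (bgen b lam), map_mem_wtSpace f bgen_mem⟩
      map_add' := fun _ _ => rfl
      map_smul' := fun _ _ => rfl }
  refine LinearEquiv.finrank_eq (LinearEquiv.ofBijective ev ⟨fun f g h =>
    BP.hom_ext (congrArg Subtype.val h), fun x => ?_⟩)
  obtain ⟨h, hh⟩ := exists_hom_BQ hM x.2 (h₀ x)
  refine ⟨h ∘ₗ (BP b lam).subtype, Subtype.ext ?_⟩
  set q := qgen lam (blockSet b lam)
  show h (bproj b lam q) = x
  rw [← hh, ← sub_eq_zero, ← map_sub]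
  -- The part of the generator outside `BP` is in the range of a power of Casimir minus scalar,
  -- which is zero on `M`.
  have h₃ : (bproj b lam q : BQ b lam) - q ∈ BR b lam := by
    rw [← Submodule.ker_projectionOnto (isCompl_BP_BR b lam), LinearMap.mem_ker, map_sub]
    exact sub_eq_zero.mpr (bproj_coe _)
  obtain ⟨y, hy⟩ := h₃
  rw [← hy, map_casEnd_pow, h₀]

theorem hom_BP_eq_zero {d : ℂ} (hd : d ≠ casScalar b lam) (hc : ∀ x : M, casimir b • x = d • x)
    (f : BP b lam →ₗ[Ug L] M) : f = 0 := by
  refine LinearMap.ext fun x => ?_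
  by_contra h
  refine hd (eq_of_casEnd_pow_eq_zero (hc (f x)) h (k := blockExp b lam) ?_)
  rw [← map_casEnd_pow, casEnd_pow_BP, map_zero]

theorem StdF.casScalar_eq {l : List (Dual ℂ H)} (h : StdF b l M) {c : ℂ} {k : ℕ}
    (hc : ∀ x : M, (casEnd b M c ^ k) x = 0) : ∀ μ ∈ l, casScalar b μ = c := by
  induction l generalizing M with
  | nil => simp
  | cons μ l ih =>
    obtain ⟨X, ⟨e⟩, hX⟩ := h
    rw [List.forall_mem_cons]
    refine ⟨?_, ih hX fun x => ?_⟩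
    · refine eq_of_casEnd_pow_eq_zero (casimir_smul_verma (vgen b μ)) vgen_ne_zero (k := k) ?_
      obtain ⟨y, hy⟩ := e.surjective (vgen b μ)
      have h₁ : (casEnd b X c ^ k) y = 0 :=
        Subtype.ext ((map_casEnd_pow X.subtype c k y).trans (hc _))
      rw [← hy]
      exact (map_casEnd_pow (b := b) e.toLinearMap c k y).symm.trans (by rw [h₁, map_zero])
    · obtain ⟨y, rfl⟩ := X.mkQ_surjective x
      rw [← map_casEnd_pow, hc, map_zero]

/-- By Noetherianity Casimir minus `c` is also injective, so the bottom Verma module has another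
scalar; surjectivity passes to the quotient. -/
theorem StdF.casScalar_ne {l : List (Dual ℂ H)} (h : StdF b l M) {c : ℂ}
    (hc : Function.Surjective (casEnd b M c)) : ∀ μ ∈ l, casScalar b μ ≠ c := by
  induction l generalizing M with
  | nil => simp
  | cons μ l ih =>
    have : IsNoetherian (Ug L) M := h.isFin.1
    have hinj := IsNoetherian.injective_of_surjective_endomorphism _ hc
    obtain ⟨X, ⟨e⟩, hX⟩ := h
    rw [List.forall_mem_cons]
    refine ⟨?_, ih hX fun x => ?_⟩
    · rintro rfl
      obtain ⟨y, hy⟩ := e.surjective (vgen b μ)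
      have h₁ : casEnd b X (casScalar b μ) y = 0 := by
        refine e.injective ?_
        have h₂ := map_casEnd_pow (b := b) e.toLinearMap (casScalar b μ) 1 y
        rw [pow_one, pow_one] at h₂
        rw [map_zero]
        refine h₂.trans ?_
        rw [casEnd_apply, casimir_smul_verma, sub_self]
      have h₃ : casEnd b M (casScalar b μ) y = 0 := congrArg Subtype.val h₁
      have h₄ : (y : M) = 0 := hinj (h₃.trans (map_zero _).symm)
      have h₅ : y = 0 := Subtype.ext h₄
      rw [h₅, map_zero] at hy
      exact vgen_ne_zero hy.symm
    · obtain ⟨y, rfl⟩ := X.mkQ_surjective x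
      obtain ⟨z, rfl⟩ := hc y
      refine ⟨X.mkQ z, ?_⟩
      have h₂ := map_casEnd_pow (b := b) X.mkQ c 1 z
      rw [pow_one, pow_one] at h₂
      exact h₂.symm

theorem casEnd_BR_surjective : Function.Surjective (casEnd b (BR b lam) (casScalar b lam)) := by
  obtain ⟨hN, hA, -⟩ := isFin_of_catO (catO_sub (catO_BQ b lam) (BR b lam))
  refine IsArtinian.surjective_of_injective_endomorphism _ ?_
  rw [injective_iff_map_eq_zero]
  intro x hx
  refine Subtype.ext (Submodule.disjoint_def.mp (isCompl_BP_BR b lam).disjoint _ ?_ x.2)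
  have h₁ : (casEnd b (BR b lam) (casScalar b lam) ^ blockExp b lam) x = 0 := by
    obtain ⟨k, hk⟩ := Nat.exists_eq_succ_of_ne_zero (blockExp_pos b lam).ne'
    rw [hk, Nat.succ_eq_add_one, pow_succ, Module.End.mul_apply, hx, map_zero]
  have h₂ := map_casEnd_pow (b := b) (BR b lam).subtype (casScalar b lam) (blockExp b lam) x
  rw [h₁, map_zero] at h₂
  exact h₂.symm

/-- The truncation discards no exponent leading to a weight with the Casimir scalar of `lam`, so for
those weights the full partition function appears. -/
theorem exists_stdF_BQ [DecidableEq (Dual ℂ H)] : ∃ l : List (Dual ℂ H), StdF b l (BQ b lam) ∧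
    ∀ μ : Dual ℂ H, casScalar b μ = casScalar b lam → l.count μ = pfun b (μ - lam) := by
  obtain ⟨l, hl, hl'⟩ := stdF_QMod (μ := lam) (upClosed_blockSet b lam) (finite_compl_blockSet b lam)
  refine ⟨l, hl, fun μ hμ => ?_⟩
  rw [← Multiset.coe_count, hl', Multiset.count_map, pfun]
  refine (Nat.subtype_card ((finite_compl_blockSet b lam).toFinset.filter
    fun d => μ = wtm d + lam) fun d => ?_).symm
  rw [Finset.mem_filter, Set.Finite.mem_toFinset, Set.mem_compl_iff]
  constructor
  · rintro ⟨-, rfl⟩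
    rw [add_sub_cancel_right]
  · intro h
    refine ⟨fun hd => ?_, by rw [h, sub_add_cancel]⟩
    have h₁ : casScalar b (lam + wtm d) = casScalar b lam := by rw [h, add_sub_cancel, hμ]
    exact absurd (htm_lt_blockBound h₁) (not_lt.mpr hd)

theorem exists_stdF_isCompl {X : Type v} [AddCommGroup X] [Module ℂ X] [Module (Ug L) X]
    [IsScalarTower ℂ (Ug L) X] {l : List (Dual ℂ H)} (h : StdF b l X) (hX : IsCategoryO b X)
    {A B : Submodule (Ug L) X} (hAB : IsCompl A B) :
    ∃ l₁ l₂, StdF b l₁ A ∧ StdF b l₂ B ∧ (l₁ ++ l₂).Perm l := by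
  obtain ⟨-, hW, hB⟩ := isCategoryO_iff.mp hX
  obtain ⟨l₁, h₁⟩ := h.retract hW hB A.subtype (A.projectionOnto B hAB) fun x => by simp
  obtain ⟨l₂, h₂⟩ := h.retract hW hB B.subtype (B.projectionOnto A hAB.symm) fun x => by simp
  exact ⟨l₁, l₂, h₁, h₂, (h₁.append
    (h₂.congr (Submodule.quotientEquivOfIsCompl A B hAB).symm)).perm h hW hB⟩

theorem exists_stdF_BP : ∃ l : List (Dual ℂ H), StdF b l (BP b lam) := by
  classical
  obtain ⟨l, hl, -⟩ := exists_stdF_BQ (b := b) (lam := lam)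
  obtain ⟨l₁, -, h₁, -⟩ := exists_stdF_isCompl hl (catO_BQ b lam) (isCompl_BP_BR b lam)
  exact ⟨l₁, h₁⟩

/-- When the Casimir scalars agree, both sides are `pfun b (μ - lam)`: the left because `BR`
contributes no such factor, the right as the dimension of a weight space of the Verma module.
Otherwise both vanish. -/
theorem count_stdF_BP [DecidableEq (Dual ℂ H)] {l : List (Dual ℂ H)} (h : StdF b l (BP b lam))
    (μ : Dual ℂ H) : l.count μ = finrank ℂ (BP b lam →ₗ[Ug L] Verma b μ) := by
  by_cases hμ : casScalar b μ = casScalar b lam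
  · rw [finrank_hom_BP catO_verma (fun x => hμ ▸ casimir_smul_verma x), finrank_wtSpace_verma]
    obtain ⟨lQ, hlQ, hcount⟩ := exists_stdF_BQ (b := b) (lam := lam)
    obtain ⟨l₁, l₂, h₁, h₂, hp⟩ := exists_stdF_isCompl hlQ (catO_BQ b lam) (isCompl_BP_BR b lam)
    obtain ⟨-, hW, hB⟩ := isCategoryO_iff.mp (catO_BP (b := b) (lam := lam))
    rw [← hcount μ hμ, (h.perm h₁ hW hB).count_eq, ← hp.count_eq, List.count_append,
      List.count_eq_zero_of_not_mem (l := l₂) fun hmem =>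
        h₂.casScalar_ne casEnd_BR_surjective μ hmem hμ, add_zero]
  · have : Subsingleton (BP b lam →ₗ[Ug L] Verma b μ) :=
      subsingleton_of_forall_eq 0 (hom_BP_eq_zero hμ casimir_smul_verma)
    rw [finrank_zero_of_subsingleton]
    exact List.count_eq_zero_of_not_mem fun hmem => hμ (h.casScalar_eq casEnd_pow_BP μ hmem)

end Block

end CatO
end

set_option linter.unusedSectionVars false

noncomputable section

namespace CatO

variable {L : Type u} [LieRing L] [LieAlgebra ℂ L] [FiniteDimensional ℂ L] [IsSemisimple ℂ L]
  {H : LieSubalgebra ℂ L} [H.IsCartanSubalgebra] {b : (rootSystem H).Base}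

variable {X : Type u} [AddCommGroup X] [Module ℂ X] [Module (Ug L) X] [IsScalarTower ℂ (Ug L) X]
  {P : Type u} [AddCommGroup P] [Module ℂ P] [Module (Ug L) P] [IsScalarTower ℂ (Ug L) P]

/-! ### Existence of projective covers. -/

section Covers

/-- A minimal direct summand `A` on which `π` is nonzero is a cover. If `Y` and the kernel span `A`,
lifting `π` through `Y` gives an endomorphism `ψ` of `A` with image in `Y` and `π ∘ ψ = π`. The
Fitting summand given by the range of a power of `ψ` is not killed by `π`, so it is `A` by
minimality, and `Y = A`. -/
theorem exists_cover_summand (hX : IsProjectiveO b X) {ν : Dual ℂ H} {π : X →ₗ[Ug L] Irr b ν}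
    (hπ : π ≠ 0) : ∃ A B : Submodule (Ug L) X, IsCompl A B ∧ IsProjectiveCover b ν A := by
  obtain ⟨hN, hA, -⟩ := isFin_of_catO hX.1
  obtain ⟨A, ⟨⟨p, hp⟩, hAπ⟩, hmin⟩ := (wellFounded_lt (α := Submodule (Ug L) X)).has_min
    {A | (∃ p : X →ₗ[Ug L] A, ∀ a : A, p a = a) ∧ ¬ A ≤ LinearMap.ker π}
    ⟨⊤, ⟨LinearMap.codRestrict ⊤ LinearMap.id fun _ => trivial, fun a => rfl⟩, fun h =>
      hπ (LinearMap.ext fun x => h (Submodule.mem_top (x := x)))⟩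
  have hproj : IsProjectiveO b A := hX.retract A.subtype p hp
  refine ⟨A, LinearMap.ker p, LinearMap.isCompl_of_proj hp, hproj, π ∘ₗ A.subtype, ?_, ?_⟩
  · refine LinearMap.surjective_of_ne_zero fun h => hAπ fun a ha => ?_
    exact LinearMap.congr_fun h ⟨a, ha⟩
  intro Y hY
  have hsurj : Function.Surjective ((π ∘ₗ A.subtype) ∘ₗ Y.subtype) := by
    refine LinearMap.surjective_of_ne_zero fun h => hAπ fun a ha => ?_
    obtain ⟨y, hy, z, hz, hyz⟩ := Submodule.mem_sup.mp
      (hY ▸ Submodule.mem_top : (⟨a, ha⟩ : A) ∈ Y ⊔ LinearMap.ker (π ∘ₗ A.subtype))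
    have h₁ : (π ∘ₗ A.subtype) ⟨a, ha⟩ = 0 := by
      rw [← hyz, map_add, LinearMap.mem_ker.mp hz, add_zero]
      exact LinearMap.congr_fun h ⟨y, hy⟩
    exact h₁
  obtain ⟨φ, hφ⟩ := hproj.2 Y (Irr b ν) (catO_sub hproj.1 Y) catO_irr _ (π ∘ₗ A.subtype) hsurj
  let ψ : Module.End (Ug L) A := Y.subtype ∘ₗ φ
  have hψ : ∀ (k : ℕ) (a : A), π ((ψ ^ k) a : A) = π a := by
    intro k
    induction k with
    | zero => exact fun a => rfl
    | succ k ih =>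
      intro a
      rw [pow_succ, Module.End.mul_apply, ih]
      exact LinearMap.congr_fun hφ a
  obtain ⟨K, hK⟩ := Filter.eventually_atTop.mp (LinearMap.eventually_isCompl_ker_pow_range_pow ψ)
  have hc := (hK (K + 1) K.le_succ).symm
  set R := LinearMap.range (ψ ^ (K + 1)) with hR
  have hR' : R.map A.subtype = A := by
    refine (Submodule.map_subtype_le A R).eq_of_not_lt (hmin _ ⟨⟨(Submodule.equivSubtypeMap A R).toLinearMap ∘ₗ
      R.projectionOnto _ hc ∘ₗ p, ?_⟩, ?_⟩)
    · rintro ⟨_, ⟨a, ha, rfl⟩⟩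
      refine Subtype.ext ?_
      have h₁ : p (A.subtype a) = a := hp a
      simp only [LinearMap.comp_apply, h₁]
      rw [show a = ((⟨a, ha⟩ : R) : A) from rfl, Submodule.projectionOnto_apply_left]
      rfl
    · intro h
      refine hAπ fun a ha => ?_
      have h₁ := hψ (K + 1) ⟨a, ha⟩
      rw [LinearMap.mem_ker, ← h₁]
      exact h (Submodule.mem_map_of_mem ⟨_, rfl⟩)
  rw [eq_top_iff]
  intro a _
  obtain ⟨r, hr, hra⟩ := (hR'.symm ▸ a.2 : (a : X) ∈ R.map A.subtype)
  obtain ⟨y, rfl⟩ := hr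
  have h₂ : (ψ ^ (K + 1)) y = a := Subtype.ext hra
  rw [← h₂, pow_succ', Module.End.mul_apply]
  exact (φ _).2

theorem exists_isCompl_cover (lam : Dual ℂ H) : ∃ A B : Submodule (Ug L) (BP b lam),
    IsCompl A B ∧ IsProjectiveCover b lam A := by
  have h := finrank_hom_BP (b := b) (catO_irr (b := b) (μ := lam)) casimir_smul_irr
  rw [finrank_wtSpace_irr] at h
  have := Module.nontrivial_of_finrank_pos (h.symm ▸ Nat.one_pos)
  obtain ⟨π, hπ⟩ := exists_ne (0 : BP b lam →ₗ[Ug L] Irr b lam)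
  exact exists_cover_summand isProjectiveO_BP hπ

theorem IsProjectiveCover.exists_stdF {lam : Dual ℂ H} (hP : IsProjectiveCover b lam P) :
    ∃ l, StdF b l P := by
  obtain ⟨A, B, hAB, hA⟩ := exists_isCompl_cover (b := b) lam
  obtain ⟨l, hl⟩ := exists_stdF_BP (b := b) (lam := lam)
  obtain ⟨l₁, -, h₁, -⟩ := exists_stdF_isCompl hl catO_BP hAB
  obtain ⟨e⟩ := hA.exists_equiv hP
  exact ⟨l₁, h₁.congr e⟩

end Covers

/-! ### BGG reciprocity by induction over the weights above. -/

section Reciprocity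

open Classical in
variable (b X) in
/-- The multiplicities in Verma filtrations of `X` are given by homomorphisms to Verma modules. -/
def Recip : Prop :=
  ∀ l, StdF b l X → ∀ μ : Dual ℂ H, l.count μ = finrank ℂ (X →ₗ[Ug L] Verma b μ)

theorem Recip.of_equiv (h : Recip b X) (e : X ≃ₗ[Ug L] P) : Recip b P := fun l hl μ => by
  rw [h l (hl.congr e.symm) μ, finrank_hom_congr_left e]

theorem Recip.of_isCompl (hX : IsCategoryO b X) {A B : Submodule (Ug L) X} (hAB : IsCompl A B)
    (hA : Recip b A) (hB : Recip b B) : Recip b X := fun l hl μ => by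
  classical
  obtain ⟨l₁, l₂, h₁, h₂, hp⟩ := exists_stdF_isCompl hl hX hAB
  rw [finrank_hom_isCompl hX isFin_verma hAB, ← hp.count_eq, List.count_append, hA l₁ h₁ μ,
    hB l₂ h₂ μ]

theorem Recip.left_of_isCompl (hX : IsCategoryO b X) {A B : Submodule (Ug L) X} (hAB : IsCompl A B)
    {l : List (Dual ℂ H)} (hl : StdF b l X) (h : Recip b X) (hB : Recip b B) : Recip b A :=
    fun l' hl' μ => by
  classical
  obtain ⟨l₁, l₂, h₁, h₂, hp⟩ := exists_stdF_isCompl hl hX hAB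
  obtain ⟨-, hW, hbdd⟩ := isCategoryO_iff.mp (catO_sub hX A)
  have h₃ := h l hl μ
  rw [finrank_hom_isCompl hX isFin_verma hAB, ← hp.count_eq, List.count_append, hB l₂ h₂ μ] at h₃
  rw [(hl'.perm h₁ hW hbdd).count_eq]
  omega

theorem exists_hom_irr_ne_zero (hX : IsCategoryO b X) [Nontrivial X] :
    ∃ (ν : Dual ℂ H) (π : X →ₗ[Ug L] Irr b ν), π ≠ 0 := by
  have := hX.1
  obtain ⟨Y, hY, -⟩ := (eq_top_or_exists_le_coatom (⊥ : Submodule (Ug L) X)).resolve_left bot_ne_top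
  have : IsSimpleModule (Ug L) (X ⧸ Y) := isSimpleModule_iff_isCoatom.mpr hY
  obtain ⟨ν, ⟨e⟩⟩ := exists_equiv_irr (catO_quotient hX Y)
  refine ⟨ν, e.toLinearMap ∘ₗ Y.mkQ, fun h => hY.1 (eq_top_iff.mpr fun x _ => ?_)⟩
  have h₁ := LinearMap.congr_fun h x
  have h₂ : Y.mkQ x = 0 := e.injective (h₁.trans (map_zero e).symm)
  rwa [Submodule.mkQ_apply, Submodule.Quotient.mk_eq_zero] at h₂

/-- Split off covers of simple quotients one at a time; a cover is nonzero, so the Verma filtration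
of the complement is shorter. -/
theorem recip_of_tops {l : List (Dual ℂ H)} (hl : StdF b l X) (hX : IsProjectiveO b X)
    (h : ∀ (ν : Dual ℂ H) (f : X →ₗ[Ug L] Irr b ν), f ≠ 0 → ∀ (P : Type u) [AddCommGroup P]
      [Module ℂ P] [Module (Ug L) P] [IsScalarTower ℂ (Ug L) P], IsProjectiveCover b ν P →
        Recip b P) : Recip b X := by
  obtain ⟨n, hn⟩ : ∃ n, l.length = n := ⟨_, rfl⟩
  induction n using Nat.strong_induction_on generalizing X l with
  | _ n ih =>
    rcases subsingleton_or_nontrivial X with hs | hs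
    · classical
      intro l' hl' μ
      rw [hl'.nil_of_subsingleton, List.count_nil, finrank_zero_of_subsingleton]
    obtain ⟨ν, π, hπ⟩ := exists_hom_irr_ne_zero hX.1
    obtain ⟨A, B, hAB, hA⟩ := exists_cover_summand hX hπ
    refine Recip.of_isCompl hX.1 hAB (h ν π hπ A hA) ?_
    obtain ⟨l₁, l₂, h₁, h₂, hp⟩ := exists_stdF_isCompl hl hX.1 hAB
    have h₃ := hp.length_eq
    rw [List.length_append, hn] at h₃
    have h₄ : l₁.length ≠ 0 := by
      intro h₄
      rw [List.length_eq_zero_iff] at h₄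
      subst h₄
      have h₅ : Subsingleton A := h₁
      have h₆ := hA.finrank_hom_irr
      rw [finrank_zero_of_subsingleton] at h₆
      exact zero_ne_one h₆
    refine ih l₂.length (by omega) h₂ (hX.of_isCompl hAB.symm) (fun κ f hf => ?_) rfl
    refine h κ (f ∘ₗ B.projectionOnto A hAB.symm) fun hf₀ => hf (LinearMap.ext fun x => ?_)
    obtain ⟨y, rfl⟩ := Submodule.projectionOnto_surjective hAB.symm x
    exact LinearMap.congr_fun hf₀ y

/-- Reciprocity for projective covers. -/
theorem IsProjectiveCover.recip {lam : Dual ℂ H} (hP : IsProjectiveCover b lam P) :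
    Recip b P := by
  classical
  -- The induction is on the number of weights weakly above `lam` with its Casimir scalar, a set
  -- which shrinks strictly on passing to a larger such weight.
  let S : Dual ℂ H → Set (Dual ℂ H) := fun lam =>
    {ν | ν - lam ∈ Qpos b ∧ casScalar b ν = casScalar b lam}
  have hS : ∀ lam, (S lam).Finite := fun lam =>
    ((finite_casScalar_add (b := b) lam (casScalar b lam)).image fun β => lam + β).subset
      fun ν hν => ⟨ν - lam, ⟨hν.1, by rw [add_sub_cancel]; exact hν.2⟩, add_sub_cancel _ _⟩
  obtain ⟨n, hn⟩ : ∃ n, (S lam).ncard = n := ⟨_, rfl⟩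
  induction n using Nat.strong_induction_on generalizing lam P with
  | _ n ih =>
    obtain ⟨A, B, hAB, hA⟩ := exists_isCompl_cover (b := b) lam
    obtain ⟨e⟩ := hA.exists_equiv hP
    refine Recip.of_equiv (X := A) ?_ e
    obtain ⟨l, hl⟩ := exists_stdF_BP (b := b) (lam := lam)
    obtain ⟨l₁, l₂, h₁, h₂, -⟩ := exists_stdF_isCompl hl catO_BP hAB
    refine Recip.left_of_isCompl catO_BP hAB hl (fun l' hl' μ => count_stdF_BP hl' μ) ?_
    refine recip_of_tops h₂ (isProjectiveO_BP.of_isCompl hAB.symm) fun ν f hf Q _ _ _ _ hQ => ?_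
    have hf' : f ∘ₗ B.projectionOnto A hAB.symm ≠ 0 := fun hf₀ => hf (LinearMap.ext fun x => by
      obtain ⟨y, rfl⟩ := Submodule.projectionOnto_surjective hAB.symm x
      exact LinearMap.congr_fun hf₀ y)
    have hcas : casScalar b ν = casScalar b lam := by
      by_contra hne
      exact hf' (hom_BP_eq_zero hne casimir_smul_irr _)
    -- A nonzero map from `BP` does not kill its generator, so `lam` is a weight of `Irr b ν`.
    have hwt : ν - lam ∈ Qpos b := by
      refine sub_mem_of_wtSpace_irr ((Submodule.ne_bot_iff _).mpr
        ⟨_, map_mem_wtSpace (f ∘ₗ B.projectionOnto A hAB.symm) bgen_mem, fun h => hf' ?_⟩)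
      exact BP.hom_ext h
    -- Homomorphisms from `BP` to `Irr b lam` form a line, already used up by the summand `A`.
    have hne : ν ≠ lam := by
      rintro rfl
      have h₃ := finrank_hom_BP (b := b) (catO_irr (b := b) (μ := ν)) casimir_smul_irr
      rw [finrank_wtSpace_irr, finrank_hom_isCompl catO_BP (isFin_of_catO catO_irr) hAB,
        hA.finrank_hom_irr] at h₃
      have := finiteDimensional_hom (catO_sub (catO_BP (b := b) (lam := ν)) B)
        (isFin_of_catO (catO_irr (b := b) (μ := ν)))
      have h₄ : finrank ℂ (B →ₗ[Ug L] Irr b ν) = 0 := by omega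
      exact hf ((finrank_zero_iff_forall_zero.mp h₄) f)
    refine ih _ ?_ hQ rfl
    rw [← hn]
    refine Set.ncard_lt_ncard ⟨fun κ hκ => ⟨?_, hκ.2.trans hcas⟩, fun hle => ?_⟩ (hS lam)
    · have := add_mem hκ.1 hwt
      rwa [sub_add_sub_cancel] at this
    · have h₅ : lam ∈ S ν := hle ⟨by rw [sub_self]; exact zero_mem _, rfl⟩
      exact hne (eq_of_sub_mem_Qpos hwt h₅.1)

open Classical in
theorem IsProjectiveCover.count_eq {lam : Dual ℂ H} (hP : IsProjectiveCover b lam P)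
    {l : List (Dual ℂ H)} (hl : StdF b l P) (μ : Dual ℂ H) :
    l.count μ = jhMult (Ug L) (Verma b μ) (Irr b lam) := by
  rw [hP.recip l hl μ, hP.finrank_hom catO_verma]

/-- Exactness of Hom(P, -) reduces to the Verma factors; applied to another cover, this is the
formula for the Cartan matrix. -/
theorem IsProjectiveCover.finrank_hom_stdF {lam : Dual ℂ H} (hP : IsProjectiveCover b lam P)
    {l : List (Dual ℂ H)} (hl : StdF b l X) (hX : IsCategoryO b X) :
    finrank ℂ (P →ₗ[Ug L] X) = (l.map fun κ => jhMult (Ug L) (Verma b κ) (Irr b lam)).sum := by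
  induction l generalizing X with
  | nil =>
    have : Subsingleton X := hl
    rw [List.map_nil, List.sum_nil, finrank_zero_of_subsingleton]
  | cons μ l ih =>
    obtain ⟨Y, ⟨e⟩, hY⟩ := hl
    rw [finrank_hom_add hP.1 hX Y, ih hY (catO_quotient hX Y), finrank_hom_congr_right e,
      hP.finrank_hom catO_verma, List.map_cons, List.sum_cons]

end Reciprocity

end CatO
end

theorem mainTheorem10 {L : Type u} [LieRing L] [LieAlgebra ℂ L] [FiniteDimensional ℂ L]
    [LieAlgebra.IsSemisimple ℂ L] (H : LieSubalgebra ℂ L) [H.IsCartanSubalgebra]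
    (b : (LieAlgebra.IsKilling.rootSystem H).Base) :
    -- Verma modules have finite length, and every `L_lam` has a projective cover in `O`
    (∀ μ : Module.Dual ℂ H, IsFiniteLength (CatO.Ug L) (CatO.Verma b μ)) ∧
    (∀ lam : Module.Dual ℂ H, ∃ (P : Type u) (_ : AddCommGroup P) (_ : Module (CatO.Ug L) P),
      CatO.IsProjectiveCover b lam P) ∧
    -- projective covers are standardly filtered, and BGG reciprocity holds
    (∀ (lam : Module.Dual ℂ H) (P : Type u) [AddCommGroup P] [Module (CatO.Ug L) P],
      CatO.IsProjectiveCover b lam P →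
        Nonempty (CatO.StandardFiltration b P) ∧
        ∀ (F : CatO.StandardFiltration b P) (μ : Module.Dual ℂ H),
          F.mult μ = CatO.jhMult (CatO.Ug L) (CatO.Verma b μ) (CatO.Irr b lam)) ∧
    -- the columns of `D` are finite, and the Cartan matrix is `C = Dᵀ D`
    (∀ lam : Module.Dual ℂ H, {ν : Module.Dual ℂ H | CatO.decompMatrix b ν lam ≠ 0}.Finite) ∧
    (∀ (lam μ : Module.Dual ℂ H) (P Q : Type u) [AddCommGroup P] [Module (CatO.Ug L) P]
      [AddCommGroup Q] [Module (CatO.Ug L) Q] [Module ℂ Q] [IsScalarTower ℂ (CatO.Ug L) Q],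
      CatO.IsProjectiveCover b lam P → CatO.IsProjectiveCover b μ Q →
        FiniteDimensional ℂ (P →ₗ[CatO.Ug L] Q) ∧
        Module.finrank ℂ (P →ₗ[CatO.Ug L] Q) =
          ∑ᶠ ν : Module.Dual ℂ H,
            (CatO.decompMatrix b).transpose lam ν * CatO.decompMatrix b ν μ) := by
  classical
  refine ⟨fun μ => ?_, fun lam => ?_, fun lam P _ _ hP => ?_, fun lam => ?_, ?_⟩
  · have h := CatO.isFin_verma (b := b) (μ := μ)
    exact isFiniteLength_iff_isNoetherian_isArtinian.mpr ⟨h.1, h.2.1⟩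
  · obtain ⟨A, -, -, hA⟩ := CatO.exists_isCompl_cover (b := b) lam
    exact ⟨A, inferInstance, inferInstance, hA⟩
  · let _ : Module ℂ P := Module.compHom P (algebraMap ℂ (CatO.Ug L))
    have := CatO.compHom_isScalarTower (L := L) P
    obtain ⟨l, hl⟩ := hP.exists_stdF
    refine ⟨hl.nonempty_standardFiltration, fun F μ => ?_⟩
    obtain ⟨l', hl', hF⟩ := F.exists_stdF
    rw [← hF μ, hP.count_eq hl']
  · obtain ⟨A, -, -, hA⟩ := CatO.exists_isCompl_cover (b := b) lam
    obtain ⟨l, hl⟩ := hA.exists_stdF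
    refine l.toFinset.finite_toSet.subset fun ν hν => ?_
    have hν' : CatO.jhMult (CatO.Ug L) (CatO.Verma b ν) (CatO.Irr b lam) ≠ 0 := hν
    rw [← hA.count_eq hl, ne_eq, List.count_eq_zero, not_not] at hν'
    exact List.mem_toFinset.mpr hν'
  · intro lam μ P Q _ _ _ _ _ _ hP hQ
    let _ : Module ℂ P := Module.compHom P (algebraMap ℂ (CatO.Ug L))
    have := CatO.compHom_isScalarTower (L := L) P
    obtain ⟨l, hl⟩ := hQ.exists_stdF
    refine ⟨CatO.finiteDimensional_hom hP.1.1 (CatO.isFin_of_catO hQ.1.1), ?_⟩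
    -- Grouping equal entries of the list turns the sum into one over weights; the list also
    -- contains the support of the finitary sum, by reciprocity for `Q`.
    rw [hP.finrank_hom_stdF hl hQ.1.1, Finset.sum_list_map_count,
      finsum_eq_sum_of_support_subset (s := l.toFinset)]
    · refine Finset.sum_congr rfl fun ν _ => ?_
      rw [hQ.count_eq hl, smul_eq_mul, mul_comm]
      rfl
    · intro ν hν
      have hν' := right_ne_zero_of_mul (Function.mem_support.mp hν)
      have hν'' : CatO.jhMult (CatO.Ug L) (CatO.Verma b ν) (CatO.Irr b μ) ≠ 0 := hν'
      rw [← hQ.count_eq hl, ne_eq, List.count_eq_zero, not_not] at hν''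
      exact List.mem_toFinset.mpr hν''
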